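/- **Setting.** Let $D\subset\mathbb R^d$ be open and bounded, $U=\mathbb R^N$, $1\le p<\infty$, $0<T<\infty$, and let $f=(f^1,\dots,f^d)$, $f^m:U\to U$, satisfy $|f^m(u)|\le C(1+|u|^p)$ and $|f^m(u)-f^m(v)|\le C|u-v|\max(|u|,|v|)^{p-1}$. *Correlation measures.* A correlation measure $\nu=(\nu^k)_{k\ge1}$ is a family of Young measures $\nu^k:D^k\to\mathcal P(U^k)$ that is symmetric ($\nu^k_{\sigma(x)}$ is the image of $\nu^k_x$ under $\xi\mapsto\sigma(\xi)$), consistent ($\nu^{k}_{x_1,\dots,x_k}$ is the marginal of $\nu^{k+1}_{x_1,\dots,x_{k+1}}$), has $\int_D\langle\nu^1_x,|\xi|^p\rangle dx<\infty$ and is diagonally continuous: $\omega^p_r(\nu^2)=\int_D\frac1{|B_r(x)\cap D|}\int_{B_r(x)\cap D}\langle\nu^2_{x,y},|\xi_1-\xi_2|^p\rangle\,dy\,dx\to0$ as $r\to0$. It is dual to $\mu\in\mathcal P(L^p(D;U))$ if $\int_{D^k}\langle\nu^k_x,g(x)\rangle dx=\int_{L^p}\int_{D^k}g(x,u(x_1),\dots,u(x_k))\,dx\,d\mu(u)$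 for all $k$ and all $g\in L^1(D^k;C_0(U^k))$. A time-dependent correlation measure is a family of Young measures $\nu^k_{t,x}$ on $[0,T)\times D^k$ such that $\nu_t$ is a correlation measure for a.e. $t$, $\operatorname{ess\,sup}_t\int_D\langle\nu^1_{t,x},|\xi|^p\rangle dx<\infty$, and $\int_0^{T'}\omega_r^p(\nu^2_t)\,dt\to0$ as $r\to0$ for all $T'\in(0,T)$. $\mathcal P_T(L^p(D;U))$ is the set of maps $\mu:[0,T)\to\mathcal P(L^p(D;U))$ such that, for some time-dependent correlation measure $\nu$, $\mu_t$ is dual to $\nu_t$ for a.e. $t$. *Strong convergence.* $\mathcal H^{k,p}$ is the set of Carathéodory functions $g(t,x,\xi)$ on $[0,T)\times D^k\times U^k$ with $|g(t,x,\xi)|\le\sum_{\alpha\in\{0,1\}^k}\phi_{k-|\alpha|}\bigl(t,(x_j)_{\alpha_j=0}\bigr)\prod_{\alpha_j=1}|\xi_j|^p$ for some $0\le\phi_i\in L^\infty([0,T);L^1(D^i))$, and $\mathcal H^{k,p}_1$ is the set of $g\in\mathcal H^{k,p}$ such that, for some $r>0$, $0\le\psi\in L^\infty([0,T))$ and $0\le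 h\in\mathcal H^{k-1,p}$, $|g(t,x,\zeta)-g(t,y,\xi)|\le\psi(t)\sum_{i=1}^k|\zeta_i-\xi_i|\max(|\xi_i|,|\zeta_i|)^{p-1}h(t,\hat x^i,\hat\xi^i)$ whenever $x,y\in D^k$, $|x-y|<r$, $\xi,\zeta\in U^k$ (a hat with superscript $i$ omits the $i$-th entry). A sequence $\mu_n\in\mathcal P_T(L^p(D;U))$ converges strongly to $\mu\in\mathcal P_T(L^p(D;U))$ if there is $M$ with $\|u\|_{L^p}\le M$ for $\mu_{n,t}$-a.e. $u$, for all $n$ and a.e. $t$, and if the corresponding correlation measures satisfy $\int_{D^k}\bigl|\int_0^T\langle\nu^k_{n;t,x}-\nu^k_{t,x},g(t,x)\rangle\,dt\bigr|\,dx\to0$ for all $k\ge1$ and $g\in\mathcal H^{k,p}_1$. *Scheme.* Let $\Delta_n>0$, $\Delta_n\to0$. For $\Delta=\Delta_n$, the mesh consists of those cells $\mathcal C_i$, $i\in\mathbb Z^d$, of a Cartesian grid of width $\Delta$ that lie in $D$; $\langle u\rangle_i$ is the average of $u$ over $\mathcal C_i$. Let $q\ge1$ and let $F^{m,\Delta}:U^{2q}\to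 U$ ($m=1,\dots,d$) be locally Lipschitz numerical fluxes such that, for every bounded $B\subset U$, there is $C$, independent of $\Delta=\Delta_n$, with $|F^{m,\Delta}(w_{1-q},\dots,w_q)-f^m(w_0)|\le C\sum_{j=1-q}^q|w_0-w_j|$ for all $w_{1-q},\dots,w_q\in B$, and such that $|F^{m,\Delta}(w)|\le C(1+\sum_j|w_j|^p)$ for all $w\in U^{2q}$, with $C$ independent of $\Delta$. Let $\mathcal S^\Delta_t:L^p(D;U)\to L^p(D;U)$, $0\le t<T$, be the (measurable) evolution operators of the semi-discrete finite volume scheme $$\frac{d}{dt}u_i+\sum_{m=1}^d\frac1\Delta\Bigl(F^{m,\Delta}(u_{i-(q-1)e_m},\dots,u_{i+qe_m})-F^{m,\Delta}(u_{i-qe_m},\dots,u_{i+(q-1)e_m})\Bigr)=0,\qquad u_i(0)=\langle\bar u\rangle_i,$$ for all cells $\mathcal C_i\subset D$ (with any boundary closure, i.e. any values in the cells not contained in $D$), so that $\mathcal S^\Delta_t\bar u=u_i(t)$ on $\mathcal C_i\subset D$. **Theorem (Lax–Wendroff theorem for statistical solutions).** Let $\bar\mu\in\mathcal P(L^p(D;U))$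 have bounded support, $\|u\|_{L^p}\le K$ for $\bar\mu$-a.e. $u$, and let $\mu^{\Delta_n}_t=\mathcal S^{\Delta_n}_t\#\bar\mu$. Assume that $\mu^{\Delta_n}$ converges strongly to $\mu$ in $\mathcal P_T(L^p(D;U))$ and that, for some $s>0$ and some $C$, for all $\Delta=\Delta_n$, $$\Delta^d\int_0^T\int_{L^p}\sum_{m=1}^d\sum_i\bigl|\langle u\rangle_i-\langle u\rangle_{i-e_m}\bigr|^s\,d\mu^\Delta_t(u)\,dt\le C\Delta,$$ the sum being over all $i$ with $\mathcal C_i,\mathcal C_{i-e_m}\subset D$. Then $\mu$ is a statistical solution of $\partial_tu+\nabla_x\cdot f(u)=0$ with initial data $\bar\mu$: for a.e. $t\in[0,T)$ the measure $\mu_t$ has bounded support, and, with $\nu$ and $\bar\nu$ the correlation measures corresponding to $\mu$ and $\bar\mu$, for every $k$ the moments below are integrable and $$\int_0^T\!\!\int_{D^k}\langle\nu^k_{t,x},\xi_1\otimes\cdots\otimes\xi_k\rangle:\partial_t\phi+\sum_{i=1}^k\langle\nu^k_{t,x},\xi_1\otimes\cdots\otimes f(\xi_i)\otimes\cdots\otimes\xi_k\rangle:\nabla_{x_i}\phi\,dx\,dt+\int_{D^k}\langle\bar\nu^k_x,\xi_1\otimes\cdots\otimes\xi_k\rangle:\phi|_{t=0}\,dx=0$$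 for all $\phi\in C_c^\infty(D^k\times[0,T);U^{\otimes k})$. -/

import Mathlib

open MeasureTheory ProbabilityTheory Set Filter Topology
open scoped ENNReal NNReal ZeroAtInfty

noncomputable section

namespace LaxWendroff

/-- `ℝⁿ` with the Euclidean norm. -/
abbrev Vec (n : ℕ) : Type := EuclideanSpace ℝ (Fin n)

/-- The phase space `L^p(D; U)` with `U = ℝ^N`. -/
abbrev LpSpace (d N : ℕ) (p : ℝ≥0∞) (D : Set (Vec d)) : Type :=
  Lp (Vec N) p ((volume : Measure (Vec d)).restrict D)

/-- Measures on `L^p(D; U)` are Borel measures for the norm topology. -/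
instance instMeasurableSpaceLpSpace {d N : ℕ} {p : ℝ≥0∞} [Fact (1 ≤ p)] {D : Set (Vec d)} :
    MeasurableSpace (LpSpace d N p D) := borel _

instance instBorelSpaceLpSpace {d N : ℕ} {p : ℝ≥0∞} [Fact (1 ≤ p)] {D : Set (Vec d)} :
    BorelSpace (LpSpace d N p D) := ⟨rfl⟩

/-- `D^k` as a subset of `(ℝ^d)^k`. -/
def domPow {d : ℕ} (D : Set (Vec d)) (k : ℕ) : Set (Fin k → Vec d) := Set.univ.pi fun _ => D

/-! ### Correlation measures -/

/-- A family `(ν^k)_k` of maps from `(ℝ^d)^k` to measures on `U^k` (only the values on `D^k`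
matter). -/
abbrev CorrFamily (d N : ℕ) : Type := ∀ k : ℕ, Kernel (Fin k → Vec d) (Fin k → Vec N)

/-- A family `(ν^k)_k` of maps from `ℝ × (ℝ^d)^k` to measures on `U^k` (only the values on
`[0,T) × D^k` matter). -/
abbrev TimeCorrFamily (d N : ℕ) : Type := ∀ k : ℕ, Kernel (ℝ × (Fin k → Vec d)) (Fin k → Vec N)

/-- The family `(ν^k_t)_k` at a fixed time `t`. -/
def TimeCorrFamily.slice {d N : ℕ} (ν : TimeCorrFamily d N) (t : ℝ) : CorrFamily d N :=
  fun k => (ν k).sectR t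

/-- `∫_D ⟨ν^1_x, |ξ|^p⟩ dx`. -/
def lpMoment {d N : ℕ} (D : Set (Vec d)) (p : ℝ) (ν : CorrFamily d N) : ℝ≥0∞ :=
  ∫⁻ x in D, ∫⁻ ξ, ‖ξ 0‖ₑ ^ p ∂(ν 1 fun _ => x)

/-- The modulus of continuity `ω_r^p(ν²) = ∫_D ⨍_{B_r(x)} ⟨ν²_{x,y}, |ξ₁ - ξ₂|^p⟩ dy dx`; the
average is over the part of the ball that lies in `D`. -/
def modCont {d N : ℕ} (D : Set (Vec d)) (p : ℝ) (ν : CorrFamily d N) (r : ℝ) : ℝ≥0∞ :=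
  ∫⁻ x in D, ⨍⁻ y in Metric.ball x r ∩ D, (∫⁻ ξ, ‖ξ 0 - ξ 1‖ₑ ^ p ∂(ν 2 ![x, y])) ∂volume

/-- Correlation measures on `D`. A Young measure (defined a.e. on `D^k`) is represented by a
Markov kernel. -/
structure IsCorrelationMeasure {d N : ℕ} (D : Set (Vec d)) (p : ℝ) (ν : CorrFamily d N) :
    Prop where
  markov : ∀ k, IsMarkovKernel (ν k)
  symmetric : ∀ (k : ℕ) (σ : Equiv.Perm (Fin k)), ∀ᵐ x ∂volume.restrict (domPow D k),
    ν k (x ∘ σ) = (ν k x).map fun ξ => ξ ∘ σ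
  consistent : ∀ k : ℕ, ∀ᵐ x ∂volume.restrict (domPow D (k + 1)),
    (ν (k + 1) x).map (fun ξ (j : Fin k) => ξ j.castSucc) = ν k fun j => x j.castSucc
  integrable : lpMoment D p ν < ∞
  diagonal : Tendsto (modCont D p ν) (𝓝[>] 0) (𝓝 0)

/-- Time-dependent correlation measures on `[0,T) × D`. -/
structure IsTimeCorrelationMeasure {d N : ℕ} (D : Set (Vec d)) (T p : ℝ)
    (ν : TimeCorrFamily d N) : Prop where
  markov : ∀ k, IsMarkovKernel (ν k)
  slice : ∀ᵐ t ∂volume.restrict (Ico 0 T), IsCorrelationMeasure D p (ν.slice t)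
  integrable : ∃ c : ℝ≥0, ∀ᵐ t ∂volume.restrict (Ico 0 T), lpMoment D p (ν.slice t) ≤ c
  diagonal : ∀ T' ∈ Ioo 0 T,
    Tendsto (fun r => ∫⁻ t in Ico 0 T', modCont D p (ν.slice t) r) (𝓝[>] 0) (𝓝 0)

/-- Duality of a measure on `L^p(D; U)` and a correlation measure: for every
`g ∈ L^1(D^k; C_0(U^k))`,
`∫_{D^k} ⟨ν^k_x, g(x)⟩ dx = ∫_{L^p} ∫_{D^k} g(x, u(x₁), …, u(x_k)) dx dμ(u)`. -/
def IsDual {d N : ℕ} {p : ℝ≥0∞} [Fact (1 ≤ p)] {D : Set (Vec d)}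
    (μ : Measure (LpSpace d N p D)) (ν : CorrFamily d N) : Prop :=
  ∀ (k : ℕ) (g : (Fin k → Vec d) → C₀(Fin k → Vec N, ℝ)),
    Integrable g (volume.restrict (domPow D k)) →
      ∫ x in domPow D k, ∫ ξ, g x ξ ∂(ν k x) =
        ∫ u, (∫ x in domPow D k, g x fun j => u (x j)) ∂μ

/-- `ν` is the time-dependent correlation measure corresponding to `μ : [0,T) → P(L^p(D; U))`. -/
structure Corresponds {d N : ℕ} {p : ℝ≥0∞} [Fact (1 ≤ p)] {D : Set (Vec d)} (T : ℝ)
    (μ : ℝ → Measure (LpSpace d N p D)) (ν : TimeCorrFamily d N) : Prop where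
  isTimeCorrelationMeasure : IsTimeCorrelationMeasure D T p.toReal ν
  isDual : ∀ᵐ t ∂volume.restrict (Ico 0 T), IsDual (μ t) (ν.slice t)

/-- The space `P_T(L^p(D; U))` of maps `[0,T) → P(L^p(D; U))` that are dual to some time-dependent
correlation measure. -/
structure MemPT {d N : ℕ} {p : ℝ≥0∞} [Fact (1 ≤ p)] {D : Set (Vec d)} (T : ℝ)
    (μ : ℝ → Measure (LpSpace d N p D)) : Prop where
  isProbabilityMeasure : ∀ t ∈ Ico 0 T, IsProbabilityMeasure (μ t)
  exists_corresponds : ∃ ν : TimeCorrFamily d N, Corresponds T μ ν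

/-! ### Observables and strong convergence -/

/-- Nonnegative elements of `L^∞([0,T); L^1(D^i))`. -/
structure IsBoundedL1 {d : ℕ} (D : Set (Vec d)) (T : ℝ) (i : ℕ)
    (φ : ℝ → (Fin i → Vec d) → ℝ) : Prop where
  measurable : Measurable fun z : ℝ × (Fin i → Vec d) => φ z.1 z.2
  nonneg : ∀ t x, 0 ≤ φ t x
  bounded : ∃ c : ℝ≥0, ∀ᵐ t ∂volume.restrict (Ico 0 T),
    ∫⁻ x in domPow D i, ENNReal.ofReal (φ t x) ≤ c

/-- The class `H^{k,p}([0,T), D; U)` of Carathéodory functions with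
`|g(t,x,ξ)| ≤ ∑_{α ∈ {0,1}^k} φ_{|ᾱ|}(t, x_ᾱ) |ξ^α|^p`; the multiindex `α` is given by the set
`A` of the positions with `α_j = 1`. -/
structure MemH {d N : ℕ} (D : Set (Vec d)) (T p : ℝ) (k : ℕ)
    (g : ℝ → (Fin k → Vec d) → (Fin k → Vec N) → ℝ) : Prop where
  measurable : Measurable fun z : ℝ × (Fin k → Vec d) × (Fin k → Vec N) => g z.1 z.2.1 z.2.2
  continuous : ∀ᵐ z ∂(volume : Measure (ℝ × (Fin k → Vec d))).restrict (Ico 0 T ×ˢ domPow D k),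
    Continuous (g z.1 z.2)
  growth : ∃ φ : ∀ i : ℕ, ℝ → (Fin i → Vec d) → ℝ, (∀ i, IsBoundedL1 D T i (φ i)) ∧
    ∀ t ∈ Ico 0 T, ∀ x ∈ domPow D k, ∀ ξ : Fin k → Vec N,
      |g t x ξ| ≤ ∑ A : Finset (Fin k),
        φ Aᶜ.card t (fun j => x (Aᶜ.orderEmbOfFin rfl j)) * (∏ j ∈ A, ‖ξ j‖) ^ p

/-- The class `H^{k,p}_1([0,T), D; U)`, `k = n + 1`, of locally Lipschitz observables. -/
structure MemH1 {d N : ℕ} (D : Set (Vec d)) (T p : ℝ) (n : ℕ)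
    (g : ℝ → (Fin (n + 1) → Vec d) → (Fin (n + 1) → Vec N) → ℝ) : Prop where
  memH : MemH D T p (n + 1) g
  lipschitz : ∃ r : ℝ, 0 < r ∧
    ∃ h : ℝ → (Fin n → Vec d) → (Fin n → Vec N) → ℝ, MemH D T p n h ∧ (∀ t x ξ, 0 ≤ h t x ξ) ∧
    ∃ ψ : ℝ → ℝ, Measurable ψ ∧ (∀ t, 0 ≤ ψ t) ∧
      (∃ c : ℝ, ∀ᵐ t ∂volume.restrict (Ico 0 T), ψ t ≤ c) ∧
      ∀ t ∈ Ico 0 T, ∀ x ∈ domPow D (n + 1), ∀ y ∈ domPow D (n + 1) ∩ Metric.ball x r,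
        ∀ ξ ζ : Fin (n + 1) → Vec N,
          |g t x ζ - g t y ξ| ≤ ψ t * ∑ i, ‖ζ i - ξ i‖ * max ‖ξ i‖ ‖ζ i‖ ^ (p - 1) *
            h t (fun j => x (i.succAbove j)) (fun j => ξ (i.succAbove j))

/-- Strong convergence `μ_n → μ` in `P_T(L^p(D; U))`: the `μ_n` have uniformly bounded support,
and the corresponding correlation measures satisfy
`∫_{D^k} |∫_0^T ⟨ν^k_{n;t,x} - ν^k_{t,x}, g(t,x)⟩ dt| dx → 0`
for all `k ≥ 1` and all `g ∈ H^{k,p}_1([0,T), D; U)`. -/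
structure StronglyConverges {d N : ℕ} {p : ℝ≥0∞} [Fact (1 ≤ p)] {D : Set (Vec d)} (T : ℝ)
    (μn : ℕ → ℝ → Measure (LpSpace d N p D)) (μ : ℝ → Measure (LpSpace d N p D)) : Prop where
  memPT_seq : ∀ n, MemPT T (μn n)
  memPT_limit : MemPT T μ
  bounded : ∃ M : ℝ, ∀ n, ∀ᵐ t ∂volume.restrict (Ico 0 T), ∀ᵐ u ∂(μn n t), ‖u‖ ≤ M
  observables : ∃ (νn : ℕ → TimeCorrFamily d N) (ν : TimeCorrFamily d N),
    (∀ n, Corresponds T (μn n) (νn n)) ∧ Corresponds T μ ν ∧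
    ∀ (l : ℕ) (g : ℝ → (Fin (l + 1) → Vec d) → (Fin (l + 1) → Vec N) → ℝ),
      MemH1 D T p.toReal l g →
        Tendsto (fun n => ∫⁻ x in domPow D (l + 1),
          ‖∫ t in Ico 0 T, ((∫ ξ, g t x ξ ∂(νn n (l + 1) (t, x))) -
            ∫ ξ, g t x ξ ∂(ν (l + 1) (t, x)))‖ₑ) atTop (𝓝 0)

/-! ### Statistical solutions -/

/-- The entry with multiindex `I` of the tensor `ξ₁ ⊗ ⋯ ⊗ ξ_k ∈ U^{⊗k}`. -/
def tensorEntry {N k : ℕ} (ξ : Fin k → Vec N) (I : Fin k → Fin N) : ℝ := ∏ j, ξ j (I j)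

/-- The entry with multiindex `I` of `ξ₁ ⊗ ⋯ ⊗ f^m(ξ_i) ⊗ ⋯ ⊗ ξ_k`. -/
def fluxEntry {d N k : ℕ} (f : Fin d → Vec N → Vec N) (i : Fin k) (m : Fin d)
    (ξ : Fin k → Vec N) (I : Fin k → Fin N) : ℝ :=
  tensorEntry (Function.update ξ i (f m (ξ i))) I

/-- Test functions `φ ∈ C_c^∞(D^k × [0,T); U^{⊗k})`, smooth up to `t = 0`. -/
structure IsTestFunction {d N : ℕ} (D : Set (Vec d)) (T : ℝ) (k : ℕ)
    (φ : ℝ × (Fin k → Vec d) → (Fin k → Fin N) → ℝ) : Prop where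
  smooth : ContDiff ℝ (⊤ : ℕ∞) φ
  compact : HasCompactSupport φ
  support : tsupport φ ⊆ Iio T ×ˢ domPow D k

/-- The equation for the `k`-th correlation marginal,
`∂_t ⟨ν^k, ξ₁ ⊗ ⋯ ⊗ ξ_k⟩ + ∑_i ∇_{x_i} · ⟨ν^k, ξ₁ ⊗ ⋯ ⊗ f(ξ_i) ⊗ ⋯ ⊗ ξ_k⟩ = 0`,
in the sense of distributions with initial data `⟨ν̄^k, ξ₁ ⊗ ⋯ ⊗ ξ_k⟩`, together with the
integrability of all the moments in it. -/
structure MomentEquation {d N : ℕ} (D : Set (Vec d)) (T : ℝ) (f : Fin d → Vec N → Vec N)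
    (νbar : CorrFamily d N) (ν : TimeCorrFamily d N) (k : ℕ) : Prop where
  integrable_initial : ∀ I : Fin k → Fin N,
    Integrable (fun w : (Fin k → Vec d) × (Fin k → Vec N) => tensorEntry w.2 I)
      ((volume.restrict (domPow D k)) ⊗ₘ (νbar k))
  integrable_moment : ∀ I : Fin k → Fin N,
    Integrable (fun w : (ℝ × (Fin k → Vec d)) × (Fin k → Vec N) => tensorEntry w.2 I)
      ((volume.restrict (Ico 0 T ×ˢ domPow D k)) ⊗ₘ (ν k))
  integrable_flux : ∀ (i : Fin k) (m : Fin d) (I : Fin k → Fin N),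
    Integrable (fun w : (ℝ × (Fin k → Vec d)) × (Fin k → Vec N) => fluxEntry f i m w.2 I)
      ((volume.restrict (Ico 0 T ×ˢ domPow D k)) ⊗ₘ (ν k))
  equation : ∀ φ : ℝ × (Fin k → Vec d) → (Fin k → Fin N) → ℝ, IsTestFunction D T k φ →
    (∫ z in Ico 0 T ×ˢ domPow D k, ∑ I : Fin k → Fin N,
      ((∫ ξ, tensorEntry ξ I ∂(ν k z)) * fderiv ℝ φ z (1, 0) I +
        ∑ i : Fin k, ∑ m : Fin d, (∫ ξ, fluxEntry f i m ξ I ∂(ν k z)) *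
          fderiv ℝ φ z (0, Pi.single i (EuclideanSpace.single m 1)) I)) +
    ∫ x in domPow D k, ∑ I : Fin k → Fin N,
      (∫ ξ, tensorEntry ξ I ∂(νbar k x)) * φ (0, x) I = 0

/-- `μ` is a statistical solution on `[0,T)` of `∂_t u + ∇_x · f(u) = 0` with initial data
`μbar`. As elements of `P_T(L^p(D; U))` are determined up to null sets of times, the bounded
support of `μ_t` is required for almost every `t`. -/
structure IsStatisticalSolution {d N : ℕ} {p : ℝ≥0∞} [Fact (1 ≤ p)] {D : Set (Vec d)} (T : ℝ)
    (f : Fin d → Vec N → Vec N) (μbar : Measure (LpSpace d N p D))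
    (μ : ℝ → Measure (LpSpace d N p D)) : Prop where
  bounded_initial : ∃ M : ℝ, ∀ᵐ u ∂μbar, ‖u‖ ≤ M
  memPT : MemPT T μ
  bounded : ∀ᵐ t ∂volume.restrict (Ico 0 T), ∃ M : ℝ, ∀ᵐ u ∂(μ t), ‖u‖ ≤ M
  moments : ∀ (νbar : CorrFamily d N) (ν : TimeCorrFamily d N),
    IsCorrelationMeasure D p.toReal νbar → IsDual μbar νbar → Corresponds T μ ν →
      ∀ k : ℕ, MomentEquation D T f νbar ν k

/-! ### The finite volume scheme -/

/-- The cell with index `i` of the equidistant mesh of width `Δ` with base point `a`. -/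
def cell {d : ℕ} (a : Vec d) (Δ : ℝ) (i : Fin d → ℤ) : Set (Vec d) :=
  {x | ∀ m, a m + Δ * i m < x m ∧ x m < a m + Δ * (i m + 1)}

/-- The indices of the cells contained in `D`. -/
def mesh {d : ℕ} (D : Set (Vec d)) (a : Vec d) (Δ : ℝ) : Set (Fin d → ℤ) := {i | cell a Δ i ⊆ D}

/-- The local average of `u` over the cell with index `i`. -/
def cellAvg {d N : ℕ} (a : Vec d) (Δ : ℝ) (u : Vec d → Vec N) (i : Fin d → ℤ) : Vec N :=
  ⨍ x in cell a Δ i, u x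

/-- The stencil `(w_{i-(q-1)e_m}, …, w_{i+q e_m})` of a cell field `w`. -/
def stencil {d N : ℕ} (q : ℕ) (w : (Fin d → ℤ) → Vec N) (m : Fin d) (i : Fin d → ℤ) :
    Fin (2 * q) → Vec N :=
  fun j => w (i + Pi.single m ((j : ℤ) - q + 1))

/-- `S_t`, `0 ≤ t < T`, is the numerical evolution operator of the semi-discrete finite volume
scheme with numerical fluxes `F^m`: on the cells of the mesh `S_t u₀` is piecewise constant, its
cell values solve the scheme, and they start from the cell averages of `u₀`. The values in cells
outside the mesh, which enter through the stencils near the boundary, may be prescribed in any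
way (boundary conditions). -/
structure IsNumericalEvolution {d N : ℕ} {p : ℝ≥0∞} [Fact (1 ≤ p)] {D : Set (Vec d)} (T : ℝ)
    (a : Vec d) (Δ : ℝ) (q : ℕ) (F : Fin d → (Fin (2 * q) → Vec N) → Vec N)
    (S : ℝ → LpSpace d N p D → LpSpace d N p D) : Prop where
  measurable : ∀ t ∈ Ico 0 T, Measurable (S t)
  scheme : ∀ u₀ : LpSpace d N p D, ∃ v : ℝ → (Fin d → ℤ) → Vec N,
    (∀ t ∈ Ico 0 T, ∀ i ∈ mesh D a Δ, ∀ᵐ x ∂volume.restrict (cell a Δ i), S t u₀ x = v t i) ∧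
    (∀ i ∈ mesh D a Δ, v 0 i = cellAvg a Δ u₀ i) ∧
    ∀ t ∈ Ico 0 T, ∀ i ∈ mesh D a Δ,
      HasDerivWithinAt (fun τ => v τ i)
        (-∑ m, Δ⁻¹ • (F m (stencil q (v t) m i) - F m (stencil q (v t) m (i - Pi.single m 1))))
        (Ico 0 T) t

/-- `∑_m ∑_i |u_i - u_{i-e_m}|^s`, the sum over all pairs of neighbouring cells of the mesh. -/
def jumpSum {d N : ℕ} (D : Set (Vec d)) (a : Vec d) (Δ s : ℝ) (u : Vec d → Vec N) : ℝ≥0∞ :=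
  ∑ m : Fin d, ∑' i : {i : Fin d → ℤ // i ∈ mesh D a Δ ∧ i - Pi.single m 1 ∈ mesh D a Δ},
    ‖cellAvg a Δ u i.1 - cellAvg a Δ u (i.1 - Pi.single m 1)‖ₑ ^ s

end LaxWendroff

end

noncomputable section

namespace LaxWendroff

/-! ### Products over finitely many coordinates -/

/-! The argument is the classical one of Lax and Wendroff, applied for fixed initial datum u to
products of k point values and then averaged over `μbar`. Let V(t,u,x) be the piecewise constant
numerical solution and W_m(t,u,x) the numerical flux through the right face of the cell of x. Near
the support of a test function φ the scheme says that V has the time derivative −∑_m Δ⁻¹(W_m(x) −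
W_m(x − Δe_m)). The product rule for ∏_j V(t,u,x_j), integration in time against φ and a translation
of one variable x_l give an exact identity in which W_m replaces V in slot l and is tested with the
forward difference quotient of φ (`SemiDiscrete.weak_form`). It remains to let Δ → 0 in its three
kinds of terms.

Everything rests on a concrete form of duality: dx dν^k_x(ξ) is the image of dμ(u) dx under (u,x) ↦
(x,u(x_1),…,u(x_k)) (`compProd_eq_map_evalPow`). A k-point moment of a product is therefore an
average over u of a product of k one-point integrals. As the measures live on a ball of L^p, an
error in a single slot costs only a one-point integral of that error, times a constant.

Time derivative term. The observable ξ_1 ⊗ ⋯ ⊗ ξ_k is not directly admissible in strong convergence: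
for p > 1 the weight max(|ξ|,|ζ|)^(p−1) degenerates at the origin. Each factor is replaced by a
bounded function that is constant near 0 (`IsMomentFn.exists_approx`). The error is small away from
infinity, and the tails of |ξ|^p are small uniformly for large n, because max(|ξ|^p − R, 0) is
itself an admissible observable (`exists_tail_le`). Together with step functions in time this yields
`tendsto_integral_mul_prod`. The L^p bound needed for the limit comes from the correlations of all
orders: ∫ X^l dμ_t ≤ c^l for every l ≥ 1 forces X ≤ c almost everywhere
(`ae_le_of_lintegral_pow_le`, `timeDualBdd_limit`).

Flux term. Where the stencil values stay in a ball, consistency bounds W_m − f^m(V) by jumps of V,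
and x ≤ ε + Rε^(−s)x^s for 0 ≤ x ≤ R converts these into the s-th powers controlled by the weak BV
bound, whose integral is O(Δ). Where some stencil value is large, growth and the tail bound suffice.
So W_m − f^m(V) → 0 in L^1 (`SchemeLimit.tendsto_consistency`), the difference quotients of φ
converge uniformly, and the moments with f^m(V) in one slot converge as before.

Initial term. Cell averages converge to u in L^1 on compact subsets of D, for each u; dominated
convergence in u does the rest (`SchemeLimit.tendsto_initial_term`). Finally, two time-dependent
correlation measures dual to the same μ have the same joint law in (t,x,ξ), so the equation holds
for every representative. -/

lemma lintegral_pi_prod {X : Type*} [MeasurableSpace X] (m : Measure X) [SigmaFinite m] {n : ℕ}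
    (b : Fin n → X → ℝ≥0∞) (hb : ∀ i, Measurable (b i)) :
    ∫⁻ x, ∏ i, b i (x i) ∂(Measure.pi fun _ : Fin n => m) = ∏ i, ∫⁻ x, b i x ∂m := by
  induction n with
  | zero => simp
  | succ n ih =>
    have hmp := (measurePreserving_piFinSuccAbove (fun _ : Fin (n + 1) => m) 0).symm
    rw [← hmp.lintegral_comp_emb (MeasurableEquiv.measurableEmbedding _)]
    simp_rw [MeasurableEquiv.piFinSuccAbove_symm_apply, Fin.insertNthEquiv,
            Fin.prod_univ_succ, Fin.insertNth_zero, Equiv.coe_fn_mk, Fin.cons_succ,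
            Fin.cons_zero, cast_eq]
    rw [lintegral_prod_mul (hb 0).aemeasurable
      (g := fun y : Fin n → X => ∏ i : Fin n, b i.succ (y i))
      (Finset.measurable_fun_prod _ fun i _ =>
        (hb i.succ).comp (measurable_pi_apply i)).aemeasurable]
    congr 1
    exact ih (fun i => b i.succ) (fun i => hb _)

/-- Telescoping, one factor at a time. Each summand on the right is again a product of functions of
separate variables, so that its integral factorises later on. -/
lemma abs_prod_sub_prod_le {k : ℕ} (a b B : Fin k → ℝ) (ha : ∀ j, |a j| ≤ B j)
    (hb : ∀ j, |b j| ≤ B j) :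
    |∏ j, a j - ∏ j, b j| ≤ ∑ l, ∏ j, if j = l then |a l - b l| else B j := by
  induction k with
  | zero => simp
  | succ n ih =>
    have h := ih (fun j => a j.succ) (fun j => b j.succ) (fun j => B j.succ)
      (fun j => ha _) (fun j => hb _)
    have h1 : |∏ j : Fin n, a j.succ| ≤ ∏ j : Fin n, B j.succ := by
      rw [Finset.abs_prod]
      exact Finset.prod_le_prod (fun _ _ => abs_nonneg _) fun j _ => ha _
    simp only [Fin.prod_univ_succ, Fin.sum_univ_succ, if_true, Fin.succ_ne_zero, if_false,
      Fin.succ_inj, (Fin.succ_ne_zero _).symm, ← Finset.mul_sum]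
    have e : a 0 * ∏ j : Fin n, a j.succ - b 0 * ∏ j : Fin n, b j.succ =
      (a 0 - b 0) * ∏ j : Fin n, a j.succ +
        b 0 * (∏ j : Fin n, a j.succ - ∏ j : Fin n, b j.succ) := by ring
    rw [e]
    refine (abs_add_le _ _).trans ?_
    rw [abs_mul, abs_mul]
    exact add_le_add (mul_le_mul_of_nonneg_left h1 (abs_nonneg _))
      (mul_le_mul (hb 0) h (abs_nonneg _) ((abs_nonneg _).trans (hb 0)))

lemma measurableSet_domPow {d : ℕ} {D : Set (Vec d)} (hD : MeasurableSet D) (k : ℕ) :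
    MeasurableSet (domPow D k) :=
  MeasurableSet.univ_pi fun _ => hD

lemma volume_restrict_domPow {d : ℕ} (D : Set (Vec d)) (k : ℕ) :
    (volume : Measure (Fin k → Vec d)).restrict (domPow D k) =
      Measure.pi fun _ : Fin k => (volume : Measure (Vec d)).restrict D := by
  rw [volume_pi, domPow, Measure.restrict_pi_pi]

/-! ### A jointly measurable evaluation on `L^p` -/

/-- The representatives u ↦ `u x` are chosen separately for each class and need not be jointly
measurable. A jointly measurable version is a pointwise limit of elements of a countable dense
family, selected measurably in u and close enough to u that the convergence holds almost everywhere
in x. -/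
lemma exists_measurable_eval {d N : ℕ} {p : ℝ≥0∞} [Fact (1 ≤ p)] (hp : p ≠ ∞) (D : Set (Vec d)) :
    ∃ e : LpSpace d N p D × Vec d → Vec N, Measurable e ∧
      ∀ u : LpSpace d N p D, ∀ᵐ x ∂volume.restrict D, e (u, x) = u x := by
  have : Fact (p ≠ ∞) := ⟨hp⟩
  let s : ℕ → LpSpace d N p D := TopologicalSpace.denseSeq _
  have hex : ∀ (n : ℕ) (u : LpSpace d N p D), ∃ k, dist (s k) u < (1 / 2) ^ n / 2 := by
    intro n u
    obtain ⟨k, hk⟩ := (TopologicalSpace.denseRange_denseSeq (LpSpace d N p D)).exists_dist_lt u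
      (show (0 : ℝ) < (1 / 2) ^ n / 2 by positivity)
    exact ⟨k, by rwa [dist_comm]⟩
  classical
  -- The least index of a member of the dense sequence within 2⁻ⁿ/2 of u. The halving makes
  -- consecutive choices differ by less than 2⁻ⁿ, a summable bound that gives convergence almost
  -- everywhere.
  let ι : ℕ → LpSpace d N p D → ℕ := fun n u => Nat.find (hex n u)
  have hι : ∀ n, Measurable (ι n) := fun n => measurable_find _ fun k =>
    measurableSet_lt (measurable_const.dist measurable_id) measurable_const
  let e' : ℕ → LpSpace d N p D × Vec d → Vec N := fun n w => s (ι n w.1) w.2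
  have he' : ∀ n, StronglyMeasurable (e' n) := by
    intro n
    refine Measurable.stronglyMeasurable ?_
    have h1 : Measurable fun z : ℕ × Vec d => s z.1 z.2 :=
      measurable_from_prod_countable_right fun k => (Lp.stronglyMeasurable (s k)).measurable
    exact h1.comp (((hι n).comp measurable_fst).prodMk measurable_snd)
  refine ⟨fun w => limUnder atTop (e' · w), (StronglyMeasurable.limUnder he').measurable, ?_⟩
  intro u
  have hd : ∀ n, dist (s (ι n u)) u < (1 / 2) ^ n / 2 := fun n => Nat.find_spec (hex n u)
  have h1 : ∀ᵐ x ∂volume.restrict D, ∃ l, Tendsto (fun n => s (ι n u) x) atTop (𝓝 l) := by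
    refine Lp.ae_tendsto_of_cauchy_eLpNorm (p := p) (fun n => Lp.aestronglyMeasurable _) Fact.out
      (B := fun n => ENNReal.ofReal ((1 / 2) ^ n)) ?_ ?_
    · rw [← ENNReal.ofReal_tsum_of_nonneg (fun n => by positivity)
        (summable_geometric_two)]
      exact ENNReal.ofReal_ne_top
    · intro M n m hn hm
      rw [← Lp.edist_def, edist_dist]
      refine (ENNReal.ofReal_lt_ofReal_iff (by positivity)).2 ?_
      have a1 : ((1 : ℝ) / 2) ^ n ≤ (1 / 2) ^ M :=
        pow_le_pow_of_le_one (by norm_num) (by norm_num) hn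
      have a2 : ((1 : ℝ) / 2) ^ m ≤ (1 / 2) ^ M :=
        pow_le_pow_of_le_one (by norm_num) (by norm_num) hm
      linarith [dist_triangle_right (s (ι n u)) (s (ι m u)) u, hd n, hd m]
  have h2 : Tendsto (fun n => s (ι n u)) atTop (𝓝 u) := by
    rw [tendsto_iff_dist_tendsto_zero]
    refine squeeze_zero (fun _ => dist_nonneg) (fun n => (hd n).le) ?_
    simpa using (tendsto_pow_atTop_nhds_zero_of_lt_one (r := (1 / 2 : ℝ)) (by norm_num)
      (by norm_num)).div_const 2
  -- Convergence in L^p gives almost everywhere convergence to u along a subsequence, which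
  -- identifies the pointwise limit.
  obtain ⟨ns, hns, h3⟩ := (tendstoInMeasure_of_tendsto_Lp h2).exists_seq_tendsto_ae
  filter_upwards [h1, h3] with x ⟨l, hl⟩ hx
  have : l = u x := tendsto_nhds_unique (hl.comp hns.tendsto_atTop) hx
  rw [← this]
  exact hl.limUnder_eq

/-- The push-forward of `(u, x) ↦ (x, u(x₁), …, u(x_k))`. -/
def evalPow {d N : ℕ} {p : ℝ≥0∞} {D : Set (Vec d)} (e : LpSpace d N p D × Vec d → Vec N) (k : ℕ)
    (w : LpSpace d N p D × (Fin k → Vec d)) : (Fin k → Vec d) × (Fin k → Vec N) :=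
  (w.2, fun j => e (w.1, w.2 j))

lemma measurable_evalPow {d N : ℕ} {p : ℝ≥0∞} [Fact (1 ≤ p)] {D : Set (Vec d)}
    {e : LpSpace d N p D × Vec d → Vec N} (he : Measurable e) (k : ℕ) :
    Measurable (evalPow e k) := by
  unfold evalPow
  refine measurable_snd.prodMk (measurable_pi_lambda _ fun j => he.comp ?_)
  fun_prop

lemma ae_pi_of_ae {X : Type*} [MeasurableSpace X] (m : Measure X) [SigmaFinite m] {k : ℕ}
    {q : X → Prop} (h : ∀ᵐ x ∂m, q x) :
    ∀ᵐ x ∂(Measure.pi fun _ : Fin k => m), ∀ j, q (x j) := by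
  rw [ae_all_iff]
  intro j
  exact (Measure.quasiMeasurePreserving_eval (μ := fun _ : Fin k => m) j).ae h

/-- Duality is stated only for integrands with values in C_0. Taking 1_A(x)g(ξ) with g continuous of
compact support determines the two finite measures on every set A × U^k, hence on all rectangles. -/
theorem compProd_eq_map_evalPow {d N : ℕ} {p : ℝ≥0∞} [Fact (1 ≤ p)] {D : Set (Vec d)}
    (hDf : volume D ≠ ∞)
    {e : LpSpace d N p D × Vec d → Vec N} (he : Measurable e)
    (heu : ∀ u : LpSpace d N p D, ∀ᵐ x ∂volume.restrict D, e (u, x) = u x)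
    {μ : Measure (LpSpace d N p D)} [IsProbabilityMeasure μ] {ν : CorrFamily d N}
    (hν : ∀ k, IsMarkovKernel (ν k)) (h : IsDual μ ν) (k : ℕ) :
    (volume.restrict (domPow D k)) ⊗ₘ (ν k) =
      (μ.prod (volume.restrict (domPow D k))).map (evalPow e k) := by
  have := hν k
  have : IsFiniteMeasure ((volume : Measure (Vec d)).restrict D) :=
    ⟨by simpa using hDf.lt_top⟩
  have : IsFiniteMeasure ((volume : Measure (Fin k → Vec d)).restrict (domPow D k)) := by
    rw [volume_restrict_domPow]; infer_instance
  have hem := measurable_evalPow he k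
  refine Measure.ext_prod fun {A B} hA hB => ?_
  -- both sides are finite measures of the set `B` that agree on compactly supported functions
  let m₁ : Measure (Fin k → Vec N) :=
    (((volume.restrict (domPow D k)) ⊗ₘ (ν k)).restrict (A ×ˢ univ)).map Prod.snd
  let m₂ : Measure (Fin k → Vec N) :=
    (((μ.prod (volume.restrict (domPow D k))).map (evalPow e k)).restrict (A ×ˢ univ)).map Prod.snd
  suffices hm : m₁ = m₂ by
    have := congrArg (fun m => m B) hm
    simp only [m₁, m₂] at this
    rw [Measure.map_apply measurable_snd hB, Measure.map_apply measurable_snd hB,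
      Measure.restrict_apply (measurable_snd hB), Measure.restrict_apply (measurable_snd hB)] at this
    have e1 : Prod.snd ⁻¹' B ∩ A ×ˢ (univ : Set (Fin k → Vec N)) = A ×ˢ B := by
      ext ⟨x, y⟩; simp [and_comm]
    rwa [e1] at this
  refine Measure.ext_of_integral_eq_on_compactlySupported fun g => ?_
  obtain ⟨Cg, hCg⟩ := g.hasCompactSupport.exists_bound_of_continuous g.continuous
  have hgm : StronglyMeasurable g := g.continuous.stronglyMeasurable
  let g₀ : C₀(Fin k → Vec N, ℝ) := ⟨⟨g, g.continuous⟩, g.hasCompactSupport.is_zero_at_infty⟩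
  have hA' : MeasurableSet (A ×ˢ (univ : Set (Fin k → Vec N))) := hA.prod .univ
  -- The function x ↦ 1_A(x)g with values in C_0 is integrable because D^k has finite measure.
  have key := h k (A.indicator fun _ => g₀)
    ((integrable_const g₀).indicator hA)
  have hind : ∀ x y, (A.indicator (fun _ => g₀) x) y =
      (A ×ˢ (univ : Set (Fin k → Vec N))).indicator (fun w => g w.2) (x, y) := by
    intro x y
    by_cases hx : x ∈ A
    · simp [hx, g₀]
    · simp [hx]
  have hbd : ∀ w : (Fin k → Vec d) × (Fin k → Vec N),
      ‖(A ×ˢ (univ : Set (Fin k → Vec N))).indicator (fun w => g w.2) w‖ ≤ Cg := fun w =>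
    (norm_indicator_le_norm_self _ _).trans (hCg _)
  have hsm : StronglyMeasurable
      ((A ×ˢ (univ : Set (Fin k → Vec N))).indicator fun w => g w.2) :=
    (hgm.comp_measurable measurable_snd).indicator hA'
  have hi : ∀ (m : Measure ((Fin k → Vec d) × (Fin k → Vec N))) [IsFiniteMeasure m],
      Integrable ((A ×ˢ (univ : Set (Fin k → Vec N))).indicator fun w => g w.2) m :=
    fun m _ => Integrable.of_bound hsm.aestronglyMeasurable Cg (ae_of_all _ hbd)
  simp only [m₁, m₂]
  rw [integral_map measurable_snd.aemeasurable hgm.aestronglyMeasurable,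
    integral_map measurable_snd.aemeasurable hgm.aestronglyMeasurable,
    ← integral_indicator hA', ← integral_indicator hA',
    Measure.integral_compProd (hi _),
    integral_map hem.aemeasurable hsm.aestronglyMeasurable,
    integral_prod]
  · simp only [hind] at key
    refine key.trans ?_
    refine integral_congr_ae (ae_of_all _ fun u => ?_)
    refine integral_congr_ae ?_
    rw [volume_restrict_domPow]
    filter_upwards [ae_pi_of_ae _ (heu u)] with x hx
    simp only [evalPow, hx]
  · exact Integrable.of_bound (hsm.comp_measurable hem).aestronglyMeasurable Cg
      (ae_of_all _ fun w => hbd _)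

/-! ### Moments of dual correlation measures -/

/-- A probability measure on `L^p(D; U)`, concentrated on `{∫_D |u|^P ≤ c}`, and a dual family of
Markov kernels. -/
structure DualBdd {d N : ℕ} {p : ℝ≥0∞} [Fact (1 ≤ p)] {D : Set (Vec d)} (P : ℝ) (c : ℝ≥0)
    (μ : Measure (LpSpace d N p D)) (ν : CorrFamily d N) : Prop where
  prob : IsProbabilityMeasure μ
  markov : ∀ k, IsMarkovKernel (ν k)
  dual : IsDual μ ν
  bound : ∀ᵐ u ∂μ, ∫⁻ x in D, ‖u x‖ₑ ^ P ≤ c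

section FixedTime

variable {d N : ℕ} {p : ℝ≥0∞} [Fact (1 ≤ p)] {D : Set (Vec d)}

lemma measurable_lintegral_comp (hp : p ≠ ∞) {b : Vec N → ℝ≥0∞} (hb : Measurable b) :
    Measurable fun u : LpSpace d N p D => ∫⁻ x in D, b (u x) := by
  obtain ⟨e, he, heu⟩ := exists_measurable_eval (N := N) hp D
  have : (fun u : LpSpace d N p D => ∫⁻ x in D, b (u x)) =
      fun u => ∫⁻ x in D, b (e (u, x)) := by
    funext u
    refine lintegral_congr_ae ?_
    filter_upwards [heu u] with x hx
    rw [hx]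
  rw [this]
  exact (hb.comp he).lintegral_prod_right'

/-- For fixed u the variables x_1,…,x_k are independent, so Tonelli's theorem factorises the inner
integral. -/
lemma lintegral_compProd_prod (hp : p ≠ ∞) (hDf : volume D ≠ ∞)
    {μ : Measure (LpSpace d N p D)} [IsProbabilityMeasure μ] {ν : CorrFamily d N}
    (hν : ∀ k, IsMarkovKernel (ν k)) (h : IsDual μ ν) {k : ℕ} (b : Fin k → Vec N → ℝ≥0∞)
    (hb : ∀ j, Measurable (b j)) :
    ∫⁻ w, ∏ j, b j (w.2 j) ∂((volume.restrict (domPow D k)) ⊗ₘ (ν k)) =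
      ∫⁻ u, (∏ j, ∫⁻ x in D, b j (u x)) ∂μ := by
  obtain ⟨e, he, heu⟩ := exists_measurable_eval (N := N) hp D
  have : IsFiniteMeasure ((volume : Measure (Vec d)).restrict D) := ⟨by simpa using hDf.lt_top⟩
  have hm : Measurable fun w : (Fin k → Vec d) × (Fin k → Vec N) => ∏ j, b j (w.2 j) :=
    Finset.measurable_fun_prod _ fun j _ => (hb j).comp (by fun_prop)
  rw [compProd_eq_map_evalPow hDf he heu hν h k, lintegral_map hm (measurable_evalPow he k),
    volume_restrict_domPow]
  refine (lintegral_prod _ (hm.comp (measurable_evalPow he k)).aemeasurable).trans ?_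
  refine lintegral_congr fun u => ?_
  refine (lintegral_pi_prod _ (fun j x => b j (e (u, x)))
    (fun j => (hb j).comp (he.comp measurable_prodMk_left))).trans ?_
  refine Finset.prod_congr rfl fun j _ => lintegral_congr_ae ?_
  filter_upwards [heu u] with x hx
  rw [hx]

lemma lintegral_compProd_one (hp : p ≠ ∞) (hDf : volume D ≠ ∞)
    {μ : Measure (LpSpace d N p D)} [IsProbabilityMeasure μ] {ν : CorrFamily d N}
    (hν : ∀ k, IsMarkovKernel (ν k)) (h : IsDual μ ν) {b : Vec N → ℝ≥0∞} (hb : Measurable b) :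
    ∫⁻ w, b (w.2 0) ∂((volume.restrict (domPow D 1)) ⊗ₘ (ν 1)) =
      ∫⁻ u, (∫⁻ x in D, b (u x)) ∂μ := by
  simpa using lintegral_compProd_prod hp hDf hν h (k := 1) (fun _ => b) (fun _ => hb)

lemma lintegral_growth_le {P : ℝ} {c : ℝ≥0} {C : ℝ≥0∞} {b : Vec N → ℝ≥0∞}
    (hC : ∀ ξ, b ξ ≤ C * (1 + ‖ξ‖ₑ ^ P)) {u : Vec d → Vec N}
    (hu : AEMeasurable u (volume.restrict D))
    (h : ∫⁻ x in D, ‖u x‖ₑ ^ P ≤ c) : ∫⁻ x in D, b (u x) ≤ C * (volume D + c) := by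
  calc ∫⁻ x in D, b (u x) ≤ ∫⁻ x in D, C * (1 + ‖u x‖ₑ ^ P) := lintegral_mono fun x => hC _
    _ = C * ∫⁻ x in D, (1 + ‖u x‖ₑ ^ P) :=
        lintegral_const_mul'' _ (aemeasurable_const.add (hu.enorm.pow_const _))
    _ = C * (volume D + ∫⁻ x in D, ‖u x‖ₑ ^ P) := by
        rw [lintegral_add_left measurable_const]; simp
    _ ≤ _ := by gcongr

/-- For almost every u all factors except the l-th have an integral bounded by a constant
independent of u; only the one-point integral of the l-th factor remains. This is how an error made
in one slot of a product is estimated. The exponent `k - 1` is not truncated, since `l` shows that k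
≥ 1. -/
lemma DualBdd.lintegral_prod_le (hp : p ≠ ∞) (hDf : volume D ≠ ∞) {P : ℝ} {c : ℝ≥0}
    {μ : Measure (LpSpace d N p D)} {ν : CorrFamily d N} (h : DualBdd P c μ ν) {k : ℕ}
    (b : Fin k → Vec N → ℝ≥0∞) (hb : ∀ j, Measurable (b j)) (l : Fin k) {C : ℝ≥0∞}
    (hC : ∀ j, j ≠ l → ∀ ξ, b j ξ ≤ C * (1 + ‖ξ‖ₑ ^ P)) :
    ∫⁻ w, ∏ j, b j (w.2 j) ∂((volume.restrict (domPow D k)) ⊗ₘ (ν k)) ≤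
      (C * (volume D + c)) ^ (k - 1) *
        ∫⁻ w, b l (w.2 0) ∂((volume.restrict (domPow D 1)) ⊗ₘ (ν 1)) := by
  have := h.prob
  rw [lintegral_compProd_prod hp hDf h.markov h.dual b hb,
    lintegral_compProd_one hp hDf h.markov h.dual (hb l),
    ← lintegral_const_mul _ (measurable_lintegral_comp hp (hb l))]
  refine lintegral_mono_ae ?_
  filter_upwards [h.bound] with u hu
  rw [← Finset.mul_prod_erase Finset.univ _ (Finset.mem_univ l), mul_comm]
  gcongr
  calc _ ≤ ∏ j ∈ Finset.univ.erase l, (C * (volume D + c)) :=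
        Finset.prod_le_prod' fun j hj => lintegral_growth_le (hC j (Finset.ne_of_mem_erase hj))
          (Lp.aestronglyMeasurable u).aemeasurable hu
    _ = _ := by simp [Finset.card_erase_of_mem]

lemma DualBdd.lintegral_prod_le_pow (hp : p ≠ ∞) (hDf : volume D ≠ ∞) {P : ℝ} {c : ℝ≥0}
    {μ : Measure (LpSpace d N p D)} {ν : CorrFamily d N} (h : DualBdd P c μ ν) {k : ℕ}
    (b : Fin k → Vec N → ℝ≥0∞) (hb : ∀ j, Measurable (b j)) {C : ℝ≥0∞}
    (hC : ∀ j ξ, b j ξ ≤ C * (1 + ‖ξ‖ₑ ^ P)) :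
    ∫⁻ w, ∏ j, b j (w.2 j) ∂((volume.restrict (domPow D k)) ⊗ₘ (ν k)) ≤
      (C * (volume D + c)) ^ k := by
  have := h.prob
  rw [lintegral_compProd_prod hp hDf h.markov h.dual b hb]
  calc _ ≤ ∫⁻ _u, (C * (volume D + c)) ^ k ∂μ := by
        refine lintegral_mono_ae ?_
        filter_upwards [h.bound] with u hu
        calc _ ≤ ∏ _j : Fin k, (C * (volume D + c)) :=
              Finset.prod_le_prod' fun j _ => lintegral_growth_le (hC j)
                (Lp.aestronglyMeasurable u).aemeasurable hu
          _ = _ := by simp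
    _ = _ := by simp

lemma enorm_prod_real {ι : Type*} (s : Finset ι) (a : ι → ℝ) :
    ‖∏ j ∈ s, a j‖ₑ = ∏ j ∈ s, ‖a j‖ₑ := by
  classical
  induction s using Finset.induction_on with
  | empty => simp
  | insert i s hi ih => rw [Finset.prod_insert hi, Finset.prod_insert hi, enorm_mul, ih]

/-- The growth bound `|H(ξ)| ≤ C (1 + |ξ|^P)` in extended form. -/
lemma enorm_le_growth {P C : ℝ} (hP : 0 ≤ P) {a : ℝ} {ξ : Vec N} (h : |a| ≤ C * (1 + ‖ξ‖ ^ P)) :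
    ‖a‖ₑ ≤ ENNReal.ofReal C * (1 + ‖ξ‖ₑ ^ P) := by
  have h0 : (0 : ℝ) ≤ 1 + ‖ξ‖ ^ P := by positivity
  rw [Real.enorm_eq_ofReal_abs]
  refine (ENNReal.ofReal_le_ofReal h).trans ?_
  rw [ENNReal.ofReal_mul' h0, ENNReal.ofReal_add zero_le_one (by positivity),
    ← ENNReal.ofReal_rpow_of_nonneg (norm_nonneg _) hP, ofReal_norm]
  simp

lemma DualBdd.integrable_prod (hp : p ≠ ∞) (hDf : volume D ≠ ∞) {P : ℝ} (hP : 0 ≤ P) {c : ℝ≥0}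
    {μ : Measure (LpSpace d N p D)} {ν : CorrFamily d N} (h : DualBdd P c μ ν) {k : ℕ}
    (H : Fin k → Vec N → ℝ) (hH : ∀ j, Measurable (H j)) {C : ℝ}
    (hC : ∀ j ξ, |H j ξ| ≤ C * (1 + ‖ξ‖ ^ P)) :
    Integrable (fun w : (Fin k → Vec d) × (Fin k → Vec N) => ∏ j, H j (w.2 j))
      ((volume.restrict (domPow D k)) ⊗ₘ (ν k)) := by
  refine ⟨(Finset.measurable_fun_prod _ fun j _ =>
    (hH j).comp (by fun_prop)).aestronglyMeasurable, ?_⟩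
  rw [HasFiniteIntegral]
  simp only [enorm_prod_real]
  refine (h.lintegral_prod_le_pow hp hDf (fun j ξ => ‖H j ξ‖ₑ) (fun j => (hH j).enorm)
    (fun j ξ => enorm_le_growth hP (hC j ξ))).trans_lt ?_
  finiteness

end FixedTime

/-! ### The joint law of time, space and state -/

/-- The measure `dt dx dν^k_{t,x}(ξ)` on `[0,T) × D^k × U^k`. -/
def jointLaw {d N : ℕ} (D : Set (Vec d)) (T : ℝ) (ν : TimeCorrFamily d N) (k : ℕ) :
    Measure ((ℝ × (Fin k → Vec d)) × (Fin k → Vec N)) :=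
  (volume.restrict (Ico 0 T ×ˢ domPow D k)) ⊗ₘ (ν k)

/-- A time-dependent version of `DualBdd`. -/
structure TimeDualBdd {d N : ℕ} {p : ℝ≥0∞} [Fact (1 ≤ p)] {D : Set (Vec d)} (T P : ℝ) (c : ℝ≥0)
    (μ : ℝ → Measure (LpSpace d N p D)) (ν : TimeCorrFamily d N) : Prop where
  markov : ∀ k, IsMarkovKernel (ν k)
  slice : ∀ᵐ t ∂volume.restrict (Ico 0 T), DualBdd P c (μ t) (ν.slice t)

section Joint

variable {d N : ℕ} {D : Set (Vec d)} {T : ℝ} {ν : TimeCorrFamily d N}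

lemma volume_restrict_prod (D : Set (Vec d)) (T : ℝ) (k : ℕ) :
    (volume : Measure (ℝ × (Fin k → Vec d))).restrict (Ico 0 T ×ˢ domPow D k) =
      (volume.restrict (Ico 0 T)).prod (volume.restrict (domPow D k)) := by
  rw [Measure.volume_eq_prod, Measure.prod_restrict]

/-- Reassociating the triple (t,x,ξ) allows disintegration in time first, which exposes the slices
for which duality is known. -/
lemma jointLaw_eq (k : ℕ) :
    jointLaw D T ν k = ((volume.restrict (Ico 0 T)) ⊗ₘ
      (Kernel.const ℝ (volume.restrict (domPow D k)) ⊗ₖ ν k)).map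
        MeasurableEquiv.prodAssoc.symm := by
  rw [Measure.compProd_assoc, jointLaw, volume_restrict_prod, Measure.compProd_const]

lemma const_compProd_apply (hν : ∀ k, IsMarkovKernel (ν k)) (k : ℕ) (t : ℝ) :
    (Kernel.const ℝ ((volume : Measure (Fin k → Vec d)).restrict (domPow D k)) ⊗ₖ ν k) t =
      (volume.restrict (domPow D k)) ⊗ₘ (ν.slice t k) := by
  have := hν k
  rw [Kernel.compProd_apply_eq_compProd_sectR]
  rfl

lemma lintegral_jointLaw (hν : ∀ k, IsMarkovKernel (ν k)) {k : ℕ}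
    {h : (ℝ × (Fin k → Vec d)) × (Fin k → Vec N) → ℝ≥0∞} (hh : Measurable h) :
    ∫⁻ w, h w ∂(jointLaw D T ν k) = ∫⁻ t in Ico 0 T, ∫⁻ y, h ((t, y.1), y.2)
      ∂((volume.restrict (domPow D k)) ⊗ₘ (ν.slice t k)) := by
  have := hν k
  rw [jointLaw_eq, lintegral_map_equiv, Measure.lintegral_compProd (by fun_prop)]
  simp only [const_compProd_apply hν]
  rfl

lemma integrable_jointLaw_slice (hν : ∀ k, IsMarkovKernel (ν k)) {k : ℕ}
    {h : (ℝ × (Fin k → Vec d)) × (Fin k → Vec N) → ℝ} (hh : Integrable h (jointLaw D T ν k)) :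
    ∀ᵐ t ∂volume.restrict (Ico 0 T), Integrable (fun y => h ((t, y.1), y.2))
      ((volume.restrict (domPow D k)) ⊗ₘ (ν.slice t k)) := by
  have := hν k
  rw [jointLaw_eq, integrable_map_equiv] at hh
  have h1 := ((Measure.integrable_compProd_iff hh.aestronglyMeasurable).1 hh).1
  simp only [const_compProd_apply hν] at h1
  exact h1

lemma integral_jointLaw (hν : ∀ k, IsMarkovKernel (ν k)) {k : ℕ}
    {h : (ℝ × (Fin k → Vec d)) × (Fin k → Vec N) → ℝ} (hh : Integrable h (jointLaw D T ν k)) :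
    ∫ w, h w ∂(jointLaw D T ν k) = ∫ t in Ico 0 T, ∫ y, h ((t, y.1), y.2)
      ∂((volume.restrict (domPow D k)) ⊗ₘ (ν.slice t k)) := by
  have := hν k
  rw [jointLaw_eq, integrable_map_equiv] at hh
  rw [jointLaw_eq, integral_map_equiv]
  refine (Measure.integral_compProd hh).trans ?_
  simp only [const_compProd_apply hν]
  rfl

lemma isFiniteMeasure_jointLaw (hDf : volume D ≠ ∞) (hν : ∀ k, IsMarkovKernel (ν k)) (k : ℕ) :
    IsFiniteMeasure (jointLaw D T ν k) := by
  have := hν k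
  have : IsFiniteMeasure ((volume : Measure (Vec d)).restrict D) := ⟨by simpa using hDf.lt_top⟩
  have : IsFiniteMeasure ((volume : Measure (ℝ × (Fin k → Vec d))).restrict
      (Ico 0 T ×ˢ domPow D k)) := by
    rw [volume_restrict_prod, volume_restrict_domPow]; infer_instance
  rw [jointLaw]; infer_instance

variable {p : ℝ≥0∞} [Fact (1 ≤ p)] {P : ℝ} {c : ℝ≥0} {μ : ℝ → Measure (LpSpace d N p D)}

lemma TimeDualBdd.lintegral_prod_le (hp : p ≠ ∞) (hDf : volume D ≠ ∞)
    (h : TimeDualBdd T P c μ ν) {k : ℕ}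
    (b : Fin k → Vec N → ℝ≥0∞) (hb : ∀ j, Measurable (b j)) (l : Fin k) {C : ℝ≥0∞}
    (hC : ∀ j, j ≠ l → ∀ ξ, b j ξ ≤ C * (1 + ‖ξ‖ₑ ^ P)) :
    ∫⁻ w, ∏ j, b j (w.2 j) ∂(jointLaw D T ν k) ≤
      (C * (volume D + c)) ^ (k - 1) * ∫⁻ w, b l (w.2 0) ∂(jointLaw D T ν 1) := by
  have hm : Measurable fun w : (ℝ × (Fin k → Vec d)) × (Fin k → Vec N) => ∏ j, b j (w.2 j) :=
    Finset.measurable_fun_prod _ fun j _ => (hb j).comp (by fun_prop)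
  have hm1 : Measurable fun w : (ℝ × (Fin 1 → Vec d)) × (Fin 1 → Vec N) => b l (w.2 0) :=
    (hb l).comp (by fun_prop)
  -- In the degenerate case ∞ · 0 the right side is 0 by convention, and the claim is that the left
  -- side vanishes; this holds slice by slice.
  by_cases htop : ∫⁻ w, b l (w.2 0) ∂(jointLaw D T ν 1) = ∞ ∧ (C * (volume D + c)) ^ (k - 1) = 0
  · rw [lintegral_jointLaw h.markov hm, htop.2, zero_mul, nonpos_iff_eq_zero]
    rw [← lintegral_zero (μ := volume.restrict (Ico 0 T))]
    refine lintegral_congr_ae ?_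
    filter_upwards [h.slice] with t ht
    have := ht.lintegral_prod_le hp hDf b hb l hC
    rw [htop.2, zero_mul, nonpos_iff_eq_zero] at this
    exact this
  rw [lintegral_jointLaw h.markov hm, lintegral_jointLaw h.markov hm1]
  have := h.markov 1
  have hmt : Measurable fun t : ℝ => ∫⁻ y : (Fin 1 → Vec d) × (Fin 1 → Vec N), b l (y.2 0)
      ∂((volume.restrict (domPow D 1)) ⊗ₘ (ν.slice t 1)) := by
    simp only [← const_compProd_apply h.markov]
    exact Measurable.lintegral_kernel ((hb l).comp (by fun_prop))
  rw [← lintegral_const_mul _ hmt]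
  refine lintegral_mono_ae ?_
  filter_upwards [h.slice] with t ht
  exact ht.lintegral_prod_le hp hDf b hb l hC

lemma TimeDualBdd.lintegral_prod_le_pow (hp : p ≠ ∞) (hDf : volume D ≠ ∞)
    (h : TimeDualBdd T P c μ ν) {k : ℕ}
    (b : Fin k → Vec N → ℝ≥0∞) (hb : ∀ j, Measurable (b j)) {C : ℝ≥0∞}
    (hC : ∀ j ξ, b j ξ ≤ C * (1 + ‖ξ‖ₑ ^ P)) :
    ∫⁻ w, ∏ j, b j (w.2 j) ∂(jointLaw D T ν k) ≤
      (C * (volume D + c)) ^ k * ENNReal.ofReal T := by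
  have hm : Measurable fun w : (ℝ × (Fin k → Vec d)) × (Fin k → Vec N) => ∏ j, b j (w.2 j) :=
    Finset.measurable_fun_prod _ fun j _ => (hb j).comp (by fun_prop)
  rw [lintegral_jointLaw h.markov hm]
  calc _ ≤ ∫⁻ _t in Ico 0 T, (C * (volume D + c)) ^ k := by
        refine lintegral_mono_ae ?_
        filter_upwards [h.slice] with t ht
        exact ht.lintegral_prod_le_pow hp hDf b hb hC
    _ = _ := by simp

lemma TimeDualBdd.integrable_prod (hp : p ≠ ∞) (hDf : volume D ≠ ∞) (hP : 0 ≤ P)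
    (h : TimeDualBdd T P c μ ν) {k : ℕ}
    (H : Fin k → Vec N → ℝ) (hH : ∀ j, Measurable (H j)) {C : ℝ}
    (hC : ∀ j ξ, |H j ξ| ≤ C * (1 + ‖ξ‖ ^ P)) :
    Integrable (fun w : (ℝ × (Fin k → Vec d)) × (Fin k → Vec N) => ∏ j, H j (w.2 j))
      (jointLaw D T ν k) := by
  refine ⟨(Finset.measurable_fun_prod _ fun j _ =>
    (hH j).comp (by fun_prop)).aestronglyMeasurable, ?_⟩
  rw [HasFiniteIntegral]
  simp only [enorm_prod_real]
  refine (h.lintegral_prod_le_pow hp hDf (fun j ξ => ‖H j ξ‖ₑ) (fun j => (hH j).enorm)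
    (fun j ξ => enorm_le_growth hP (hC j ξ))).trans_lt ?_
  finiteness

end Joint

/-! ### Observables of the form `1_A(t) G(ξ)` -/

lemma isBoundedL1_const {d : ℕ} {D : Set (Vec d)} (hDf : volume D ≠ ∞) (T : ℝ) (i : ℕ) {C : ℝ}
    (hC : 0 ≤ C) : IsBoundedL1 D T i fun _ _ => C where
  measurable := measurable_const
  nonneg _ _ := hC
  bounded := by
    have h : volume (domPow D i) ≠ ∞ := by
      rw [domPow, volume_pi_pi]
      exact ENNReal.prod_ne_top fun _ _ => hDf
    have h' : ENNReal.ofReal C * volume (domPow D i) ≠ ∞ := ENNReal.mul_ne_top (by simp) h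
    refine ⟨(ENNReal.ofReal C * volume (domPow D i)).toNNReal, ae_of_all _ fun t => ?_⟩
    rw [setLIntegral_const, ENNReal.coe_toNNReal h']

/-- Setting ζ = ξ in the Lipschitz condition shows that members of the class are locally constant in
x; the observables used here do not depend on x at all. Constants then serve as h, ψ and all the
φ_i. -/
lemma memH1_indicator_mul {d N : ℕ} {D : Set (Vec d)} (hDf : volume D ≠ ∞) (T : ℝ) {P : ℝ}
    (l : ℕ) {A : Set ℝ} (hA : MeasurableSet A) {G : (Fin (l + 1) → Vec N) → ℝ}
    (hG : Continuous G) {C L : ℝ} (hC : 0 ≤ C) (hL : 0 ≤ L)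
    (hGC : ∀ ξ, |G ξ| ≤ C * (1 + ‖ξ 0‖ ^ P))
    (hGL : ∀ ζ ξ, |G ζ - G ξ| ≤ L * ∑ i, ‖ζ i - ξ i‖ * max ‖ξ i‖ ‖ζ i‖ ^ (P - 1)) :
    MemH1 D T P l fun t _ ξ => A.indicator 1 t * G ξ := by
  have hA1 : ∀ t, |A.indicator (1 : ℝ → ℝ) t| ≤ 1 := fun t => by
    by_cases ht : t ∈ A <;> simp [ht]
  have hm : Measurable (A.indicator (1 : ℝ → ℝ)) := measurable_one.indicator hA
  refine ⟨⟨?_, ?_, ?_⟩, ?_⟩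
  · exact (hm.comp measurable_fst).mul (hG.measurable.comp (measurable_snd.comp measurable_snd))
  · exact ae_of_all _ fun z => continuous_const.mul hG
  · refine ⟨fun _ _ _ => C, fun i => isBoundedL1_const hDf T i hC, fun t _ x _ ξ => ?_⟩
    rw [abs_mul]
    calc |A.indicator 1 t| * |G ξ| ≤ 1 * (C * (1 + ‖ξ 0‖ ^ P)) :=
          mul_le_mul (hA1 t) (hGC ξ) (abs_nonneg _) zero_le_one
      -- Of the 2^k terms in the growth condition only those of ∅ and {0} are needed: they give C
      -- and C|ξ_0|^P.
      _ = ∑ B ∈ {∅, {0}}, C * (∏ j ∈ B, ‖ξ j‖) ^ P := by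
          rw [Finset.sum_pair (Finset.singleton_ne_empty (0 : Fin (l + 1))).symm]
          simp; ring
      _ ≤ _ := Finset.sum_le_sum_of_subset_of_nonneg (Finset.subset_univ _) fun B _ _ =>
          mul_nonneg hC (Real.rpow_nonneg (Finset.prod_nonneg fun _ _ => norm_nonneg _) _)
  · refine ⟨1, one_pos, fun _ _ _ => 1, ⟨measurable_const, ae_of_all _ fun z => continuous_const,
      ⟨fun _ _ _ => 1, fun i => isBoundedL1_const hDf T i zero_le_one, fun t _ x _ ξ => ?_⟩⟩,
      fun _ _ _ => zero_le_one, fun _ => L, measurable_const, fun _ => hL,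
      ⟨L, ae_of_all _ fun _ => le_rfl⟩, fun t _ x _ y _ ξ ζ => ?_⟩
    · have : (1 : ℝ) * (∏ j ∈ (∅ : Finset (Fin l)), ‖ξ j‖) ^ P ≤
          ∑ B : Finset (Fin l), 1 * (∏ j ∈ B, ‖ξ j‖) ^ P :=
        Finset.single_le_sum (f := fun B : Finset (Fin l) => (1 : ℝ) * (∏ j ∈ B, ‖ξ j‖) ^ P)
          (fun B _ => mul_nonneg zero_le_one
            (Real.rpow_nonneg (Finset.prod_nonneg fun _ _ => norm_nonneg _) _))
          (Finset.mem_univ _)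
      simpa using this
    · rw [← mul_sub, abs_mul]
      calc |A.indicator 1 t| * |G ζ - G ξ| ≤ 1 * |G ζ - G ξ| :=
            mul_le_mul_of_nonneg_right (hA1 t) (abs_nonneg _)
        _ ≤ _ := by simpa using hGL ζ ξ

/-- The convergence of all observables in the definition of strong convergence. -/
def ObservablesConverge {d N : ℕ} (D : Set (Vec d)) (T P : ℝ) (νn : ℕ → TimeCorrFamily d N)
    (ν : TimeCorrFamily d N) : Prop :=
  ∀ (l : ℕ) (g : ℝ → (Fin (l + 1) → Vec d) → (Fin (l + 1) → Vec N) → ℝ),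
    MemH1 D T P l g →
      Tendsto (fun n => ∫⁻ x in domPow D (l + 1),
        ‖∫ t in Ico 0 T, ((∫ ξ, g t x ξ ∂(νn n (l + 1) (t, x))) -
          ∫ ξ, g t x ξ ∂(ν (l + 1) (t, x)))‖ₑ) atTop (𝓝 0)

/-- Strong convergence is convergence in L^1 of the x-variables after integration in time. A bounded
measurable weight χ(x), though not allowed inside the observable, can therefore be inserted
afterwards at the cost of the factor K. -/
lemma ObservablesConverge.tendsto_integral {d N : ℕ} {D : Set (Vec d)} (hDf : volume D ≠ ∞)
    {T P : ℝ} {νn : ℕ → TimeCorrFamily d N} {ν : TimeCorrFamily d N}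
    (hobs : ObservablesConverge D T P νn ν) (hνn : ∀ n k, IsMarkovKernel (νn n k))
    (hν : ∀ k, IsMarkovKernel (ν k)) {l : ℕ} {A : Set ℝ} (hA : MeasurableSet A)
    {χ : (Fin (l + 1) → Vec d) → ℝ} (hχ : Measurable χ) {K : ℝ} (hK : ∀ x, |χ x| ≤ K)
    {G : (Fin (l + 1) → Vec N) → ℝ}
    (hG : Continuous G) {C L : ℝ} (hC : 0 ≤ C) (hL : 0 ≤ L)
    (hGC : ∀ ξ, |G ξ| ≤ C * (1 + ‖ξ 0‖ ^ P))
    (hGL : ∀ ζ ξ, |G ζ - G ξ| ≤ L * ∑ i, ‖ζ i - ξ i‖ * max ‖ξ i‖ ‖ζ i‖ ^ (P - 1))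
    (hin : ∀ n, Integrable (fun w => G w.2) (jointLaw D T (νn n) (l + 1)))
    (hi : Integrable (fun w => G w.2) (jointLaw D T ν (l + 1))) :
    Tendsto (fun n => ∫ w, A.indicator 1 w.1.1 * χ w.1.2 * G w.2
      ∂(jointLaw D T (νn n) (l + 1))) atTop
      (𝓝 (∫ w, A.indicator 1 w.1.1 * χ w.1.2 * G w.2 ∂(jointLaw D T ν (l + 1)))) := by
  have hA1 : ∀ t, |A.indicator (1 : ℝ → ℝ) t| ≤ 1 := fun t => by
    by_cases ht : t ∈ A <;> simp [ht]
  have hAm : Measurable (A.indicator (1 : ℝ → ℝ)) := measurable_one.indicator hA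
  have : IsFiniteMeasure ((volume : Measure (Vec d)).restrict D) := ⟨by simpa using hDf.lt_top⟩
  set m : Measure (Fin (l + 1) → Vec d) := volume.restrict (domPow D (l + 1)) with hm_def
  have : IsFiniteMeasure m := by rw [hm_def, volume_restrict_domPow]; infer_instance
  set Q : Measure (ℝ × (Fin (l + 1) → Vec d)) := (volume.restrict (Ico 0 T)).prod m with hQ
  have hgm := memH1_indicator_mul hDf T l hA hG hC hL hGC hGL
  have h0 := hobs l _ hgm
  -- the conditional expectations of the observable
  have key : ∀ κ : TimeCorrFamily d N, (∀ k, IsMarkovKernel (κ k)) →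
      Integrable (fun w => G w.2) (jointLaw D T κ (l + 1)) →
      Integrable (fun z => ∫ ξ, A.indicator 1 z.1 * G ξ ∂(κ (l + 1) z)) Q ∧
      ∫ w, A.indicator 1 w.1.1 * χ w.1.2 * G w.2 ∂(jointLaw D T κ (l + 1)) =
        ∫ z, χ z.2 * ∫ ξ, A.indicator 1 z.1 * G ξ ∂(κ (l + 1) z) ∂Q := by
    intro κ hκ hIκ
    have := hκ (l + 1)
    rw [jointLaw, volume_restrict_prod] at hIκ
    have h1 : Integrable (fun w : (ℝ × (Fin (l + 1) → Vec d)) × (Fin (l + 1) → Vec N) =>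
        A.indicator 1 w.1.1 * G w.2) (Q ⊗ₘ κ (l + 1)) :=
      hIκ.bdd_mul (c := 1) (hAm.comp (measurable_fst.comp measurable_fst)).aestronglyMeasurable
        (ae_of_all _ fun w => hA1 _)
    have h2 : Integrable (fun w : (ℝ × (Fin (l + 1) → Vec d)) × (Fin (l + 1) → Vec N) =>
        χ w.1.2 * (A.indicator 1 w.1.1 * G w.2)) (Q ⊗ₘ κ (l + 1)) :=
      h1.bdd_mul (c := K) (hχ.comp (measurable_snd.comp measurable_fst)).aestronglyMeasurable
        (ae_of_all _ fun w => hK _)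
    refine ⟨h1.integral_compProd, ?_⟩
    rw [jointLaw, volume_restrict_prod]
    have e1 : ∀ w : (ℝ × (Fin (l + 1) → Vec d)) × (Fin (l + 1) → Vec N),
        A.indicator 1 w.1.1 * χ w.1.2 * G w.2 = χ w.1.2 * (A.indicator 1 w.1.1 * G w.2) :=
      fun w => by ring
    simp only [e1]
    rw [Measure.integral_compProd h2]
    simp only [integral_const_mul]
  have hχQ : AEStronglyMeasurable (fun z : ℝ × (Fin (l + 1) → Vec d) => χ z.2) Q :=
    (hχ.comp measurable_snd).aestronglyMeasurable
  obtain ⟨hF, hF'⟩ := key ν hν hi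
  rw [tendsto_iff_norm_sub_tendsto_zero]
  have hK0 : Tendsto (fun n => (ENNReal.ofReal K * ∫⁻ x in domPow D (l + 1),
      ‖∫ t in Ico 0 T, ((∫ ξ, A.indicator 1 t * G ξ ∂(νn n (l + 1) (t, x))) -
          ∫ ξ, A.indicator 1 t * G ξ ∂(ν (l + 1) (t, x)))‖ₑ)) atTop (𝓝 0) := by
    simpa using ENNReal.Tendsto.const_mul h0 (Or.inr (by simp))
  have hfin : Tendsto (fun n => ‖∫ w, A.indicator 1 w.1.1 * χ w.1.2 * G w.2
      ∂(jointLaw D T (νn n) (l + 1)) -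
      ∫ w, A.indicator 1 w.1.1 * χ w.1.2 * G w.2 ∂(jointLaw D T ν (l + 1))‖ₑ) atTop (𝓝 0) := by
    refine tendsto_of_tendsto_of_tendsto_of_le_of_le tendsto_const_nhds hK0
      (fun _ => zero_le) fun n => ?_
    obtain ⟨hFn, hFn'⟩ := key (νn n) (hνn n) (hin n)
    simp only
    rw [hF', hFn', ← integral_sub (hFn.bdd_mul (c := K) hχQ (ae_of_all _ fun z => hK _))
      (hF.bdd_mul (c := K) hχQ (ae_of_all _ fun z => hK _))]
    simp only [← mul_sub]
    have h3 := (hFn.sub hF).bdd_mul (c := K) hχQ (ae_of_all _ fun z => hK _)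
    simp only [Pi.sub_apply] at h3
    rw [hQ, integral_prod_symm _ h3]
    refine (enorm_integral_le_lintegral_enorm _).trans ?_
    rw [← lintegral_const_mul' _ _ (by simp)]
    refine lintegral_mono fun x => ?_
    simp only [integral_const_mul, enorm_mul]
    gcongr
    rw [Real.enorm_eq_ofReal_abs]
    exact ENNReal.ofReal_le_ofReal (hK x)
  have := (ENNReal.tendsto_toReal ENNReal.zero_ne_top).comp hfin
  simpa [Function.comp_def] using this

/-! ### Elementary observables -/

lemma abs_rpow_sub_rpow_le {P : ℝ} (hP : 1 ≤ P) {a b : ℝ} (ha : 0 ≤ a) (hb : 0 ≤ b) :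
    |a ^ P - b ^ P| ≤ P * (|a - b| * max b a ^ (P - 1)) := by
  have key : ∀ x y : ℝ, 0 ≤ x → x ≤ y → y ^ P - x ^ P ≤ P * ((y - x) * y ^ (P - 1)) := by
    intro x y hx hxy
    rcases hx.eq_or_lt with rfl | hx'
    · rcases hxy.eq_or_lt with rfl | hy
      · simp
      · rw [Real.zero_rpow (by linarith), sub_zero, sub_zero, ← Real.rpow_one_add' hy.le (by linarith)]
        have : 0 ≤ y ^ P := Real.rpow_nonneg hy.le _
        rw [show 1 + (P - 1) = P by ring]
        nlinarith
    · have hy : 0 < y := hx'.trans_le hxy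
      -- Bernoulli's inequality for (1 + s)^P with s = x/y − 1 ≥ −1; multiplied by y^P it is the
      -- claim.
      have h1 := one_add_mul_self_le_rpow_one_add (s := x / y - 1)
        (by have : 0 ≤ x / y := by positivity
            linarith) hP
      rw [show 1 + (x / y - 1) = x / y by ring, Real.div_rpow hx hy.le] at h1
      have hyP : 0 < y ^ P := Real.rpow_pos_of_pos hy _
      rw [le_div_iff₀ hyP] at h1
      have e : y ^ P = y * y ^ (P - 1) := by
        rw [← Real.rpow_one_add' hy.le (by linarith)]; congr 1; ring
      have e2 : (1 + P * (x / y - 1)) * y ^ P = y ^ P - P * ((y - x) * y ^ (P - 1)) := by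
        rw [e]; field_simp; ring
      linarith
  rcases le_total a b with h | h
  · rw [abs_sub_comm, abs_sub_comm a b, abs_of_nonneg (sub_nonneg.2 h), max_eq_left h,
      abs_of_nonneg (sub_nonneg.2 (Real.rpow_le_rpow ha h (by linarith)))]
    exact key a b ha h
  · rw [abs_of_nonneg (sub_nonneg.2 h), max_eq_right h,
      abs_of_nonneg (sub_nonneg.2 (Real.rpow_le_rpow hb h (by linarith)))]
    exact key b a hb h

lemma abs_norm_rpow_sub_le {N : ℕ} {P : ℝ} (hP : 1 ≤ P) (ζ ξ : Vec N) :
    |‖ζ‖ ^ P - ‖ξ‖ ^ P| ≤ P * (‖ζ - ξ‖ * max ‖ξ‖ ‖ζ‖ ^ (P - 1)) := by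
  refine (abs_rpow_sub_rpow_le hP (norm_nonneg ζ) (norm_nonneg ξ)).trans ?_
  gcongr
  exact abs_norm_sub_norm_le _ _

/-- Bounded observables of one variable that are Lipschitz with the weight `max(|ξ|,|ζ|)^{P-1}`
give product observables. -/
lemma prod_observable_lipschitz {N l : ℕ} {P B L : ℝ} (hB : 0 ≤ B) (G : Fin (l + 1) → Vec N → ℝ)
    (hGB : ∀ j ξ, |G j ξ| ≤ B)
    (hGL : ∀ j ζ ξ, |G j ζ - G j ξ| ≤ L * (‖ζ - ξ‖ * max ‖ξ‖ ‖ζ‖ ^ (P - 1)))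
    (ζ ξ : Fin (l + 1) → Vec N) :
    |∏ j, G j (ζ j) - ∏ j, G j (ξ j)| ≤
      (L * B ^ l) * ∑ i, ‖ζ i - ξ i‖ * max ‖ξ i‖ ‖ζ i‖ ^ (P - 1) := by
  refine (abs_prod_sub_prod_le (fun j => G j (ζ j)) (fun j => G j (ξ j)) (fun _ => B)
    (fun j => hGB _ _) (fun j => hGB _ _)).trans ?_
  rw [Finset.mul_sum]
  refine Finset.sum_le_sum fun i _ => ?_
  rw [← Finset.mul_prod_erase Finset.univ _ (Finset.mem_univ i)]
  simp only [if_true]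
  rw [Finset.prod_congr rfl (g := fun _ => B)
    (fun j hj => if_neg (Finset.ne_of_mem_erase hj))]
  rw [Finset.prod_const, Finset.card_erase_of_mem (Finset.mem_univ i), Finset.card_univ,
    Fintype.card_fin, Nat.add_sub_cancel]
  calc |G i (ζ i) - G i (ξ i)| * B ^ l ≤
        (L * (‖ζ i - ξ i‖ * max ‖ξ i‖ ‖ζ i‖ ^ (P - 1))) * B ^ l :=
        mul_le_mul_of_nonneg_right (hGL i _ _) (by positivity)
    _ = _ := by ring

lemma abs_prod_le_pow {N l : ℕ} {B : ℝ} (G : Fin l → Vec N → ℝ)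
    (hGB : ∀ j ξ, |G j ξ| ≤ B) (ξ : Fin l → Vec N) : |∏ j, G j (ξ j)| ≤ B ^ l := by
  rw [Finset.abs_prod]
  calc _ ≤ ∏ _j : Fin l, B := Finset.prod_le_prod (fun _ _ => abs_nonneg _) fun j _ => hGB _ _
    _ = _ := by simp

/-- Convergence of bounded product observables. -/
lemma ObservablesConverge.tendsto_integral_prod {d N : ℕ} {D : Set (Vec d)}
    (hDf : volume D ≠ ∞)
    {T P : ℝ} {νn : ℕ → TimeCorrFamily d N} {ν : TimeCorrFamily d N}
    (hobs : ObservablesConverge D T P νn ν) (hνn : ∀ n k, IsMarkovKernel (νn n k))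
    (hν : ∀ k, IsMarkovKernel (ν k)) {l : ℕ} {A : Set ℝ} (hA : MeasurableSet A)
    {χ : (Fin (l + 1) → Vec d) → ℝ} (hχ : Measurable χ) {K : ℝ} (hK : ∀ x, |χ x| ≤ K)
    {B L : ℝ} (hB : 0 ≤ B) (hL : 0 ≤ L) (G : Fin (l + 1) → Vec N → ℝ)
    (hG : ∀ j, Continuous (G j)) (hGB : ∀ j ξ, |G j ξ| ≤ B)
    (hGL : ∀ j ζ ξ, |G j ζ - G j ξ| ≤ L * (‖ζ - ξ‖ * max ‖ξ‖ ‖ζ‖ ^ (P - 1))) :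
    Tendsto (fun n => ∫ w, A.indicator 1 w.1.1 * χ w.1.2 * ∏ j, G j (w.2 j)
      ∂(jointLaw D T (νn n) (l + 1))) atTop
      (𝓝 (∫ w, A.indicator 1 w.1.1 * χ w.1.2 * ∏ j, G j (w.2 j)
        ∂(jointLaw D T ν (l + 1)))) := by
  have hc : Continuous fun ξ : Fin (l + 1) → Vec N => ∏ j, G j (ξ j) :=
    continuous_finsetProd _ fun j _ => (hG j).comp (continuous_apply j)
  have hinteg : ∀ κ : TimeCorrFamily d N, (∀ k, IsMarkovKernel (κ k)) →
      Integrable (fun w => ∏ j, G j (w.2 j)) (jointLaw D T κ (l + 1)) := by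
    intro κ hκ
    have := isFiniteMeasure_jointLaw (T := T) hDf hκ (l + 1)
    exact Integrable.of_bound (hc.measurable.comp measurable_snd).aestronglyMeasurable
      (B ^ (l + 1)) (ae_of_all _ fun w => abs_prod_le_pow G hGB _)
  refine hobs.tendsto_integral hDf hνn hν hA hχ hK hc (C := B ^ (l + 1)) (L := L * B ^ l)
    (by positivity) (by positivity) (fun ξ => ?_)
    (prod_observable_lipschitz hB G hGB hGL) (fun n => hinteg _ (hνn n)) (hinteg _ hν)
  refine (abs_prod_le_pow G hGB ξ).trans ?_
  have h1 : 0 ≤ ‖ξ 0‖ ^ P := by positivity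
  have h2 : 0 ≤ B ^ (l + 1) := by positivity
  nlinarith

/-! ### Bounded support of the limit -/

/-- For r > c, Markov's inequality for the power l + 1 bounds the measure of {X ≥ r} by (c/r)^(l+1),
which tends to 0. -/
lemma ae_le_of_lintegral_pow_le {Ω : Type*} [MeasurableSpace Ω] (μ : Measure Ω) {X : Ω → ℝ≥0∞}
    (hX : Measurable X) (c : ℝ≥0) (h : ∀ l : ℕ, ∫⁻ ω, X ω ^ (l + 1) ∂μ ≤ c ^ (l + 1)) :
    ∀ᵐ ω ∂μ, X ω ≤ c := by
  have key : ∀ r : ℝ≥0, c < r → μ {ω | (r : ℝ≥0∞) ≤ X ω} = 0 := by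
    intro r hr
    have hr0 : (r : ℝ≥0∞) ≠ 0 := by
      have : 0 < r := (zero_le (a := c)).trans_lt hr
      exact_mod_cast this.ne'
    have h1 : ∀ l : ℕ, μ {ω | (r : ℝ≥0∞) ≤ X ω} ≤ ((c : ℝ≥0∞) / r) ^ (l + 1) := by
      intro l
      have h2 := mul_meas_ge_le_lintegral (μ := μ) (hX.pow_const (l + 1))
        ((r : ℝ≥0∞) ^ (l + 1))
      have h3 : μ {ω | (r : ℝ≥0∞) ≤ X ω} ≤ μ {ω | (r : ℝ≥0∞) ^ (l + 1) ≤ X ω ^ (l + 1)} :=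
        measure_mono fun ω (hω : (r : ℝ≥0∞) ≤ X ω) => pow_le_pow_left' hω _
      rw [div_eq_mul_inv, mul_pow, ← ENNReal.inv_pow, ← div_eq_mul_inv, ENNReal.le_div_iff_mul_le (Or.inl (pow_ne_zero _ hr0))
        (Or.inl (by finiteness)), mul_comm]
      exact (mul_le_mul_right h3 _).trans (h2.trans (h l))
    have h4 : Tendsto (fun l : ℕ => ((c : ℝ≥0∞) / r) ^ (l + 1)) atTop (𝓝 0) := by
      refine (tendsto_add_atTop_iff_nat 1).2
        (ENNReal.tendsto_pow_atTop_nhds_zero_of_lt_one ?_)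
      rw [ENNReal.div_lt_iff (Or.inl hr0) (Or.inl (by finiteness)), one_mul]
      exact_mod_cast hr
    exact le_antisymm (ge_of_tendsto' h4 h1) zero_le
  have h5 : ∀ᵐ ω ∂μ, ∀ n : ℕ, X ω < ((c + 1 / (n + 1) : ℝ≥0) : ℝ≥0∞) := by
    rw [ae_all_iff]
    intro n
    rw [ae_iff]
    simp only [not_lt]
    exact key _ (lt_add_of_pos_right _ (by positivity))
  filter_upwards [h5] with ω hω
  have h6 : Tendsto (fun n : ℕ => ((c + 1 / (n + 1) : ℝ≥0) : ℝ≥0∞)) atTop (𝓝 ((c + 0 : ℝ≥0) : ℝ≥0∞)) :=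
    ENNReal.tendsto_coe.2 (tendsto_const_nhds.add tendsto_one_div_add_atTop_nhds_zero_nat)
  rw [add_zero] at h6
  exact ge_of_tendsto' h6 fun n => (hω n).le

section Limit

variable {d N : ℕ} {p : ℝ≥0∞} [Fact (1 ≤ p)] {D : Set (Vec d)} {T P : ℝ} {c : ℝ≥0}
  {μn : ℕ → ℝ → Measure (LpSpace d N p D)} {μ : ℝ → Measure (LpSpace d N p D)}
  {νn : ℕ → TimeCorrFamily d N} {ν : TimeCorrFamily d N}

lemma enorm_rpow_eq_ofReal {P : ℝ} (hP : 0 ≤ P) (ξ : Vec N) :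
    ‖ξ‖ₑ ^ P = ENNReal.ofReal (‖ξ‖ ^ P) := by
  rw [← ENNReal.ofReal_rpow_of_nonneg (norm_nonneg _) hP, ofReal_norm]

lemma ofReal_prod_eq {k : ℕ} (G : Fin k → ℝ) (hG : ∀ j, 0 ≤ G j) :
    ENNReal.ofReal (∏ j, G j) = ∏ j, ENNReal.ofReal (G j) :=
  ENNReal.ofReal_prod_of_nonneg fun j _ => hG j

/-- Bounds for moments of truncated observables pass to the limit. -/
lemma ae_lintegral_truncated_le (hp : p ≠ ∞) (hDf : volume D ≠ ∞) (hP : 1 ≤ P)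
    (hn : ∀ n, TimeDualBdd T P c (μn n) (νn n)) (hν : ∀ k, IsMarkovKernel (ν k))
    (hobs : ObservablesConverge D T P νn ν) (l R : ℕ) :
    ∀ᵐ t ∂volume.restrict (Ico 0 T),
      ∫⁻ y, ∏ j, ENNReal.ofReal (min (‖y.2 j‖ ^ P) R)
        ∂((volume.restrict (domPow D (l + 1))) ⊗ₘ (ν.slice t (l + 1))) ≤ c ^ (l + 1) := by
  have hP0 : 0 ≤ P := by linarith
  -- Truncation makes |ξ|^P bounded while it keeps the weighted Lipschitz estimate, so products of
  -- any order are admissible observables.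
  let g : Vec N → ℝ := fun ξ => min (‖ξ‖ ^ P) R
  have hg0 : ∀ ξ, 0 ≤ g ξ := fun ξ => le_min (by positivity) (by positivity)
  have hgc : Continuous g :=
    (continuous_norm.rpow_const fun _ => Or.inr hP0).min continuous_const
  have hgB : ∀ ξ, |g ξ| ≤ R := fun ξ => by
    rw [abs_of_nonneg (hg0 ξ)]; exact min_le_right _ _
  have hgL : ∀ ζ ξ, |g ζ - g ξ| ≤ P * (‖ζ - ξ‖ * max ‖ξ‖ ‖ζ‖ ^ (P - 1)) := by
    intro ζ ξ
    refine le_trans ?_ (abs_norm_rpow_sub_le hP ζ ξ)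
    refine (abs_min_sub_min_le_max _ _ _ _).trans ?_
    simp
  have hgm : Measurable fun ξ : Fin (l + 1) → Vec N => ∏ j, ENNReal.ofReal (g (ξ j)) :=
    Finset.measurable_fun_prod _ fun j _ =>
      (hgc.measurable.comp (measurable_pi_apply j)).ennreal_ofReal
  have := hν (l + 1)
  have hqm : Measurable fun t : ℝ => ∫⁻ y : (Fin (l + 1) → Vec d) × (Fin (l + 1) → Vec N),
      ∏ j, ENNReal.ofReal (g (y.2 j))
      ∂((volume.restrict (domPow D (l + 1))) ⊗ₘ (ν.slice t (l + 1))) := by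
    simp only [← const_compProd_apply hν]
    exact Measurable.lintegral_kernel (hgm.comp measurable_snd)
  -- Strong convergence controls integrals in time only. A bound for almost every t follows from the
  -- bounds over all measurable sets of times, which enter the observable through their indicators.
  refine ae_le_of_forall_setLIntegral_le_of_sigmaFinite hqm ?_
  intro A hA _
  -- integrals over the set `A` of times
  have hprod0 : ∀ w : (ℝ × (Fin (l + 1) → Vec d)) × (Fin (l + 1) → Vec N),
      0 ≤ A.indicator 1 w.1.1 * 1 * ∏ j, g (w.2 j) := fun w =>
    mul_nonneg (mul_nonneg (indicator_nonneg (fun _ _ => zero_le_one) _) zero_le_one)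
      (Finset.prod_nonneg fun j _ => hg0 _)
  have hmeas : Measurable fun w : (ℝ × (Fin (l + 1) → Vec d)) × (Fin (l + 1) → Vec N) =>
      A.indicator (1 : ℝ → ℝ) w.1.1 * 1 * ∏ j, g (w.2 j) := by
    refine ((((measurable_one.indicator hA).comp (measurable_fst.comp measurable_fst))).mul
      measurable_const).mul (Finset.measurable_fun_prod _ fun j _ => hgc.measurable.comp ?_)
    fun_prop
  have key : ∀ κ : TimeCorrFamily d N, (∀ k, IsMarkovKernel (κ k)) →
      ENNReal.ofReal (∫ w, A.indicator 1 w.1.1 * 1 * ∏ j, g (w.2 j) ∂(jointLaw D T κ (l + 1))) =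
      ∫⁻ t in A, ∫⁻ y, ∏ j, ENNReal.ofReal (g (y.2 j))
        ∂((volume.restrict (domPow D (l + 1))) ⊗ₘ (κ.slice t (l + 1)))
        ∂(volume.restrict (Ico 0 T)) := by
    intro κ hκ
    have := isFiniteMeasure_jointLaw (T := T) hDf hκ (l + 1)
    rw [ofReal_integral_eq_lintegral_ofReal ?_ (ae_of_all _ hprod0),
      lintegral_jointLaw hκ hmeas.ennreal_ofReal, ← lintegral_indicator hA]
    · refine lintegral_congr fun t => ?_
      by_cases ht : t ∈ A
      · simp [ht, ofReal_prod_eq _ fun j => hg0 _]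
      · simp [ht]
    · refine Integrable.of_bound hmeas.aestronglyMeasurable (R ^ (l + 1)) (ae_of_all _ fun w => ?_)
      rw [norm_mul, Real.norm_eq_abs, Real.norm_eq_abs]
      have h1 : |A.indicator (1 : ℝ → ℝ) w.1.1 * 1| ≤ 1 := by
        by_cases ht : w.1.1 ∈ A <;> simp [ht]
      calc _ ≤ 1 * (R : ℝ) ^ (l + 1) := mul_le_mul h1 (abs_prod_le_pow (fun _ => g)
            (fun _ => hgB) _) (abs_nonneg _) zero_le_one
        _ = _ := one_mul _
  have hlim := hobs.tendsto_integral_prod hDf (fun n => (hn n).markov) hν (l := l) hA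
    (χ := fun _ => 1) measurable_const (K := 1) (fun _ => by simp) (B := R) (L := P)
    (by positivity) hP0 (fun _ => g) (fun _ => hgc) (fun _ => hgB) (fun _ => hgL)
  have hlim' := (ENNReal.continuous_ofReal.tendsto _).comp hlim
  simp only [Function.comp_def, key _ hν, key _ (hn _).markov] at hlim'
  refine le_of_tendsto' hlim' fun n => ?_
  refine lintegral_mono_ae (ae_restrict_of_ae ?_)
  filter_upwards [(hn n).slice] with t ht
  have := ht.prob
  rw [lintegral_compProd_prod hp hDf ht.markov ht.dual _ fun _ => hgc.measurable.ennreal_ofReal]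
  calc _ ≤ ∫⁻ _u, (c : ℝ≥0∞) ^ (l + 1) ∂(μn n t) := by
        refine lintegral_mono_ae ?_
        filter_upwards [ht.bound] with u hu
        rw [Finset.prod_const, Finset.card_univ, Fintype.card_fin]
        refine pow_le_pow_left' (le_trans (lintegral_mono fun x => ?_) hu) _
        rw [enorm_rpow_eq_ofReal hP0]
        exact ENNReal.ofReal_le_ofReal (min_le_left _ _)
    _ = _ := by simp

/-- With X(u) = ∫_D min(|u|^P,R) dx, the factorised moments read ∫ X^(l+1) dμ_t ≤ c^(l+1) for all l,
whence X ≤ c almost everywhere; monotone convergence removes R. The exceptional set of times is a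
countable union over l and R. -/
theorem timeDualBdd_limit (hp : p ≠ ∞) (hDf : volume D ≠ ∞) (hP : 1 ≤ P)
    (hn : ∀ n, TimeDualBdd T P c (μn n) (νn n)) (hν : ∀ k, IsMarkovKernel (ν k))
    (hμ : ∀ᵐ t ∂volume.restrict (Ico 0 T), IsProbabilityMeasure (μ t))
    (hdual : ∀ᵐ t ∂volume.restrict (Ico 0 T), IsDual (μ t) (ν.slice t))
    (hobs : ObservablesConverge D T P νn ν) : TimeDualBdd T P c μ ν := by
  refine ⟨hν, ?_⟩
  have hP0 : 0 ≤ P := by linarith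
  have h1 : ∀ᵐ t ∂volume.restrict (Ico 0 T), ∀ l R : ℕ,
      ∫⁻ y, ∏ j, ENNReal.ofReal (min (‖y.2 j‖ ^ P) R)
        ∂((volume.restrict (domPow D (l + 1))) ⊗ₘ (ν.slice t (l + 1))) ≤ c ^ (l + 1) := by
    rw [ae_all_iff]; intro l
    rw [ae_all_iff]; intro R
    exact ae_lintegral_truncated_le hp hDf hP hn hν hobs l R
  filter_upwards [h1, hμ, hdual] with t ht hμt hdt
  have hmk : ∀ k, IsMarkovKernel (ν.slice t k) := fun k => by
    have := hν k
    rw [TimeCorrFamily.slice]; infer_instance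
  refine ⟨hμt, hmk, hdt, ?_⟩
  have hbm : ∀ R : ℕ, Measurable fun ξ : Vec N => ENNReal.ofReal (min (‖ξ‖ ^ P) R) := fun R =>
    ((measurable_norm.pow_const P).min measurable_const).ennreal_ofReal
  have h2 : ∀ᵐ u ∂(μ t), ∀ R : ℕ, ∫⁻ x in D, ENNReal.ofReal (min (‖u x‖ ^ P) R) ≤ c := by
    rw [ae_all_iff]
    intro R
    refine ae_le_of_lintegral_pow_le (μ t) (measurable_lintegral_comp hp (hbm R)) c fun l => ?_
    have := ht l R
    rw [lintegral_compProd_prod hp hDf hmk hdt (fun _ ξ => ENNReal.ofReal (min (‖ξ‖ ^ P) R))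
      fun _ => hbm R] at this
    simpa using this
  filter_upwards [h2] with u hu
  have hum : AEMeasurable u (volume.restrict D) := (Lp.aestronglyMeasurable u).aemeasurable
  have h3 : Tendsto (fun R : ℕ => ∫⁻ x in D, ENNReal.ofReal (min (‖u x‖ ^ P) R)) atTop
      (𝓝 (∫⁻ x in D, ‖u x‖ₑ ^ P)) := by
    refine lintegral_tendsto_of_tendsto_of_monotone (fun R => (hbm R).comp_aemeasurable hum)
      (ae_of_all _ fun x => ?_) (ae_of_all _ fun x => ?_)
    · intro R R' hR
      exact ENNReal.ofReal_le_ofReal (min_le_min le_rfl (by exact_mod_cast hR))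
    · rw [enorm_rpow_eq_ofReal hP0]
      refine tendsto_const_nhds.congr' ?_
      obtain ⟨R₀, hR₀⟩ := exists_nat_ge (‖u x‖ ^ P)
      filter_upwards [eventually_ge_atTop R₀] with R hR
      rw [min_eq_left (hR₀.trans (by exact_mod_cast hR))]
  exact le_of_tendsto' h3 hu

/-! ### Uniform integrability -/

lemma two_mul_ofReal (a : ℝ) : 2 * ENNReal.ofReal a = ENNReal.ofReal (2 * a) := by
  rw [ENNReal.ofReal_mul zero_le_two, ENNReal.ofReal_ofNat]

/-- `|ξ|^P` on `{|ξ| > R}`. -/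
def tail (P R : ℝ) (ξ : Vec N) : ℝ≥0∞ := {ξ : Vec N | R < ‖ξ‖}.indicator (fun ξ => ‖ξ‖ₑ ^ P) ξ

lemma measurable_tail (P R : ℝ) : Measurable (tail P R : Vec N → ℝ≥0∞) :=
  (measurable_enorm.pow_const P).indicator (measurableSet_lt measurable_const measurable_norm)

/-- The excess max(|ξ|^P − R, 0) grows like |ξ|^P but satisfies the weighted Lipschitz condition, so
its mean converges along the sequence. For the limit it is small for large R by dominated
convergence; hence it is small for all large n with the same R. -/
theorem exists_tail_le (hp : p ≠ ∞) (hDf : volume D ≠ ∞) (hP : 1 ≤ P)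
    (hn : ∀ n, TimeDualBdd T P c (μn n) (νn n)) (h : TimeDualBdd T P c μ ν)
    (hobs : ObservablesConverge D T P νn ν) {ε : ℝ} (hε : 0 < ε) :
    ∃ R : ℝ, 1 ≤ R ∧ (∀ᶠ n in atTop, ∫⁻ w, tail P R (w.2 0) ∂(jointLaw D T (νn n) 1) ≤
      ENNReal.ofReal ε) ∧ ∫⁻ w, tail P R (w.2 0) ∂(jointLaw D T ν 1) ≤ ENNReal.ofReal ε := by
  have hP0 : 0 ≤ P := by linarith
  let g : ℕ → Vec N → ℝ := fun R ξ => max (‖ξ‖ ^ P - R) 0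
  have hg0 : ∀ R ξ, 0 ≤ g R ξ := fun R ξ => le_max_right _ _
  have hgc : ∀ R, Continuous (g R) := fun R =>
    ((continuous_norm.rpow_const fun _ => Or.inr hP0).sub continuous_const).max continuous_const
  have hgle : ∀ R ξ, g R ξ ≤ ‖ξ‖ ^ P := fun R ξ =>
    max_le (by simp) (by positivity)
  have hgC : ∀ R ξ, |g R ξ| ≤ 1 * (1 + ‖ξ‖ ^ P) := fun R ξ => by
    rw [abs_of_nonneg (hg0 R ξ)]; linarith [hgle R ξ]
  have hgL : ∀ R ζ ξ, |g R ζ - g R ξ| ≤ P * (‖ζ - ξ‖ * max ‖ξ‖ ‖ζ‖ ^ (P - 1)) := by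
    intro R ζ ξ
    refine le_trans ?_ (abs_norm_rpow_sub_le hP ζ ξ)
    refine (abs_max_sub_max_le_max _ _ _ _).trans ?_
    simp
  have hinteg : ∀ (R : ℕ) {μ' : ℝ → Measure (LpSpace d N p D)} {κ : TimeCorrFamily d N},
      TimeDualBdd T P c μ' κ →
      Integrable (fun w => g R (w.2 0)) (jointLaw D T κ 1) := by
    intro R μ' κ hκ
    simpa using hκ.integrable_prod hp hDf hP0 (k := 1) (fun _ => g R)
      (fun _ => (hgc R).measurable) (fun _ => hgC R)
  -- the truncated moments of the limit are small
  have hlim0 : Tendsto (fun R : ℕ => ∫ w, g R (w.2 0) ∂(jointLaw D T ν 1)) atTop (𝓝 0) := by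
    rw [← integral_zero ((ℝ × (Fin 1 → Vec d)) × (Fin 1 → Vec N)) ℝ (μ := jointLaw D T ν 1)]
    refine tendsto_integral_of_dominated_convergence (fun w => g 0 (w.2 0))
      (fun R => (hinteg R h).aestronglyMeasurable) (hinteg 0 h) (fun R => ae_of_all _ fun w => ?_)
      (ae_of_all _ fun w => ?_)
    · rw [Real.norm_of_nonneg (hg0 _ _)]
      exact max_le_max (sub_le_sub_left (by simp) _) le_rfl
    · refine tendsto_const_nhds.congr' ?_
      obtain ⟨R₀, hR₀⟩ := exists_nat_ge (‖w.2 0‖ ^ P)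
      filter_upwards [eventually_ge_atTop R₀] with R hR
      have : (R₀ : ℝ) ≤ R := by exact_mod_cast hR
      exact (max_eq_right (by linarith)).symm
  obtain ⟨R, hR⟩ := (hlim0.eventually_lt_const (show (0 : ℝ) < ε / 2 by positivity)).exists
  have hconv : Tendsto (fun n => ∫ w, g R (w.2 0) ∂(jointLaw D T (νn n) 1)) atTop
      (𝓝 (∫ w, g R (w.2 0) ∂(jointLaw D T ν 1))) := by
    have := hobs.tendsto_integral hDf (fun n => (hn n).markov) h.markov (l := 0) (A := univ)
      .univ (χ := fun _ => 1) measurable_const (K := 1) (fun _ => by simp)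
      (G := fun ξ => g R (ξ 0)) ((hgc R).comp (continuous_apply 0)) (C := 1) (L := P)
      zero_le_one hP0 (fun ξ => hgC R _) (fun ζ ξ => by simpa using hgL R (ζ 0) (ξ 0))
      (fun n => hinteg R (hn n)) (hinteg R h)
    simpa using this
  -- comparison of the tail with the truncated moment
  have htail : ∀ ξ : Vec N, tail P (max 1 (2 * R)) ξ ≤ 2 * ENNReal.ofReal (g R ξ) := by
    intro ξ
    unfold tail
    by_cases hξ : max 1 (2 * (R : ℝ)) < ‖ξ‖
    · rw [indicator_of_mem (show ξ ∈ {ξ : Vec N | max 1 (2 * (R : ℝ)) < ‖ξ‖} from hξ),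
        enorm_rpow_eq_ofReal hP0]
      -- Beyond max(1, 2R) one has |ξ|^P ≥ |ξ| > 2R, and so |ξ|^P ≤ 2(|ξ|^P − R).
      have h1 : ‖ξ‖ ≤ ‖ξ‖ ^ P := Real.self_le_rpow_of_one_le
        ((le_max_left _ _).trans hξ.le) hP
      have h2 : 2 * (R : ℝ) < ‖ξ‖ := (le_max_right _ _).trans_lt hξ
      rw [two_mul_ofReal]
      refine ENNReal.ofReal_le_ofReal ?_
      have : ‖ξ‖ ^ P - R ≤ g R ξ := le_max_left _ _
      linarith
    · rw [indicator_of_notMem (by simpa using hξ)]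
      exact zero_le
  have hfinal : ∀ {μ' : ℝ → Measure (LpSpace d N p D)} {κ : TimeCorrFamily d N},
      TimeDualBdd T P c μ' κ → ∫ w, g R (w.2 0) ∂(jointLaw D T κ 1) < ε / 2 →
      ∫⁻ w, tail P (max 1 (2 * R)) (w.2 0) ∂(jointLaw D T κ 1) ≤ ENNReal.ofReal ε := by
    intro μ' κ hκ hlt
    calc _ ≤ ∫⁻ w, 2 * ENNReal.ofReal (g R (w.2 0)) ∂(jointLaw D T κ 1) :=
          lintegral_mono fun w => htail _
      _ = 2 * ∫⁻ w, ENNReal.ofReal (g R (w.2 0)) ∂(jointLaw D T κ 1) :=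
          lintegral_const_mul' _ _ (by simp)
      _ = 2 * ENNReal.ofReal (∫ w, g R (w.2 0) ∂(jointLaw D T κ 1)) := by
          rw [ofReal_integral_eq_lintegral_ofReal (hinteg R hκ) (ae_of_all _ fun w => hg0 _ _)]
      _ ≤ 2 * ENNReal.ofReal (ε / 2) := by gcongr
      _ = ENNReal.ofReal ε := by
          rw [two_mul_ofReal]
          congr 1; ring
  refine ⟨max 1 (2 * R), le_max_left _ _, ?_, hfinal h hR⟩
  filter_upwards [hconv.eventually_lt_const hR] with n hn'
  exact hfinal (hn n) hn'

end Limit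

/-! ### Approximation of observables -/

/-- The radial projection onto the closed ball of radius `r`. -/
def radialProj {N : ℕ} (r : ℝ) (ξ : Vec N) : Vec N := if ‖ξ‖ ≤ r then ξ else (r / ‖ξ‖) • ξ

section RadialProj

variable {N : ℕ} {r : ℝ}

lemma norm_radialProj_le (hr : 0 ≤ r) (ξ : Vec N) : ‖radialProj r ξ‖ ≤ r := by
  unfold radialProj
  split_ifs with h
  · exact h
  · have hξ : 0 < ‖ξ‖ := hr.trans_lt (not_le.1 h)
    rw [norm_smul, Real.norm_of_nonneg (by positivity), div_mul_cancel₀ _ hξ.ne']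

lemma norm_radialProj_le_norm (hr : 0 ≤ r) (ξ : Vec N) : ‖radialProj r ξ‖ ≤ ‖ξ‖ := by
  by_cases h : ‖ξ‖ ≤ r
  · rw [radialProj, if_pos h]
  · exact (norm_radialProj_le hr ξ).trans (not_le.1 h).le

/-- Only some uniform Lipschitz constant is needed; the factor 2 comes from the triangle inequality
alone. -/
lemma norm_radialProj_sub_le (hr : 0 ≤ r) (ζ ξ : Vec N) :
    ‖radialProj r ζ - radialProj r ξ‖ ≤ 2 * ‖ζ - ξ‖ := by
  have mixed : ∀ x y : Vec N, ‖x‖ ≤ r → r < ‖y‖ → ‖x - (r / ‖y‖) • y‖ ≤ 2 * ‖x - y‖ := by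
    intro x y hx hy
    have hy0 : 0 < ‖y‖ := hr.trans_lt hy
    have e : x - (r / ‖y‖) • y = (x - y) + (1 - r / ‖y‖) • y := by
      rw [sub_smul, one_smul]; abel
    have h1 : 0 ≤ 1 - r / ‖y‖ := by
      rw [sub_nonneg, div_le_one hy0]; exact hy.le
    have h2 : ‖(1 - r / ‖y‖) • y‖ = ‖y‖ - r := by
      rw [norm_smul, Real.norm_of_nonneg h1, sub_mul, one_mul, div_mul_cancel₀ _ hy0.ne']
    rw [e]
    have h3 := norm_add_le (x - y) ((1 - r / ‖y‖) • y)
    have h4 := norm_sub_norm_le y x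
    rw [norm_sub_rev] at h4
    linarith
  unfold radialProj
  split_ifs with h1 h2 h2
  · linarith [norm_nonneg (ζ - ξ)]
  · exact mixed _ _ h1 (not_le.1 h2)
  · rw [norm_sub_rev, norm_sub_rev ζ]
    exact mixed _ _ h2 (not_le.1 h1)
  · have hζ : 0 < ‖ζ‖ := hr.trans_lt (not_le.1 h1)
    have hξ : 0 < ‖ξ‖ := hr.trans_lt (not_le.1 h2)
    have e : (r / ‖ζ‖) • ζ - (r / ‖ξ‖) • ξ =
        (r / ‖ζ‖) • (ζ - ξ) + (r / ‖ζ‖ - r / ‖ξ‖) • ξ := by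
      rw [smul_sub, sub_smul]; abel
    have h3 : r / ‖ζ‖ ≤ 1 := (div_le_one hζ).2 (not_le.1 h1).le
    have h4 : ‖(r / ‖ζ‖ - r / ‖ξ‖) • ξ‖ = r / ‖ζ‖ * |‖ξ‖ - ‖ζ‖| := by
      rw [norm_smul, Real.norm_eq_abs, ← abs_of_pos hξ, ← abs_mul, abs_of_pos hξ]
      have : (r / ‖ζ‖ - r / ‖ξ‖) * ‖ξ‖ = r / ‖ζ‖ * (‖ξ‖ - ‖ζ‖) := by field_simp
      rw [this, abs_mul, abs_of_nonneg (by positivity)]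
    have h5 : ‖(r / ‖ζ‖) • (ζ - ξ)‖ = r / ‖ζ‖ * ‖ζ - ξ‖ := by
      rw [norm_smul, Real.norm_of_nonneg (by positivity)]
    have h6 : |‖ξ‖ - ‖ζ‖| ≤ ‖ζ - ξ‖ := by
      rw [abs_sub_comm]; exact abs_norm_sub_norm_le _ _
    rw [e]
    refine (norm_add_le _ _).trans ?_
    rw [h4, h5]
    have h7 : 0 ≤ r / ‖ζ‖ := by positivity
    nlinarith [norm_nonneg (ζ - ξ), abs_nonneg (‖ξ‖ - ‖ζ‖)]

end RadialProj

/-- A continuous function of polynomial growth that is Lipschitz on balls. -/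
structure IsMomentFn {N : ℕ} (P C : ℝ) (H : Vec N → ℝ) : Prop where
  continuous : Continuous H
  growth : ∀ ξ, |H ξ| ≤ C * (1 + ‖ξ‖ ^ P)
  lipschitz : ∀ R : ℝ, ∃ L : ℝ, 0 ≤ L ∧ ∀ ζ ξ, ‖ζ‖ ≤ R → ‖ξ‖ ≤ R → |H ζ - H ξ| ≤ L * ‖ζ - ξ‖

/-- The weight max(|ξ|,|ζ|)^(P−1) may vanish at the origin, so an admissible function should be flat
there. Take G = H ∘ ρ, where ρ is the projection onto the ball of radius R minus the projection onto
the ball of a small radius ε. Then ρ is Lipschitz and bounded, vanishes for |ξ| ≤ ε, and moves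
points of the R-ball by at most ε. The growth bound on G keeps the error in the tail comparable to
|ξ|^P. -/
lemma IsMomentFn.exists_approx {N : ℕ} {P C : ℝ} (hP : 1 ≤ P) (hC : 0 ≤ C) {H : Vec N → ℝ}
    (hH : IsMomentFn P C H) {R δ : ℝ} (hR : 1 ≤ R) (hδ : 0 < δ) :
    ∃ (G : Vec N → ℝ) (B L : ℝ), 0 ≤ B ∧ 0 ≤ L ∧ Continuous G ∧ (∀ ξ, |G ξ| ≤ B) ∧
      (∀ ζ ξ, |G ζ - G ξ| ≤ L * (‖ζ - ξ‖ * max ‖ξ‖ ‖ζ‖ ^ (P - 1))) ∧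
      (∀ ξ, |G ξ| ≤ (C * 2 ^ P) * (1 + ‖ξ‖ ^ P)) ∧
      ∀ ξ, ‖H ξ - G ξ‖ₑ ≤ ENNReal.ofReal δ + ENNReal.ofReal (4 * (C * 2 ^ P)) * tail P R ξ := by
  have hP0 : 0 ≤ P := by linarith
  -- The map ρ takes values in the ball of radius R + ε ≤ 2R.
  obtain ⟨L, hL0, hL⟩ := hH.lipschitz (2 * R)
  -- the inner radius
  obtain ⟨ε, hε0, hε1, hεL⟩ : ∃ ε : ℝ, 0 < ε ∧ ε ≤ 1 ∧ L * ε ≤ δ := by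
    refine ⟨min 1 (δ / (L + 1)), by positivity, min_le_left _ _, ?_⟩
    calc L * min 1 (δ / (L + 1)) ≤ L * (δ / (L + 1)) :=
          mul_le_mul_of_nonneg_left (min_le_right _ _) hL0
      _ ≤ δ := by
          rw [mul_div_assoc', div_le_iff₀ (by linarith)]; nlinarith
  let ρ : Vec N → Vec N := fun ξ => radialProj R ξ - radialProj ε ξ
  have hR0 : 0 ≤ R := by linarith
  have hρ2R : ∀ ξ, ‖ρ ξ‖ ≤ 2 * R := fun ξ => by
    have h1 := norm_sub_le (radialProj R ξ) (radialProj ε ξ)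
    have h2 := norm_radialProj_le hR0 ξ
    have h3 := norm_radialProj_le hε0.le ξ
    simp only [ρ]; linarith
  have hρ2 : ∀ ξ, ‖ρ ξ‖ ≤ 2 * ‖ξ‖ := fun ξ => by
    have h1 := norm_sub_le (radialProj R ξ) (radialProj ε ξ)
    have h2 := norm_radialProj_le_norm hR0 ξ
    have h3 := norm_radialProj_le_norm hε0.le ξ
    simp only [ρ]; linarith
  have hρL : ∀ ζ ξ, ‖ρ ζ - ρ ξ‖ ≤ 4 * ‖ζ - ξ‖ := fun ζ ξ => by
    have e : ρ ζ - ρ ξ = (radialProj R ζ - radialProj R ξ) -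
        (radialProj ε ζ - radialProj ε ξ) := by simp only [ρ]; abel
    rw [e]
    have h1 := norm_sub_le (radialProj R ζ - radialProj R ξ) (radialProj ε ζ - radialProj ε ξ)
    have h2 := norm_radialProj_sub_le hR0 ζ ξ
    have h3 := norm_radialProj_sub_le hε0.le ζ ξ
    linarith
  have hρ0 : ∀ ξ, ‖ξ‖ ≤ ε → ρ ξ = 0 := fun ξ hξ => by
    simp only [ρ]
    rw [radialProj, if_pos (hξ.trans (hε1.trans hR)), radialProj, if_pos hξ, sub_self]
  have hGL : ∀ ζ ξ, |H (ρ ζ) - H (ρ ξ)| ≤ (L * 4) * ‖ζ - ξ‖ := fun ζ ξ => by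
    calc _ ≤ L * ‖ρ ζ - ρ ξ‖ := hL _ _ (hρ2R ζ) (hρ2R ξ)
      _ ≤ L * (4 * ‖ζ - ξ‖) := by gcongr; exact hρL _ _
      _ = _ := by ring
  have hGg : ∀ ξ, |H (ρ ξ)| ≤ (C * 2 ^ P) * (1 + ‖ξ‖ ^ P) := fun ξ => by
    refine (hH.growth _).trans ?_
    rw [mul_assoc]
    refine mul_le_mul_of_nonneg_left ?_ hC
    have h1 : ‖ρ ξ‖ ^ P ≤ 2 ^ P * ‖ξ‖ ^ P := by
      rw [← Real.mul_rpow zero_le_two (norm_nonneg _)]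
      exact Real.rpow_le_rpow (norm_nonneg _) (hρ2 ξ) hP0
    have h2 : (1 : ℝ) ≤ 2 ^ P := Real.one_le_rpow (by norm_num) hP0
    linarith
  refine ⟨fun ξ => H (ρ ξ), C * (1 + (2 * R) ^ P), L * 4 * (ε ^ (P - 1))⁻¹, by positivity,
    by positivity, ?_, ?_, ?_, hGg, ?_⟩
  · refine (LipschitzWith.of_dist_le_mul (K := ⟨L * 4, by positivity⟩) fun ζ ξ => ?_).continuous
    rw [Real.dist_eq, dist_eq_norm]
    exact hGL ζ ξ
  · intro ξ
    refine (hH.growth _).trans (mul_le_mul_of_nonneg_left ?_ hC)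
    have := Real.rpow_le_rpow (norm_nonneg _) (hρ2R ξ) hP0
    linarith
  · intro ζ ξ
    by_cases hmax : max ‖ξ‖ ‖ζ‖ ≤ ε
    · simp only
      rw [hρ0 ζ ((le_max_right _ _).trans hmax), hρ0 ξ ((le_max_left _ _).trans hmax)]
      simp only [sub_self, abs_zero]
      positivity
    -- Here one of the two points lies outside the ε-ball, so the weight is at least ε^(P−1); this
    -- is the origin of the factor (ε^(P−1))⁻¹ in the Lipschitz constant.
    · refine (hGL ζ ξ).trans ?_
      have h1 : ε ^ (P - 1) ≤ max ‖ξ‖ ‖ζ‖ ^ (P - 1) :=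
        Real.rpow_le_rpow hε0.le (not_le.1 hmax).le (by linarith)
      have h2 : 0 < ε ^ (P - 1) := Real.rpow_pos_of_pos hε0 _
      have h3 : 1 ≤ (ε ^ (P - 1))⁻¹ * max ‖ξ‖ ‖ζ‖ ^ (P - 1) := by
        rw [inv_mul_eq_div]; exact (one_le_div h2).2 h1
      calc L * 4 * ‖ζ - ξ‖ = L * 4 * ‖ζ - ξ‖ * 1 := (mul_one _).symm
        _ ≤ L * 4 * ‖ζ - ξ‖ * ((ε ^ (P - 1))⁻¹ * max ‖ξ‖ ‖ζ‖ ^ (P - 1)) :=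
            mul_le_mul_of_nonneg_left h3 (by positivity)
        _ = _ := by ring
  · intro ξ
    by_cases hξ : ‖ξ‖ ≤ R
    · refine le_trans ?_ le_self_add
      rw [Real.enorm_eq_ofReal_abs]
      refine ENNReal.ofReal_le_ofReal (le_trans ?_ hεL)
      refine (hL _ _ (by linarith) (hρ2R ξ)).trans (mul_le_mul_of_nonneg_left ?_ hL0)
      have e : ξ - ρ ξ = radialProj ε ξ := by
        simp only [ρ]
        rw [show radialProj R ξ = ξ by rw [radialProj, if_pos hξ]]; abel
      rw [e]
      exact norm_radialProj_le hε0.le ξ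
    · refine le_trans ?_ le_add_self
      rw [tail, indicator_of_mem (show ξ ∈ {ξ : Vec N | R < ‖ξ‖} from not_le.1 hξ),
        enorm_rpow_eq_ofReal hP0, ← ENNReal.ofReal_mul (by positivity), Real.enorm_eq_ofReal_abs]
      refine ENNReal.ofReal_le_ofReal ?_
      -- Both H and G are bounded by C·2^P(1 + |ξ|^P), and 1 ≤ |ξ|^P in the tail; the four resulting
      -- terms give the factor 4.
      have h1 : 1 ≤ ‖ξ‖ ^ P := Real.one_le_rpow (hR.trans (not_le.1 hξ).le) hP0
      have h2 : (1 : ℝ) ≤ 2 ^ P := Real.one_le_rpow (by norm_num) hP0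
      have h3 : |H ξ| ≤ (C * 2 ^ P) * (1 + ‖ξ‖ ^ P) := by
        refine (hH.growth ξ).trans (mul_le_mul_of_nonneg_right ?_ (by positivity))
        nlinarith
      have h4 := abs_sub (H ξ) (H (ρ ξ))
      have h5 : 0 ≤ C * 2 ^ P := by positivity
      nlinarith [hGg ξ]

lemma tendsto_of_forall_approx {a : ℕ → ℝ} {x : ℝ}
    (h : ∀ η > 0, ∃ (b : ℕ → ℝ) (y : ℝ), Tendsto b atTop (𝓝 y) ∧ (∀ᶠ n in atTop, |a n - b n| ≤ η) ∧
      |x - y| ≤ η) : Tendsto a atTop (𝓝 x) := by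
  rw [Metric.tendsto_atTop']
  intro ε hε
  obtain ⟨b, y, hb, hab, hxy⟩ := h (ε / 4) (by positivity)
  have h1 := (Metric.tendsto_nhds.1 hb) (ε / 4) (by positivity)
  obtain ⟨n₀, hn₀⟩ := eventually_atTop.1 (hab.and h1)
  refine ⟨n₀, fun n hn => ?_⟩
  obtain ⟨h2, h3⟩ := hn₀ n hn.le
  rw [Real.dist_eq] at h3 ⊢
  have : a n - x = (a n - b n) + (b n - y) - (x - y) := by ring
  rw [this]
  have h4 := abs_sub (a n - b n + (b n - y)) (x - y)
  have h5 := abs_add_le (a n - b n) (b n - y)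
  linarith

section Convergence

variable {d N : ℕ} {p : ℝ≥0∞} [Fact (1 ≤ p)] {D : Set (Vec d)} {T P : ℝ} {c : ℝ≥0}
  {μn : ℕ → ℝ → Measure (LpSpace d N p D)} {μ : ℝ → Measure (LpSpace d N p D)}
  {νn : ℕ → TimeCorrFamily d N} {ν : TimeCorrFamily d N}

lemma ae_jointLaw_mem (hD : MeasurableSet D) (ν : TimeCorrFamily d N) (k : ℕ) :
    ∀ᵐ w ∂(jointLaw D T ν k), w.1 ∈ Ico 0 T ×ˢ domPow D k := by
  have hS : MeasurableSet (Ico 0 T ×ˢ domPow D k) :=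
    measurableSet_Ico.prod (measurableSet_domPow hD k)
  exact Measure.ae_compProd_of_ae_fst (ν k) hS (ae_restrict_mem hS)

lemma jointLaw_univ (hν : ∀ k, IsMarkovKernel (ν k)) (k : ℕ) :
    jointLaw D T ν k univ = volume (Ico 0 T ×ˢ domPow D k) := by
  have := hν k
  rw [jointLaw, Measure.compProd_apply_univ, Measure.restrict_apply_univ]

/-- Convergence of bounded product observables against continuous test functions. -/
lemma tendsto_integral_mul_prod_of_bounded (hD : MeasurableSet D) (hDf : volume D ≠ ∞) (hT : 0 < T)
    (hobs : ObservablesConverge D T P νn ν) (hνn : ∀ n k, IsMarkovKernel (νn n k))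
    (hν : ∀ k, IsMarkovKernel (ν k)) {l : ℕ} {Φ : ℝ × (Fin (l + 1) → Vec d) → ℝ}
    (hΦ : Continuous Φ) (hΦc : HasCompactSupport Φ)
    {B L : ℝ} (hB : 0 ≤ B) (hL : 0 ≤ L) (G : Fin (l + 1) → Vec N → ℝ)
    (hG : ∀ j, Continuous (G j)) (hGB : ∀ j ξ, |G j ξ| ≤ B)
    (hGL : ∀ j ζ ξ, |G j ζ - G j ξ| ≤ L * (‖ζ - ξ‖ * max ‖ξ‖ ‖ζ‖ ^ (P - 1))) :
    Tendsto (fun n => ∫ w, Φ w.1 * ∏ j, G j (w.2 j) ∂(jointLaw D T (νn n) (l + 1))) atTop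
      (𝓝 (∫ w, Φ w.1 * ∏ j, G j (w.2 j) ∂(jointLaw D T ν (l + 1)))) := by
  obtain ⟨K, hK⟩ := hΦc.exists_bound_of_continuous hΦ
  have huc := hΦc.uniformContinuous_of_continuous hΦ
  set V : ℝ := (volume (Ico 0 T ×ˢ domPow D (l + 1))).toReal with hV
  have hprodm : Measurable fun ξ : Fin (l + 1) → Vec N => ∏ j, G j (ξ j) :=
    (continuous_finsetProd _ fun j _ => (hG j).comp (continuous_apply j)).measurable
  refine tendsto_of_forall_approx fun η hη => ?_
  -- the accuracy in time
  obtain ⟨θ, hθ0, hθ⟩ : ∃ θ : ℝ, 0 < θ ∧ θ * B ^ (l + 1) * V ≤ η := by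
    have hc : 0 ≤ B ^ (l + 1) * V := by positivity
    refine ⟨η / (B ^ (l + 1) * V + 1), by positivity, ?_⟩
    rw [mul_assoc, div_mul_eq_mul_div, div_le_iff₀ (by linarith)]
    nlinarith
  obtain ⟨δ, hδ0, hδ⟩ := Metric.uniformContinuous_iff.1 huc θ hθ0
  obtain ⟨J, hJ⟩ := exists_nat_gt (T / δ)
  have hJ0 : 0 < (J : ℝ) := (by positivity : 0 < T / δ).trans hJ
  -- Within [0,T) these are J time slabs of length T/J < δ. On each of them Φ is frozen at the left
  -- end point, which separates time from space as the admissible observables require.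
  let A : ℕ → Set ℝ := fun i => {t | ⌊t * J / T⌋₊ = i}
  have hA : ∀ i, MeasurableSet (A i) := fun i =>
    (Nat.measurable_floor.comp (by fun_prop : Measurable fun t : ℝ => t * J / T))
      (measurableSet_singleton i)
  let χ : ℕ → (Fin (l + 1) → Vec d) → ℝ := fun i x => Φ (i * T / J, x)
  have hχm : ∀ i, Measurable (χ i) := fun i => (hΦ.comp (by fun_prop)).measurable
  have hχK : ∀ i x, |χ i x| ≤ K := fun i x => hK _
  let Ψ : ℝ × (Fin (l + 1) → Vec d) → ℝ := fun z =>
    ∑ i ∈ Finset.range J, (A i).indicator 1 z.1 * χ i z.2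
  have hΨm : Measurable Ψ := by
    refine Finset.measurable_fun_sum _ fun i _ => ?_
    exact ((measurable_one.indicator (hA i)).comp measurable_fst).mul
      ((hχm i).comp measurable_snd)
  have hΨ : ∀ z ∈ Ico 0 T ×ˢ domPow D (l + 1), |Φ z - Ψ z| ≤ θ := by
    rintro ⟨t, x⟩ ⟨⟨ht0, htT⟩, -⟩
    simp only at ht0 htT
    have hq0 : 0 ≤ t * J / T := by positivity
    have hlt : ⌊t * J / T⌋₊ < J := by
      rw [Nat.floor_lt hq0, div_lt_iff₀ hT, mul_comm]
      exact mul_lt_mul_of_pos_left htT hJ0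
    have e : Ψ (t, x) = χ ⌊t * J / T⌋₊ x := by
      simp only [Ψ]
      rw [Finset.sum_eq_single_of_mem _ (Finset.mem_range.2 hlt)]
      · rw [indicator_of_mem (show t ∈ A ⌊t * J / T⌋₊ from rfl)]; simp
      · intro i _ hi
        rw [indicator_of_notMem (show t ∉ A i from fun h : ⌊t * J / T⌋₊ = i => hi h.symm), zero_mul]
    rw [e]
    refine (hδ (?_ : dist (t, x) ((⌊t * J / T⌋₊ : ℝ) * T / J, x) < δ)).le
    rw [Prod.dist_eq, dist_self, max_eq_left dist_nonneg, Real.dist_eq]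
    have h1 := Nat.floor_le hq0
    have h2 := Nat.lt_floor_add_one (t * J / T)
    have h3 : T / J < δ := by
      rw [div_lt_iff₀ hJ0]; rw [div_lt_iff₀ hδ0] at hJ; linarith
    have h4 : t - (⌊t * J / T⌋₊ : ℝ) * T / J = (t * J / T - ⌊t * J / T⌋₊) * (T / J) := by
      field_simp
    rw [h4, abs_of_nonneg (mul_nonneg (by linarith) (by positivity))]
    calc _ ≤ 1 * (T / J) := mul_le_mul_of_nonneg_right (by linarith) (by positivity)
      _ < δ := by linarith
  have herr : ∀ κ : TimeCorrFamily d N, (∀ k, IsMarkovKernel (κ k)) →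
      (∀ i, Integrable (fun w => (A i).indicator 1 w.1.1 * χ i w.1.2 * ∏ j, G j (w.2 j))
        (jointLaw D T κ (l + 1))) ∧
      |∫ w, Φ w.1 * ∏ j, G j (w.2 j) ∂(jointLaw D T κ (l + 1)) -
        ∫ w, Ψ w.1 * ∏ j, G j (w.2 j) ∂(jointLaw D T κ (l + 1))| ≤ η := by
    intro κ hκ
    have := isFiniteMeasure_jointLaw (T := T) hDf hκ (l + 1)
    have hGi : Integrable (fun w => ∏ j, G j (w.2 j)) (jointLaw D T κ (l + 1)) :=
      Integrable.of_bound (hprodm.comp measurable_snd).aestronglyMeasurable (B ^ (l + 1))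
        (ae_of_all _ fun w => abs_prod_le_pow G hGB _)
    have hi : ∀ i, Integrable (fun w => (A i).indicator 1 w.1.1 * χ i w.1.2 * ∏ j, G j (w.2 j))
        (jointLaw D T κ (l + 1)) := by
      intro i
      refine hGi.bdd_mul (c := K) (((measurable_one.indicator (hA i)).comp
        (measurable_fst.comp measurable_fst)).mul
        ((hχm i).comp (measurable_snd.comp measurable_fst))).aestronglyMeasurable
        (ae_of_all _ fun w => ?_)
      have hK' := hχK i w.1.2
      by_cases hw : w.1.1 ∈ A i
      · simpa [hw] using hK'
      · simpa [hw] using (abs_nonneg _).trans hK'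
    refine ⟨hi, ?_⟩
    have h1 : Integrable (fun w => Φ w.1 * ∏ j, G j (w.2 j)) (jointLaw D T κ (l + 1)) :=
      hGi.bdd_mul (c := K) (hΦ.measurable.comp measurable_fst).aestronglyMeasurable
        (ae_of_all _ fun w => hK _)
    have h2 : Integrable (fun w => Ψ w.1 * ∏ j, G j (w.2 j)) (jointLaw D T κ (l + 1)) := by
      simp only [Ψ, Finset.sum_mul]
      exact integrable_finsetSum _ fun i _ => hi i
    rw [← integral_sub h1 h2, ← Real.norm_eq_abs]
    refine le_trans (norm_integral_le_of_norm_le_const (C := θ * B ^ (l + 1)) ?_) ?_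
    · filter_upwards [ae_jointLaw_mem hD κ (l + 1)] with w hw
      rw [← sub_mul, norm_mul]
      exact mul_le_mul (hΨ _ hw) (abs_prod_le_pow G hGB _) (norm_nonneg _) hθ0.le
    · rw [measureReal_def, jointLaw_univ hκ]
      exact hθ
  refine ⟨fun n => ∫ w, Ψ w.1 * ∏ j, G j (w.2 j) ∂(jointLaw D T (νn n) (l + 1)),
    ∫ w, Ψ w.1 * ∏ j, G j (w.2 j) ∂(jointLaw D T ν (l + 1)), ?_,
    Eventually.of_forall fun n => (herr _ (hνn n)).2, (herr _ hν).2⟩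
  have hsum : ∀ κ : TimeCorrFamily d N, (∀ k, IsMarkovKernel (κ k)) →
      ∫ w, Ψ w.1 * ∏ j, G j (w.2 j) ∂(jointLaw D T κ (l + 1)) =
        ∑ i ∈ Finset.range J, ∫ w, (A i).indicator 1 w.1.1 * χ i w.1.2 * ∏ j, G j (w.2 j)
          ∂(jointLaw D T κ (l + 1)) := by
    intro κ hκ
    simp only [Ψ, Finset.sum_mul]
    exact integral_finsetSum _ fun i _ => (herr κ hκ).1 i
  simp only [hsum _ hν, hsum _ (hνn _)]
  exact tendsto_finsetSum _ fun i _ => hobs.tendsto_integral_prod hDf hνn hν (hA i) (hχm i)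
    (hχK i) hB hL G hG hGB hGL

/-- The error made by replacing the factors of a product observable. -/
lemma TimeDualBdd.enorm_integral_sub_le (hp : p ≠ ∞) (hDf : volume D ≠ ∞) (hP : 0 ≤ P)
    (h : TimeDualBdd T P c μ ν) {k : ℕ} {Φ : ℝ × (Fin k → Vec d) → ℝ} (hΦ : Measurable Φ)
    {K : ℝ} (hK : ∀ z, |Φ z| ≤ K) (H G : Fin k → Vec N → ℝ) (hH : ∀ j, Measurable (H j))
    (hG : ∀ j, Measurable (G j)) {C : ℝ} (hHC : ∀ j ξ, |H j ξ| ≤ C * (1 + ‖ξ‖ ^ P))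
    (hGC : ∀ j ξ, |G j ξ| ≤ C * (1 + ‖ξ‖ ^ P)) :
    ‖∫ w, Φ w.1 * ∏ j, H j (w.2 j) ∂(jointLaw D T ν k) -
      ∫ w, Φ w.1 * ∏ j, G j (w.2 j) ∂(jointLaw D T ν k)‖ₑ ≤
      ENNReal.ofReal K * ∑ l, (ENNReal.ofReal C * (volume D + c)) ^ (k - 1) *
        ∫⁻ w, ‖H l (w.2 0) - G l (w.2 0)‖ₑ ∂(jointLaw D T ν 1) := by
  have hΦm : AEStronglyMeasurable (fun w : (ℝ × (Fin k → Vec d)) × (Fin k → Vec N) => Φ w.1)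
      (jointLaw D T ν k) := (hΦ.comp measurable_fst).aestronglyMeasurable
  rw [← integral_sub
    ((h.integrable_prod hp hDf hP H hH hHC).bdd_mul (c := K) hΦm (ae_of_all _ fun w => hK _))
    ((h.integrable_prod hp hDf hP G hG hGC).bdd_mul (c := K) hΦm (ae_of_all _ fun w => hK _))]
  refine (enorm_integral_le_lintegral_enorm _).trans ?_
  -- In the l-th telescoping term slot l carries the difference of the factors and every other slot
  -- the common growth majorant.
  let b : Fin k → Fin k → Vec N → ℝ≥0∞ := fun l j ξ =>
    if j = l then ‖H l ξ - G l ξ‖ₑ else ENNReal.ofReal C * (1 + ‖ξ‖ₑ ^ P)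
  have hb : ∀ l j, Measurable (b l j) := by
    intro l j
    by_cases hj : j = l
    · simp only [b, if_pos hj]; exact ((hH l).sub (hG l)).enorm
    · simp only [b, if_neg hj]; fun_prop
  calc ∫⁻ w, ‖Φ w.1 * ∏ j, H j (w.2 j) - Φ w.1 * ∏ j, G j (w.2 j)‖ₑ ∂(jointLaw D T ν k)
      ≤ ∫⁻ w, ENNReal.ofReal K * ∑ l, ∏ j, b l j (w.2 j) ∂(jointLaw D T ν k) := by
        refine lintegral_mono fun w => ?_
        rw [← mul_sub, enorm_mul]
        refine mul_le_mul' ?_ ?_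
        · rw [Real.enorm_eq_ofReal_abs]; exact ENNReal.ofReal_le_ofReal (hK _)
        · rw [Real.enorm_eq_ofReal_abs]
          refine (ENNReal.ofReal_le_ofReal (abs_prod_sub_prod_le (fun j => H j (w.2 j))
            (fun j => G j (w.2 j)) (fun j => C * (1 + ‖w.2 j‖ ^ P)) (fun j => hHC _ _)
            (fun j => hGC _ _))).trans ?_
          have h0 : ∀ j, 0 ≤ C * (1 + ‖w.2 j‖ ^ P) := fun j => (abs_nonneg _).trans (hHC j (w.2 j))
          have h1 : ∀ l j : Fin k, 0 ≤ (if j = l then |H l (w.2 l) - G l (w.2 l)| else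
              C * (1 + ‖w.2 j‖ ^ P)) := fun l j => by
            split_ifs
            · exact abs_nonneg _
            · exact h0 j
          rw [ENNReal.ofReal_sum_of_nonneg fun l _ => Finset.prod_nonneg fun j _ => h1 l j]
          refine Finset.sum_le_sum fun l _ => ?_
          rw [ENNReal.ofReal_prod_of_nonneg fun j _ => h1 l j]
          refine Finset.prod_le_prod' fun j _ => ?_
          simp only [b]
          split_ifs with hj
          · rw [Real.enorm_eq_ofReal_abs, hj]
          · rw [ENNReal.ofReal_mul' (by positivity), ENNReal.ofReal_add zero_le_one (by positivity),
              enorm_rpow_eq_ofReal hP, ENNReal.ofReal_one]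
    _ = ENNReal.ofReal K * ∑ l, ∫⁻ w, ∏ j, b l j (w.2 j) ∂(jointLaw D T ν k) := by
        rw [lintegral_const_mul' _ _ (by simp), lintegral_finsetSum]
        intro l _
        exact Finset.measurable_fun_prod _ fun j _ => (hb l j).comp (by fun_prop)
    _ ≤ _ := by
        gcongr with l _
        refine (h.lintegral_prod_le hp hDf (b l) (hb l) l (C := ENNReal.ofReal C)
          fun j hj ξ => ?_).trans ?_
        · simp only [b, if_neg hj]; exact le_rfl
        · simp only [b, if_true]; exact le_rfl

/-- The factors are replaced by bounded admissible ones. The replacement error in one slot has a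
part of size at most δ, integrated over a set of measure V, and a part in the tail of size 4C'δ;
both are uniform in n once n is large. The remaining observables converge by
`tendsto_integral_mul_prod_of_bounded`. -/
theorem tendsto_integral_mul_prod (hp : p ≠ ∞) (hD : MeasurableSet D) (hDf : volume D ≠ ∞)
    (hT : 0 < T) (hP : 1 ≤ P)
    (hn : ∀ n, TimeDualBdd T P c (μn n) (νn n)) (h : TimeDualBdd T P c μ ν)
    (hobs : ObservablesConverge D T P νn ν) {k : ℕ} {Φ : ℝ × (Fin k → Vec d) → ℝ}
    (hΦ : Continuous Φ) (hΦc : HasCompactSupport Φ) {C : ℝ} (hC : 0 ≤ C)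
    (H : Fin k → Vec N → ℝ) (hH : ∀ j, IsMomentFn P C (H j)) :
    Tendsto (fun n => ∫ w, Φ w.1 * ∏ j, H j (w.2 j) ∂(jointLaw D T (νn n) k)) atTop
      (𝓝 (∫ w, Φ w.1 * ∏ j, H j (w.2 j) ∂(jointLaw D T ν k))) := by
  have hP0 : 0 ≤ P := by linarith
  obtain ⟨K, hK⟩ := hΦc.exists_bound_of_continuous hΦ
  cases k with
  -- Strong convergence speaks of k ≥ 1 only. For k = 0 the product is empty and the integral does
  -- not depend on the correlation measure.
  | zero =>
    have h0 : ∀ κ : TimeCorrFamily d N, (∀ k, IsMarkovKernel (κ k)) →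
        ∫ w, Φ w.1 * ∏ j, H j (w.2 j) ∂(jointLaw D T κ 0) =
          ∫ z in Ico 0 T ×ˢ domPow D 0, Φ z := by
      intro κ hκ
      have := hκ 0
      simp only [Finset.univ_eq_empty, Finset.prod_empty, mul_one]
      have e : (jointLaw D T κ 0).map Prod.fst = volume.restrict (Ico 0 T ×ˢ domPow D 0) :=
        Measure.fst_compProd _ _
      rw [← e, integral_map measurable_fst.aemeasurable hΦ.measurable.aestronglyMeasurable]
    simp only [h0 _ (hn _).markov, h0 _ h.markov]
    exact tendsto_const_nhds
  | succ l =>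
    refine tendsto_of_forall_approx fun η hη => ?_
    set C' := C * 2 ^ P with hC'
    have hC'0 : 0 ≤ C' := by positivity
    have h2P : (1 : ℝ) ≤ 2 ^ P := Real.one_le_rpow (by norm_num) hP0
    have hHC : ∀ j ξ, |H j ξ| ≤ C' * (1 + ‖ξ‖ ^ P) := fun j ξ =>
      ((hH j).growth ξ).trans (mul_le_mul_of_nonneg_right (by rw [hC']; nlinarith) (by positivity))
    -- the constant in the error estimate
    set M : ℝ := K * ((l + 1) * (C' * ((volume D).toReal + c)) ^ l) with hM
    have hK0 : 0 ≤ K := (norm_nonneg _).trans (hK 0)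
    have hM0 : 0 ≤ M := by positivity
    set V : ℝ := (volume (Ico 0 T ×ˢ domPow D 1)).toReal with hV
    obtain ⟨δ, hδ0, hδ⟩ : ∃ δ : ℝ, 0 < δ ∧ M * (δ * V + 4 * C' * δ) ≤ η := by
      have hV0 : 0 ≤ V := ENNReal.toReal_nonneg
      refine ⟨η / (M * (V + 4 * C') + 1), by positivity, ?_⟩
      rw [show M * (η / (M * (V + 4 * C') + 1) * V + 4 * C' * (η / (M * (V + 4 * C') + 1))) =
        η * (M * (V + 4 * C')) / (M * (V + 4 * C') + 1) by ring, div_le_iff₀ (by positivity)]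
      nlinarith
    obtain ⟨R, hR1, hRn, hR⟩ := exists_tail_le hp hDf hP hn h hobs hδ0
    choose G B L hB hL hGc hGB hGL hGC hHG using fun j =>
      (hH j).exists_approx hP hC hR1 hδ0
    have herr : ∀ {μ' : ℝ → Measure (LpSpace d N p D)} {κ : TimeCorrFamily d N},
        TimeDualBdd T P c μ' κ →
        ∫⁻ w, tail P R (w.2 0) ∂(jointLaw D T κ 1) ≤ ENNReal.ofReal δ →
        |∫ w, Φ w.1 * ∏ j, H j (w.2 j) ∂(jointLaw D T κ (l + 1)) -
          ∫ w, Φ w.1 * ∏ j, G j (w.2 j) ∂(jointLaw D T κ (l + 1))| ≤ η := by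
      intro μ' κ hκ hκR
      have h1 := hκ.enorm_integral_sub_le hp hDf hP0 hΦ.measurable hK H G
        (fun j => (hH j).continuous.measurable) (fun j => (hGc j).measurable) hHC hGC
      have h2 : ∀ j, ∫⁻ w, ‖H j (w.2 0) - G j (w.2 0)‖ₑ ∂(jointLaw D T κ 1) ≤
          ENNReal.ofReal (δ * V + 4 * C' * δ) := by
        intro j
        have := isFiniteMeasure_jointLaw (T := T) hDf hκ.markov 1
        calc _ ≤ ∫⁻ w, (ENNReal.ofReal δ + ENNReal.ofReal (4 * C') * tail P R (w.2 0))
              ∂(jointLaw D T κ 1) := lintegral_mono fun w => hHG j _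
          _ = ENNReal.ofReal δ * jointLaw D T κ 1 univ +
              ENNReal.ofReal (4 * C') * ∫⁻ w, tail P R (w.2 0) ∂(jointLaw D T κ 1) := by
              rw [lintegral_add_left measurable_const, lintegral_const,
                lintegral_const_mul' _ _ ENNReal.ofReal_ne_top]
          _ ≤ ENNReal.ofReal δ * ENNReal.ofReal V + ENNReal.ofReal (4 * C') * ENNReal.ofReal δ := by
              gcongr
              rw [hV, ENNReal.ofReal_toReal]
              · rw [jointLaw_univ hκ.markov]
              · rw [← jointLaw_univ hκ.markov]; exact measure_ne_top _ _
          _ = _ := by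
              rw [← ENNReal.ofReal_mul hδ0.le, ← ENNReal.ofReal_mul (by positivity),
                ← ENNReal.ofReal_add (by positivity) (by positivity)]
      have h3 : ENNReal.ofReal K * ∑ j : Fin (l + 1),
          (ENNReal.ofReal C' * (volume D + c)) ^ (l + 1 - 1) *
          ∫⁻ w, ‖H j (w.2 0) - G j (w.2 0)‖ₑ ∂(jointLaw D T κ 1) ≤ ENNReal.ofReal η := by
        calc _ ≤ ENNReal.ofReal K * ∑ _j : Fin (l + 1),
              (ENNReal.ofReal C' * (volume D + c)) ^ (l + 1 - 1) *
              ENNReal.ofReal (δ * V + 4 * C' * δ) := by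
              gcongr with j _; exact h2 j
          _ = ENNReal.ofReal (M * (δ * V + 4 * C' * δ)) := by
              rw [Finset.sum_const, Finset.card_univ, Fintype.card_fin, nsmul_eq_mul,
                Nat.add_sub_cancel]
              have e1 : volume D + c = ENNReal.ofReal ((volume D).toReal + c) := by
                rw [ENNReal.ofReal_add ENNReal.toReal_nonneg c.coe_nonneg, ENNReal.ofReal_toReal hDf,
                  ENNReal.ofReal_coe_nnreal]
              have e2 : ((l + 1 : ℕ) : ℝ≥0∞) = ENNReal.ofReal (l + 1) := by
                rw [← ENNReal.ofReal_natCast]; push_cast; rfl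
              rw [e1, e2, ← ENNReal.ofReal_mul hC'0, ← ENNReal.ofReal_pow (by positivity),
                ← ENNReal.ofReal_mul (by positivity), ← ENNReal.ofReal_mul (by positivity),
                ← ENNReal.ofReal_mul hK0]
              congr 1; rw [hM]; ring
          _ ≤ _ := ENNReal.ofReal_le_ofReal hδ
      have h4 := h1.trans h3
      rw [Real.enorm_eq_ofReal_abs] at h4
      exact (ENNReal.ofReal_le_ofReal_iff hη.le).1 h4
    refine ⟨_, _, ?_, hRn.mono fun n hn' => herr (hn n) hn', herr h hR⟩
    have hBs : ∀ j, B j ≤ ∑ i, B i := fun j =>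
      Finset.single_le_sum (fun i _ => hB i) (Finset.mem_univ j)
    have hLs : ∀ j, L j ≤ ∑ i, L i := fun j =>
      Finset.single_le_sum (fun i _ => hL i) (Finset.mem_univ j)
    exact tendsto_integral_mul_prod_of_bounded hD hDf hT hobs (fun n => (hn n).markov) h.markov
      hΦ hΦc (Finset.sum_nonneg fun i _ => hB i) (Finset.sum_nonneg fun i _ => hL i) G hGc
      (fun j ξ => (hGB j ξ).trans (hBs j))
      (fun j ζ ξ => (hGL j ζ ξ).trans (mul_le_mul_of_nonneg_right (hLs j) (by positivity)))

end Convergence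

/-! ### Geometry of the mesh -/

/-- The index of the (half-open) cell that contains `x`. -/
def cellIdx {d : ℕ} (a : Vec d) (Δ : ℝ) (x : Vec d) : Fin d → ℤ := fun m => ⌊(x m - a m) / Δ⌋

section Geometry

variable {d : ℕ} {a : Vec d} {Δ : ℝ}

lemma measurable_cellIdx (a : Vec d) (Δ : ℝ) : Measurable (cellIdx a Δ) := by
  refine measurable_pi_lambda _ fun m => Int.measurable_floor.comp ?_
  fun_prop

lemma cellIdx_add_single (hΔ : 0 < Δ) (x : Vec d) (m : Fin d) (j : ℤ) :
    cellIdx a Δ (x + EuclideanSpace.single m (j * Δ)) = cellIdx a Δ x + Pi.single m j := by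
  funext m'
  by_cases h : m' = m
  · subst h
    simp only [cellIdx, PiLp.add_apply, EuclideanSpace.single_apply, if_true, Pi.add_apply,
      Pi.single_eq_same]
    rw [show (x m' + j * Δ - a m') / Δ = (x m' - a m') / Δ + j by field_simp; ring,
      Int.floor_add_intCast]
  · simp [cellIdx, EuclideanSpace.single_apply, h]

lemma cellIdx_eq_of_mem_cell (hΔ : 0 < Δ) {x : Vec d} {i : Fin d → ℤ} (h : x ∈ cell a Δ i) :
    cellIdx a Δ x = i := by
  funext m
  obtain ⟨h1, h2⟩ := h m
  rw [cellIdx, Int.floor_eq_iff, le_div_iff₀ hΔ, div_lt_iff₀ hΔ]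
  constructor <;> nlinarith

lemma ae_mem_cell (hΔ : 0 < Δ) (a : Vec d) : ∀ᵐ x : Vec d, x ∈ cell a Δ (cellIdx a Δ x) := by
  have h1 : ∀ᵐ x : Vec d, ∀ (m : Fin d) (z : ℤ), x m ≠ a m + Δ * z := by
    rw [ae_all_iff]; intro m
    rw [ae_all_iff]; intro z
    have := Measure.ae_eval_ne (μ := fun _ : Fin d => (volume : Measure ℝ)) m (a m + Δ * z)
    rw [← volume_pi] at this
    exact (PiLp.volume_preserving_ofLp (Fin d)).quasiMeasurePreserving.ae this
  filter_upwards [h1] with x hx m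
  have h2 := Int.floor_le ((x m - a m) / Δ)
  have h3 := Int.lt_floor_add_one ((x m - a m) / Δ)
  rw [le_div_iff₀ hΔ] at h2
  rw [div_lt_iff₀ hΔ] at h3
  have h4 := hx m ⌊(x m - a m) / Δ⌋
  simp only [cellIdx]
  constructor
  · refine lt_of_le_of_ne (by linarith) h4.symm
  · linarith

lemma volume_cell (a : Vec d) (Δ : ℝ) (i : Fin d → ℤ) :
    volume (cell a Δ i) = ENNReal.ofReal Δ ^ d := by
  have e : cell a Δ i = (WithLp.ofLp : Vec d → Fin d → ℝ) ⁻¹'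
      (univ.pi fun m => Ioo (a m + Δ * i m) (a m + Δ * (i m + 1))) := by
    ext x; simp [cell]
  rw [e, (PiLp.volume_preserving_ofLp (Fin d)).measure_preimage
    (MeasurableSet.univ_pi fun m => measurableSet_Ioo).nullMeasurableSet, Real.volume_pi_Ioo]
  rw [Finset.prod_congr rfl (g := fun _ => ENNReal.ofReal Δ) fun m _ => by congr 1; ring]
  simp

lemma measurableSet_cell (a : Vec d) (Δ : ℝ) (i : Fin d → ℤ) : MeasurableSet (cell a Δ i) := by
  have e : cell a Δ i = (WithLp.ofLp : Vec d → Fin d → ℝ) ⁻¹'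
      (univ.pi fun m => Ioo (a m + Δ * i m) (a m + Δ * (i m + 1))) := by
    ext x; simp [cell]
  rw [e]
  exact (PiLp.volume_preserving_ofLp (Fin d)).measurable
    (MeasurableSet.univ_pi fun m => measurableSet_Ioo)

lemma volume_cell_pos (hΔ : 0 < Δ) (a : Vec d) (i : Fin d → ℤ) : volume (cell a Δ i) ≠ 0 := by
  rw [volume_cell]; exact pow_ne_zero _ (by simpa using hΔ)

lemma volume_cell_ne_top (a : Vec d) (Δ : ℝ) (i : Fin d → ℤ) : volume (cell a Δ i) ≠ ∞ := by
  rw [volume_cell]; finiteness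

lemma volume_cellIdx_fiber (hΔ : 0 < Δ) (a : Vec d) (i : Fin d → ℤ) :
    volume (cellIdx a Δ ⁻¹' {i}) = ENNReal.ofReal Δ ^ d := by
  rw [← volume_cell a Δ i]
  refine measure_congr ?_
  filter_upwards [ae_mem_cell hΔ a] with x hx
  refine propext ⟨fun h => ?_, fun h => cellIdx_eq_of_mem_cell hΔ h⟩
  have h' : cellIdx a Δ x = i := h
  rwa [h'] at hx

lemma norm_sub_le_of_mem_cell (hΔ : 0 < Δ) {x y : Vec d} (hy : y ∈ cell a Δ (cellIdx a Δ x)) :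
    ‖y - x‖ ≤ d * Δ := by
  have h1 : y - x = ∑ m, EuclideanSpace.single m (y m - x m) := by
    ext m
    simp [EuclideanSpace.single_apply]
  rw [h1]
  refine (norm_sum_le _ _).trans ?_
  calc _ ≤ ∑ _m : Fin d, Δ := by
        refine Finset.sum_le_sum fun m _ => ?_
        rw [EuclideanSpace.norm_single, Real.norm_eq_abs, abs_le]
        obtain ⟨h2, h3⟩ := hy m
        have h4 := Int.floor_le ((x m - a m) / Δ)
        have h5 := Int.lt_floor_add_one ((x m - a m) / Δ)
        rw [le_div_iff₀ hΔ] at h4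
        rw [div_lt_iff₀ hΔ] at h5
        simp only [cellIdx] at h2 h3
        constructor <;> nlinarith
    _ = _ := by simp

/-- A shift by at most r cells together with the diameter of a cell, crudely at most dΔ, moves a
point by at most (d + r)Δ ≤ δ/2, so the whole shifted cell remains in the δ-neighbourhood of K. -/
lemma mem_mesh_of_mem_cthickening {D K : Set (Vec d)} {δ : ℝ} (hδ : 0 ≤ δ)
    (hK : Metric.cthickening δ K ⊆ D) (hΔ : 0 < Δ) {r : ℕ} (hr : (d + r) * Δ ≤ δ / 2) {x : Vec d}
    (hx : x ∈ Metric.cthickening (δ / 2) K) (m : Fin d) {j : ℤ} (hj : |j| ≤ r) :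
    cellIdx a Δ x + Pi.single m j ∈ mesh D a Δ := by
  intro y hy
  rw [← cellIdx_add_single hΔ] at hy
  have h1 := norm_sub_le_of_mem_cell hΔ hy
  have h2 : ‖y - x‖ ≤ δ / 2 := by
    have e : y - x = (y - (x + EuclideanSpace.single m (j * Δ))) +
      EuclideanSpace.single m (j * Δ) := by abel
    rw [e]
    refine (norm_add_le _ _).trans ?_
    rw [EuclideanSpace.norm_single, Real.norm_eq_abs, abs_mul, abs_of_pos hΔ]
    have h3 : |(j : ℝ)| ≤ r := by exact_mod_cast hj
    nlinarith
  apply hK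
  have h3 := Metric.cthickening_cthickening_subset (half_pos_nonneg hδ) (half_pos_nonneg hδ) K
  rw [add_halves] at h3
  exact h3 (Metric.mem_cthickening_of_dist_le y x _ _ hx (by rwa [dist_eq_norm]))
where half_pos_nonneg {δ : ℝ} (h : 0 ≤ δ) : 0 ≤ δ / 2 := by positivity

end Geometry

/-! ### The numerical solution as a field on space -/

/-- Truncation of times to `[0, T']`. -/
def clip (T' t : ℝ) : ℝ := max 0 (min t T')

lemma clip_of_mem {T' t : ℝ} (ht : t ∈ Icc 0 T') : clip T' t = t := by
  rw [clip, min_eq_left ht.2, max_eq_right ht.1]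

lemma clip_mem {T' t : ℝ} (h : 0 ≤ T') : clip T' t ∈ Icc 0 T' :=
  ⟨le_max_left _ _, max_le h (min_le_right _ _)⟩

lemma continuous_clip (T' : ℝ) : Continuous (clip T') := by unfold clip; fun_prop

section Scheme

variable {d N : ℕ} {p : ℝ≥0∞} [Fact (1 ≤ p)] {D : Set (Vec d)}

open Classical in
/-- The values of the numerical solution in the cells of the mesh (zero in other cells). -/
def cellVal (a : Vec d) (Δ : ℝ) (S : ℝ → LpSpace d N p D → LpSpace d N p D) (T' t : ℝ)
    (u : LpSpace d N p D) (i : Fin d → ℤ) : Vec N :=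
  if i ∈ mesh D a Δ then cellAvg a Δ (S (clip T' t) u) i else 0

/-- The numerical solution as a piecewise constant function on `ℝ^d`. -/
def field (a : Vec d) (Δ : ℝ) (S : ℝ → LpSpace d N p D → LpSpace d N p D) (T' t : ℝ)
    (u : LpSpace d N p D) (x : Vec d) : Vec N :=
  cellVal a Δ S T' t u (cellIdx a Δ x)

lemma measurable_cellAvg (hp : p ≠ ∞) {a : Vec d} {Δ : ℝ} {i : Fin d → ℤ}
    (hi : i ∈ mesh D a Δ) : Measurable fun u : LpSpace d N p D => cellAvg a Δ u i := by
  obtain ⟨e, he, heu⟩ := exists_measurable_eval (N := N) hp D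
  have h1 : ∀ u : LpSpace d N p D, cellAvg a Δ u i =
      (volume.real (cell a Δ i))⁻¹ • ∫ x in cell a Δ i, e (u, x) := by
    intro u
    rw [cellAvg, setAverage_eq]
    congr 1
    refine integral_congr_ae ?_
    filter_upwards [ae_restrict_of_ae_restrict_of_subset hi (heu u)] with x hx
    rw [hx]
  simp only [h1]
  have h2 : Measurable fun u : LpSpace d N p D => ∫ x in cell a Δ i, e (u, x) :=
    (he.stronglyMeasurable.integral_prod_right'
      (ν := volume.restrict (cell a Δ i))).measurable
  exact h2.const_smul (volume.real (cell a Δ i))⁻¹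

variable {T : ℝ} {a : Vec d} {Δ : ℝ} {q : ℕ} {F : Fin d → (Fin (2 * q) → Vec N) → Vec N}
  {S : ℝ → LpSpace d N p D → LpSpace d N p D}

lemma cellAvg_eq_of_ae (hΔ : 0 < Δ) {u : Vec d → Vec N} {i : Fin d → ℤ} {v : Vec N}
    (h : ∀ᵐ x ∂volume.restrict (cell a Δ i), u x = v) : cellAvg a Δ u i = v := by
  rw [cellAvg, setAverage_congr_fun (measurableSet_cell a Δ i) (g := fun _ => v)
    ((ae_restrict_iff' (measurableSet_cell a Δ i)).1 h)]
  exact setAverage_const (volume_cell_pos hΔ a i) (volume_cell_ne_top a Δ i) v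

/-- The scheme, formulated for the cell averages. -/
lemma IsNumericalEvolution.cellAvg_scheme (hΔ : 0 < Δ) (h : IsNumericalEvolution T a Δ q F S)
    (u : LpSpace d N p D) :
    (∀ t ∈ Ico 0 T, ∀ i ∈ mesh D a Δ, ∀ᵐ x ∂volume.restrict (cell a Δ i),
      S t u x = cellAvg a Δ (S t u) i) ∧
    (0 < T → ∀ i ∈ mesh D a Δ, cellAvg a Δ (S 0 u) i = cellAvg a Δ u i) ∧
    (∀ i ∈ mesh D a Δ, ContinuousOn (fun t => cellAvg a Δ (S t u) i) (Ico 0 T)) ∧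
    ∀ t ∈ Ico 0 T, ∀ i ∈ mesh D a Δ,
      (∀ (m : Fin d) (j : ℤ), |j| ≤ q → i + Pi.single m j ∈ mesh D a Δ) →
      ∀ w : (Fin d → ℤ) → Vec N, (∀ i' ∈ mesh D a Δ, w i' = cellAvg a Δ (S t u) i') →
      HasDerivWithinAt (fun τ => cellAvg a Δ (S τ u) i)
        (-∑ m, Δ⁻¹ • (F m (stencil q w m i) - F m (stencil q w m (i - Pi.single m 1))))
        (Ico 0 T) t := by
  obtain ⟨v, hv1, hv2, hv3⟩ := h.scheme u
  have hv : ∀ t ∈ Ico 0 T, ∀ i ∈ mesh D a Δ, cellAvg a Δ (S t u) i = v t i := fun t ht i hi =>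
    cellAvg_eq_of_ae hΔ (hv1 t ht i hi)
  refine ⟨fun t ht i hi => ?_, fun hT i hi => ?_, fun i hi => ?_, fun t ht i hi hst w hw => ?_⟩
  · rw [hv t ht i hi]; exact hv1 t ht i hi
  · rw [hv 0 ⟨le_rfl, hT⟩ i hi, hv2 i hi]
  · have : ContinuousOn (fun t => v t i) (Ico 0 T) := fun t ht =>
      (hv3 t ht i hi).continuousWithinAt
    exact this.congr fun t ht => hv t ht i hi
  · have h1 : ∀ m, stencil q w m i = stencil q (v t) m i := by
      intro m
      funext j
      simp only [stencil]
      have hj := j.2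
      have hmem := hst m ((j : ℤ) - q + 1) (by rw [abs_le]; constructor <;> omega)
      rw [hw _ hmem, hv t ht _ hmem]
    have h2 : ∀ m, stencil q w m (i - Pi.single m 1) = stencil q (v t) m (i - Pi.single m 1) := by
      intro m
      funext j
      simp only [stencil]
      have hj := j.2
      have e : i - Pi.single m 1 + Pi.single m ((j : ℤ) - q + 1) = i + Pi.single m ((j : ℤ) - q) := by
        rw [sub_add_eq_add_sub, add_sub_assoc, ← Pi.single_sub]
        congr 2; ring
      have hmem := hst m ((j : ℤ) - q) (by rw [abs_le]; constructor <;> omega)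
      rw [e, hw _ hmem, hv t ht _ hmem]
    simp only [h1, h2]
    exact (hv3 t ht i hi).congr_of_mem (fun τ hτ => hv τ hτ i hi) ht

variable {T' : ℝ}

/-- A Carathéodory function is jointly measurable: the cell value is continuous in t for fixed u and
measurable in u for fixed t. Clipping to [0,T'] with T' < T makes it continuous on all of ℝ. -/
lemma measurable_cellVal (hp : p ≠ ∞) (hΔ : 0 < Δ) (h : IsNumericalEvolution T a Δ q F S)
    (hT'0 : 0 ≤ T') (hT' : T' < T) (i : Fin d → ℤ) :
    Measurable fun z : ℝ × LpSpace d N p D => cellVal a Δ S T' z.1 z.2 i := by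
  by_cases hi : i ∈ mesh D a Δ
  · have hmem : ∀ t, clip T' t ∈ Ico 0 T := fun t =>
      ⟨(clip_mem hT'0).1, (clip_mem hT'0).2.trans_lt hT'⟩
    simp only [cellVal, if_pos hi]
    refine measurable_uncurry_of_continuous_of_measurable
      (u := fun t u => cellAvg a Δ (S (clip T' t) u) i) (fun u => ?_) fun t => ?_
    · exact ((h.cellAvg_scheme hΔ u).2.2.1 i hi).comp_continuous (continuous_clip T') hmem
    · exact (measurable_cellAvg hp hi).comp (h.measurable _ (hmem t))
  · simp only [cellVal, if_neg hi]
    exact measurable_const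

lemma measurable_cellVal_comp (hp : p ≠ ∞) (hΔ : 0 < Δ) (h : IsNumericalEvolution T a Δ q F S)
    (hT'0 : 0 ≤ T') (hT' : T' < T) {X : Type*} [MeasurableSpace X] {I : X → Fin d → ℤ}
    (hI : Measurable I) :
    Measurable fun z : (ℝ × LpSpace d N p D) × X => cellVal a Δ S T' z.1.1 z.1.2 (I z.2) := by
  have h1 : Measurable fun z : (ℝ × LpSpace d N p D) × (Fin d → ℤ) =>
      cellVal a Δ S T' z.1.1 z.1.2 z.2 := by
    refine measurable_from_prod_countable_left fun i => ?_
    exact measurable_cellVal hp hΔ h hT'0 hT' i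
  have h2 : Measurable fun z : (ℝ × LpSpace d N p D) × X => (z.1, I z.2) :=
    measurable_fst.prodMk (hI.comp measurable_snd)
  have h3 := h1.comp h2
  simpa only [Function.comp_def] using h3

lemma measurable_field (hp : p ≠ ∞) (hΔ : 0 < Δ) (h : IsNumericalEvolution T a Δ q F S)
    (hT'0 : 0 ≤ T') (hT' : T' < T) :
    Measurable fun z : (ℝ × LpSpace d N p D) × Vec d => field a Δ S T' z.1.1 z.1.2 z.2 :=
  measurable_cellVal_comp hp hΔ h hT'0 hT' (measurable_cellIdx a Δ)

/-- On the cells of the mesh the field is the numerical solution. -/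
lemma ae_field_eq (hΔ : 0 < Δ) (h : IsNumericalEvolution T a Δ q F S) (hT' : T' < T) {t : ℝ}
    (ht : t ∈ Icc 0 T') (u : LpSpace d N p D) :
    ∀ᵐ x, cellIdx a Δ x ∈ mesh D a Δ → x ∈ D ∧ field a Δ S T' t u x = S t u x := by
  have h1 : ∀ᵐ x, ∀ i : Fin d → ℤ, i ∈ mesh D a Δ → x ∈ cell a Δ i →
      S t u x = cellAvg a Δ (S t u) i := by
    rw [ae_all_iff]
    intro i
    by_cases hi : i ∈ mesh D a Δ
    · have := (h.cellAvg_scheme hΔ u).1 t ⟨ht.1, ht.2.trans_lt hT'⟩ i hi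
      rw [ae_restrict_iff' (measurableSet_cell a Δ i)] at this
      filter_upwards [this] with x hx _ using hx
    · exact ae_of_all _ fun x hi' => absurd hi' hi
  filter_upwards [h1, ae_mem_cell hΔ a] with x hx hc hi
  refine ⟨hi hc, ?_⟩
  rw [field, cellVal, if_pos hi, clip_of_mem ht, hx _ hi hc]

lemma field_eq_zero {t : ℝ} {u : LpSpace d N p D} {x : Vec d} (hx : cellIdx a Δ x ∉ mesh D a Δ) :
    field a Δ S T' t u x = 0 := by
  rw [field, cellVal, if_neg hx]

/-- Integrals of the field are controlled by those of the numerical solution. -/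
lemma lintegral_field_le (hDm : MeasurableSet D) (hΔ : 0 < Δ) (h : IsNumericalEvolution T a Δ q F S)
    (hT' : T' < T) {t : ℝ} (ht : t ∈ Icc 0 T') (u : LpSpace d N p D) {b : Vec N → ℝ≥0∞}
    (hb : b 0 = 0) :
    ∫⁻ x, b (field a Δ S T' t u x) ≤ ∫⁻ x in D, b (S t u x) := by
  rw [← lintegral_indicator hDm]
  refine lintegral_mono_ae ?_
  filter_upwards [ae_field_eq hΔ h hT' ht u] with x hx
  by_cases hi : cellIdx a Δ x ∈ mesh D a Δ
  · obtain ⟨h1, h2⟩ := hx hi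
    rw [h2, indicator_of_mem h1]
  · rw [field_eq_zero hi, hb]; exact zero_le

end Scheme

/-! ### Integrals of products of fields -/

section ProductBounds

variable {Z X : Type*} [MeasurableSpace Z] [MeasurableSpace X] {k : ℕ}

/-- The support of the test function confines every variable to D; then Tonelli's theorem applies to
the product over the full space. -/
lemma lintegral_enorm_prod_mul_le (Q : Measure Z) [SFinite Q] (m : Measure X) [SigmaFinite m]
    {D : Set X} (hD : MeasurableSet D) (b : Fin k → Z × X → ℝ) (hb : ∀ j, Measurable (b j))
    {Φ : Z × (Fin k → X) → ℝ} {K : ℝ} (hK : ∀ w, |Φ w| ≤ K)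
    (hΦ : ∀ w, Φ w ≠ 0 → ∀ j, w.2 j ∈ D) :
    ∫⁻ w, ‖(∏ j, b j (w.1, w.2 j)) * Φ w‖ₑ ∂(Q.prod (Measure.pi fun _ => m)) ≤
      ENNReal.ofReal K * ∫⁻ z, ∏ j, ∫⁻ y in D, ‖b j (z, y)‖ₑ ∂m ∂Q := by
  let b' : Fin k → Z × X → ℝ≥0∞ := fun j => (Prod.snd ⁻¹' D).indicator fun v => ‖b j v‖ₑ
  have hb' : ∀ j, Measurable (b' j) := fun j => (hb j).enorm.indicator (measurable_snd hD)
  have hm : Measurable fun w : Z × (Fin k → X) => ∏ j, b' j (w.1, w.2 j) := by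
    refine Finset.measurable_fun_prod _ fun j _ => (hb' j).comp ?_
    fun_prop
  calc _ ≤ ∫⁻ w, ENNReal.ofReal K * ∏ j, b' j (w.1, w.2 j)
        ∂(Q.prod (Measure.pi fun _ => m)) := by
        refine lintegral_mono fun w => ?_
        by_cases hw : Φ w = 0
        · simp [hw]
        · rw [enorm_mul, enorm_prod_real, mul_comm]
          refine mul_le_mul' ?_ (Finset.prod_le_prod' fun j _ => ?_)
          · rw [Real.enorm_eq_ofReal_abs]; exact ENNReal.ofReal_le_ofReal (hK _)
          · simp only [b']
            rw [indicator_of_mem (show (w.1, w.2 j) ∈ Prod.snd ⁻¹' D from hΦ w hw j)]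
    _ = _ := by
        rw [lintegral_const_mul' _ _ ENNReal.ofReal_ne_top, lintegral_prod _ hm.aemeasurable]
        congr 1
        refine lintegral_congr fun z => ?_
        rw [lintegral_pi_prod m (fun j x => b' j (z, x))
          fun j => (hb' j).comp measurable_prodMk_left]
        refine Finset.prod_congr rfl fun j _ => ?_
        rw [← lintegral_indicator hD]
        rfl

/-- The counterpart for fields of `DualBdd.lintegral_prod_le`: deterministic bounds for all slots
but the l-th leave a one-point integral. -/
lemma lintegral_enorm_prod_mul_le_single (Q : Measure Z) [SFinite Q] (m : Measure X)
    [SigmaFinite m] {D : Set X} (hD : MeasurableSet D) (b : Fin k → Z × X → ℝ)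
    (hb : ∀ j, Measurable (b j)) {Φ : Z × (Fin k → X) → ℝ} {K : ℝ} (hK : ∀ w, |Φ w| ≤ K)
    (hΦ : ∀ w, Φ w ≠ 0 → ∀ j, w.2 j ∈ D) (l : Fin k) {C : ℝ≥0∞}
    (hC : ∀ᵐ z ∂Q, ∀ j, j ≠ l → ∫⁻ y in D, ‖b j (z, y)‖ₑ ∂m ≤ C) :
    ∫⁻ w, ‖(∏ j, b j (w.1, w.2 j)) * Φ w‖ₑ ∂(Q.prod (Measure.pi fun _ => m)) ≤
      ENNReal.ofReal K * (C ^ (k - 1) * ∫⁻ z, ∫⁻ y in D, ‖b l (z, y)‖ₑ ∂m ∂Q) := by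
  refine (lintegral_enorm_prod_mul_le Q m hD b hb hK hΦ).trans ?_
  gcongr
  rw [← lintegral_const_mul _ (hb l).enorm.lintegral_prod_right']
  refine lintegral_mono_ae ?_
  filter_upwards [hC] with z hz
  rw [← Finset.mul_prod_erase Finset.univ _ (Finset.mem_univ l), mul_comm]
  gcongr
  calc _ ≤ ∏ _j ∈ Finset.univ.erase l, C :=
        Finset.prod_le_prod' fun j hj => hz j (Finset.ne_of_mem_erase hj)
    _ = _ := by simp [Finset.card_erase_of_mem]

lemma integrable_prod_mul (Q : Measure Z) [IsFiniteMeasure Q] (m : Measure X) [SigmaFinite m]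
    {D : Set X} (hD : MeasurableSet D) (b : Fin k → Z × X → ℝ) (hb : ∀ j, Measurable (b j))
    {Φ : Z × (Fin k → X) → ℝ} (hΦm : Measurable Φ) {K : ℝ} (hK : ∀ w, |Φ w| ≤ K)
    (hΦ : ∀ w, Φ w ≠ 0 → ∀ j, w.2 j ∈ D) {C : ℝ≥0∞} (hCt : C ≠ ∞)
    (hC : ∀ j, ∀ᵐ z ∂Q, ∫⁻ y in D, ‖b j (z, y)‖ₑ ∂m ≤ C) :
    Integrable (fun w => (∏ j, b j (w.1, w.2 j)) * Φ w) (Q.prod (Measure.pi fun _ => m)) := by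
  refine ⟨((Finset.measurable_fun_prod _ fun j _ => (hb j).comp (by fun_prop)).mul
    hΦm).aestronglyMeasurable, ?_⟩
  refine (lintegral_enorm_prod_mul_le Q m hD b hb hK hΦ).trans_lt ?_
  refine (mul_le_mul_right (b := ∫⁻ z, ∏ j, ∫⁻ y in D, ‖b j (z, y)‖ₑ ∂m ∂Q)
    (c := C ^ k * Q univ) ?_ _).trans_lt (by finiteness)
  rw [← lintegral_const]
  refine lintegral_mono_ae ?_
  filter_upwards [ae_all_iff.2 hC] with z hz
  calc _ ≤ ∏ _j : Fin k, C := Finset.prod_le_prod' fun j _ => hz j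
    _ = _ := by simp

end ProductBounds

/-! ### The weak form of the semi-discrete scheme -/

/-- Data of a piecewise constant solution of a conservative semi-discrete scheme, depending on a
parameter `ω`. -/
structure SemiDiscrete {d N : ℕ} {Ω : Type*} [MeasurableSpace Ω] (D K : Set (Vec d)) (Δ T : ℝ)
    (C : ℝ≥0∞) (Pm : Measure Ω) (V : ℝ → Ω → Vec d → Vec N)
    (W : Fin d → ℝ → Ω → Vec d → Vec N) : Prop where
  measurable_field : Measurable fun z : (ℝ × Ω) × Vec d => V z.1.1 z.1.2 z.2
  measurable_flux : ∀ m, Measurable fun z : (ℝ × Ω) × Vec d => W m z.1.1 z.1.2 z.2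
  bound_field : ∀ᵐ z ∂(volume.restrict (Icc 0 T)).prod Pm, ∫⁻ y in D, ‖V z.1 z.2 y‖ₑ ≤ C
  bound_flux : ∀ m, ∀ᵐ z ∂(volume.restrict (Icc 0 T)).prod Pm, ∫⁻ y in D, ‖W m z.1 z.2 y‖ₑ ≤ C
  bound_flux_shift : ∀ m, ∀ᵐ z ∂(volume.restrict (Icc 0 T)).prod Pm,
    ∫⁻ y in D, ‖W m z.1 z.2 (y - EuclideanSpace.single m Δ)‖ₑ ≤ C
  continuous_flux : ∀ m ω, ∀ y ∈ K, ContinuousOn (fun t => W m t ω y) (Icc 0 T)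
  continuous_flux_shift : ∀ m ω, ∀ y ∈ K,
    ContinuousOn (fun t => W m t ω (y - EuclideanSpace.single m Δ)) (Icc 0 T)
  deriv : ∀ ω, ∀ y ∈ K, ∀ t ∈ Icc 0 T, HasDerivWithinAt (fun τ => V τ ω y)
    (-∑ m, Δ⁻¹ • (W m t ω y - W m t ω (y - EuclideanSpace.single m Δ))) (Icc 0 T) t

section Weak

variable {d N k : ℕ} {Ω : Type*} [MeasurableSpace Ω] {D K : Set (Vec d)} {Δ T : ℝ}
    {C : ℝ≥0∞} {Pm : Measure Ω} [IsProbabilityMeasure Pm] {V : ℝ → Ω → Vec d → Vec N}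
    {W : Fin d → ℝ → Ω → Vec d → Vec N}

/-- The difference quotient of the fluxes. -/
def fluxDiff (Δ : ℝ) (W : Fin d → ℝ → Ω → Vec d → Vec N) (m : Fin d) (t : ℝ) (ω : Ω) (y : Vec d) :
    Vec N :=
  Δ⁻¹ • (W m t ω y - W m t ω (y - EuclideanSpace.single m Δ))

lemma enorm_apply_le (ξ : Vec N) (i : Fin N) : ‖ξ i‖ₑ ≤ ‖ξ‖ₑ := by
  rw [enorm_le_iff_norm_le]
  exact PiLp.norm_apply_le ξ i

lemma measurable_fluxDiff (h : SemiDiscrete D K Δ T C Pm V W) (m : Fin d) :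
    Measurable fun z : (ℝ × Ω) × Vec d => fluxDiff Δ W m z.1.1 z.1.2 z.2 := by
  have h2 : Measurable fun z : (ℝ × Ω) × Vec d =>
      W m z.1.1 z.1.2 (z.2 - EuclideanSpace.single m Δ) := by
    have h3 : Measurable fun z : (ℝ × Ω) × Vec d => (z.1, z.2 - EuclideanSpace.single m Δ) := by
      fun_prop
    have := (h.measurable_flux m).comp h3
    simpa only [Function.comp_def] using this
  unfold fluxDiff
  exact ((h.measurable_flux m).sub h2).const_smul Δ⁻¹

lemma measurable_coord {E : Type*} [MeasurableSpace E] {g : E → Vec N} (hg : Measurable g)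
    (i : Fin N) : Measurable fun x => g x i :=
  (measurable_pi_apply i).comp ((WithLp.measurable_ofLp 2 (Fin N → ℝ)).comp hg)

/-- The derivative in time of a product of field components. -/
lemma SemiDiscrete.hasDerivWithinAt_prod (h : SemiDiscrete D K Δ T C Pm V W)
    (I : Fin k → Fin N) (ω : Ω) {x : Fin k → Vec d} (hx : ∀ j, x j ∈ K) {t : ℝ}
    (ht : t ∈ Icc 0 T) :
    HasDerivWithinAt (fun τ => ∏ j, V τ ω (x j) (I j))
      (-∑ l, ∑ m, ∏ j, if j = l then fluxDiff Δ W m t ω (x j) (I j) else V t ω (x j) (I j))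
      (Icc 0 T) t := by
  have h1 : ∀ j, HasDerivWithinAt (fun τ => V τ ω (x j) (I j))
      (-∑ m, fluxDiff Δ W m t ω (x j) (I j)) (Icc 0 T) t := by
    intro j
    have h2 := (EuclideanSpace.proj (I j) : Vec N →L[ℝ] ℝ).hasFDerivAt.comp_hasDerivWithinAt t (h.deriv ω (x j) (hx j) t ht)
    have e : (EuclideanSpace.proj (I j) : Vec N →L[ℝ] ℝ)
        (-∑ m, Δ⁻¹ • (W m t ω (x j) - W m t ω (x j - EuclideanSpace.single m Δ))) =
        -∑ m, fluxDiff Δ W m t ω (x j) (I j) := by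
      rw [map_neg, map_sum]; rfl
    rw [e] at h2
    exact h2
  have h3 := HasDerivWithinAt.fun_finsetProd (u := Finset.univ) fun j _ => h1 j
  refine h3.congr_deriv ?_
  symm
  rw [← Finset.sum_neg_distrib]
  refine Finset.sum_congr rfl fun l _ => ?_
  rw [smul_eq_mul, mul_neg, Finset.mul_sum]
  congr 1
  refine Finset.sum_congr rfl fun m _ => ?_
  rw [← Finset.mul_prod_erase Finset.univ _ (Finset.mem_univ l), mul_comm]
  simp only [if_true]
  congr 1
  exact Finset.prod_congr rfl fun j hj => if_neg (Finset.ne_of_mem_erase hj)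

/-- The scheme tested with `φ`, integrated in time. -/
lemma SemiDiscrete.integral_time (h : SemiDiscrete D K Δ T C Pm V W) (hT : 0 ≤ T)
    (I : Fin k → Fin N) {φ : ℝ × (Fin k → Vec d) → ℝ} (hφ : ContDiff ℝ 1 φ)
    (hsupp : tsupport φ ⊆ Iio T ×ˢ domPow K k) (ω : Ω) (x : Fin k → Vec d) :
    ∫ t in Icc 0 T, ((∏ j, V t ω (x j) (I j)) * fderiv ℝ φ (t, x) (1, 0) -
      ∑ l, ∑ m, (∏ j, if j = l then fluxDiff Δ W m t ω (x j) (I j) else V t ω (x j) (I j)) *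
        φ (t, x)) = -((∏ j, V 0 ω (x j) (I j)) * φ (0, x)) := by
  by_cases hx : ∀ j, x j ∈ K
  · have hd : ∀ t ∈ Icc 0 T, HasDerivWithinAt
        (fun τ => (∏ j, V τ ω (x j) (I j)) * φ (τ, x))
        ((∏ j, V t ω (x j) (I j)) * fderiv ℝ φ (t, x) (1, 0) -
          ∑ l, ∑ m, (∏ j, if j = l then fluxDiff Δ W m t ω (x j) (I j) else V t ω (x j) (I j)) *
            φ (t, x)) (Icc 0 T) t := by
      intro t ht
      have h1 : HasDerivAt (fun τ : ℝ => φ (τ, x)) (fderiv ℝ φ (t, x) (1, 0)) t :=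
        ((hφ.differentiable (by norm_num)) (t, x)).hasFDerivAt.comp_hasDerivAt t
          ((hasDerivAt_id t).prodMk (hasDerivAt_const t x))
      refine ((h.hasDerivWithinAt_prod I ω hx ht).mul h1.hasDerivWithinAt).congr_deriv ?_
      simp only [neg_mul, Finset.sum_mul]
      rw [neg_add_eq_sub]
    have hVc : ∀ j, ContinuousOn (fun t => V t ω (x j) (I j)) (Icc 0 T) := fun j t ht =>
      ((EuclideanSpace.proj (I j) : Vec N →L[ℝ] ℝ).continuous.continuousAt.comp_continuousWithinAt
        (h.deriv ω (x j) (hx j) t ht).continuousWithinAt)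
    have hFc : ∀ m j, ContinuousOn (fun t => fluxDiff Δ W m t ω (x j) (I j)) (Icc 0 T) := by
      intro m j
      have : ContinuousOn (fun t => fluxDiff Δ W m t ω (x j)) (Icc 0 T) :=
        ((h.continuous_flux m ω _ (hx j)).sub
          (h.continuous_flux_shift m ω _ (hx j))).const_smul Δ⁻¹
      exact (EuclideanSpace.proj (I j) : Vec N →L[ℝ] ℝ).continuous.comp_continuousOn this
    have hpc : Continuous fun t : ℝ => φ (t, x) := hφ.continuous.comp (by fun_prop)
    have hdc : Continuous fun t : ℝ => fderiv ℝ φ (t, x) (1, 0) :=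
      ((hφ.continuous_fderiv (by norm_num)).comp (by fun_prop : Continuous fun t : ℝ => (t, x))).clm_apply
        continuous_const
    have hcont : ContinuousOn (fun t => (∏ j, V t ω (x j) (I j)) * fderiv ℝ φ (t, x) (1, 0) -
          ∑ l, ∑ m, (∏ j, if j = l then fluxDiff Δ W m t ω (x j) (I j) else V t ω (x j) (I j)) *
            φ (t, x)) (Icc 0 T) := by
      refine ((continuousOn_finsetProd _ fun j _ => hVc j).mul hdc.continuousOn).sub ?_
      refine continuousOn_finsetSum _ fun l _ => continuousOn_finsetSum _ fun m _ => ?_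
      refine (continuousOn_finsetProd _ fun j _ => ?_).mul hpc.continuousOn
      split_ifs
      · exact hFc m j
      · exact hVc j
    rw [integral_Icc_eq_integral_Ioc, ← intervalIntegral.integral_of_le hT,
      intervalIntegral.integral_eq_sub_of_hasDerivAt_of_le hT
        (f := fun τ => (∏ j, V τ ω (x j) (I j)) * φ (τ, x))]
    · have h0 : φ (T, x) = 0 := by
        by_contra hne
        have h1 : T < T := (hsupp (subset_tsupport _ hne)).1
        exact lt_irrefl _ h1
      simp [h0]
    · exact (continuousOn_finsetProd _ fun j _ => hVc j).mul hpc.continuousOn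
    · exact fun t ht => (hd t (Ioo_subset_Icc_self ht)).hasDerivAt (Icc_mem_nhds ht.1 ht.2)
    · exact ContinuousOn.intervalIntegrable_of_Icc hT hcont
  -- If some x_j lies outside K, where the scheme is not assumed, then φ and its derivative vanish
  -- along the whole line through x and both sides are 0.
  · have h0 : ∀ t, (t, x) ∉ tsupport φ := fun t ht => hx fun j => (hsupp ht).2 j (mem_univ j)
    have h1 : ∀ t, φ (t, x) = 0 := fun t => image_eq_zero_of_notMem_tsupport (h0 t)
    have h2 : ∀ t, fderiv ℝ φ (t, x) = 0 := fun t =>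
      image_eq_zero_of_notMem_tsupport fun ht => h0 t (tsupport_fderiv_subset ℝ ht)
    simp [h1, h2]

/-- The test function shifted by one cell in the direction `m` of the variable `x_l`. -/
def shiftTest (Δ : ℝ) (φ : ℝ × (Fin k → Vec d) → ℝ) (l : Fin k) (m : Fin d)
    (z : ℝ × (Fin k → Vec d)) : ℝ :=
  φ (z.1, z.2 + Pi.single l (EuclideanSpace.single m Δ))

lemma lintegral_fluxDiff_le (hΔ : 0 < Δ) (h : SemiDiscrete D K Δ T C Pm V W) (m : Fin d) :
    ∀ᵐ z ∂(volume.restrict (Icc 0 T)).prod Pm,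
      ∫⁻ y in D, ‖fluxDiff Δ W m z.1 z.2 y‖ₑ ≤ ENNReal.ofReal Δ⁻¹ * (C + C) := by
  filter_upwards [h.bound_flux m, h.bound_flux_shift m] with z h1 h2
  have hm : Measurable fun y => ‖W m z.1 z.2 y‖ₑ :=
    ((h.measurable_flux m).comp (measurable_prodMk_left (x := z))).enorm
  calc _ ≤ ∫⁻ y in D, ENNReal.ofReal Δ⁻¹ * (‖W m z.1 z.2 y‖ₑ +
        ‖W m z.1 z.2 (y - EuclideanSpace.single m Δ)‖ₑ) := by
        refine lintegral_mono fun y => ?_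
        rw [fluxDiff, enorm_smul, Real.enorm_of_nonneg (by positivity)]
        gcongr
        exact enorm_sub_le
    _ = ENNReal.ofReal Δ⁻¹ * ((∫⁻ y in D, ‖W m z.1 z.2 y‖ₑ) +
        ∫⁻ y in D, ‖W m z.1 z.2 (y - EuclideanSpace.single m Δ)‖ₑ) := by
        rw [lintegral_const_mul' _ _ ENNReal.ofReal_ne_top, lintegral_add_left hm]
    _ ≤ _ := by gcongr

/-- Summation by parts, carried out in the continuous variable: the neighbouring flux is the
translate of W by Δe_m, so invariance of Lebesgue measure moves the difference quotient onto φ. The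
identity is exact, and the test function need not be discretised. -/
theorem SemiDiscrete.weak_form (h : SemiDiscrete D K Δ T C Pm V W) (hD : MeasurableSet D)
    (hC : C ≠ ∞) (hΔ : 0 < Δ) (hT : 0 ≤ T) (I : Fin k → Fin N) {φ : ℝ × (Fin k → Vec d) → ℝ}
    (hφ : ContDiff ℝ 1 φ) (hφc : HasCompactSupport φ)
    (hsupp : tsupport φ ⊆ Iio T ×ˢ domPow K k) (hKD : K ⊆ D)
    (hshift : ∀ l m z, shiftTest Δ φ l m z ≠ 0 → ∀ j, z.2 j ∈ D) :
    (∫ w, (∏ j, V w.1.1 w.1.2 (w.2 j) (I j)) * fderiv ℝ φ (w.1.1, w.2) (1, 0)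
      ∂(((volume.restrict (Icc 0 T)).prod Pm).prod (volume : Measure (Fin k → Vec d)))) +
    (∑ l, ∑ m, ∫ w, (∏ j, if j = l then W m w.1.1 w.1.2 (w.2 j) (I j)
        else V w.1.1 w.1.2 (w.2 j) (I j)) *
        (Δ⁻¹ * (shiftTest Δ φ l m (w.1.1, w.2) - φ (w.1.1, w.2)))
      ∂(((volume.restrict (Icc 0 T)).prod Pm).prod (volume : Measure (Fin k → Vec d)))) +
    ∫ w, (∏ j, V 0 w.1 (w.2 j) (I j)) * φ (0, w.2)
      ∂(Pm.prod (volume : Measure (Fin k → Vec d))) = 0 := by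
  set Q := (volume.restrict (Icc 0 T)).prod Pm with hQ
  obtain ⟨Kφ, hKφ⟩ := hφc.exists_bound_of_continuous hφ.continuous
  have hdcont : Continuous fun z => fderiv ℝ φ z (1, 0) :=
    (hφ.continuous_fderiv (by norm_num)).clm_apply continuous_const
  have hdc : HasCompactSupport fun z => fderiv ℝ φ z (1, 0) :=
    (hφc.fderiv (𝕜 := ℝ)).comp_left (g := fun L : (ℝ × (Fin k → Vec d)) →L[ℝ] ℝ => L (1, 0)) rfl
  obtain ⟨Kd, hKd⟩ := hdc.exists_bound_of_continuous hdcont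
  have hsuppD : ∀ z, φ z ≠ 0 → ∀ j, z.2 j ∈ D := fun z hz j =>
    hKD ((hsupp (subset_tsupport _ hz)).2 j (mem_univ j))
  have hsuppD' : ∀ z, fderiv ℝ φ z (1, 0) ≠ 0 → ∀ j, z.2 j ∈ D := fun z hz j => by
    refine hKD ((hsupp (tsupport_fderiv_subset ℝ (subset_tsupport _ ?_))).2 j (mem_univ j))
    intro h0
    exact hz (by rw [h0]; rfl)
  -- measurability and bounds of the factors
  have hVm : ∀ j : Fin k, Measurable fun z : (ℝ × Ω) × Vec d => V z.1.1 z.1.2 z.2 (I j) :=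
    fun j => measurable_coord h.measurable_field _
  have hWm : ∀ m (j : Fin k), Measurable fun z : (ℝ × Ω) × Vec d => W m z.1.1 z.1.2 z.2 (I j) :=
    fun m j => measurable_coord (h.measurable_flux m) _
  have hFm : ∀ m (j : Fin k),
      Measurable fun z : (ℝ × Ω) × Vec d => fluxDiff Δ W m z.1.1 z.1.2 z.2 (I j) :=
    fun m j => measurable_coord (measurable_fluxDiff h m) _
  -- One bound that serves V, W, the shifted W and the difference quotient of W. The factor Δ⁻¹ in
  -- it is harmless, since here it is used only for integrability at fixed Δ.
  set C' : ℝ≥0∞ := C + ENNReal.ofReal Δ⁻¹ * (C + C) with hC'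
  have hC't : C' ≠ ∞ := by finiteness
  have hVb : ∀ j : Fin k, ∀ᵐ z ∂Q, ∫⁻ y in D, ‖V z.1 z.2 y (I j)‖ₑ ≤ C' := fun j => by
    filter_upwards [h.bound_field] with z hz
    exact (lintegral_mono fun y => enorm_apply_le _ _).trans (hz.trans le_self_add)
  have hWb : ∀ m (j : Fin k), ∀ᵐ z ∂Q, ∫⁻ y in D, ‖W m z.1 z.2 y (I j)‖ₑ ≤ C' := fun m j => by
    filter_upwards [h.bound_flux m] with z hz
    exact (lintegral_mono fun y => enorm_apply_le _ _).trans (hz.trans le_self_add)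
  have hWsb : ∀ m (j : Fin k), ∀ᵐ z ∂Q,
      ∫⁻ y in D, ‖W m z.1 z.2 (y - EuclideanSpace.single m Δ) (I j)‖ₑ ≤ C' := fun m j => by
    filter_upwards [h.bound_flux_shift m] with z hz
    exact (lintegral_mono fun y => enorm_apply_le _ _).trans (hz.trans le_self_add)
  have hFb : ∀ m (j : Fin k), ∀ᵐ z ∂Q, ∫⁻ y in D, ‖fluxDiff Δ W m z.1 z.2 y (I j)‖ₑ ≤ C' :=
    fun m j => by
      filter_upwards [lintegral_fluxDiff_le hΔ h m] with z hz
      exact (lintegral_mono fun y => enorm_apply_le _ _).trans (hz.trans le_add_self)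
  -- integrability of all terms
  have hφm : Measurable fun w : (ℝ × Ω) × (Fin k → Vec d) => φ (w.1.1, w.2) :=
    hφ.continuous.measurable.comp (by fun_prop)
  have hsm : ∀ l m, Measurable fun w : (ℝ × Ω) × (Fin k → Vec d) =>
      shiftTest Δ φ l m (w.1.1, w.2) := fun l m => by
    have h3 : Measurable fun w : (ℝ × Ω) × (Fin k → Vec d) =>
        (w.1.1, w.2 + Pi.single l (EuclideanSpace.single m Δ : Vec d)) := by fun_prop
    have := hφ.continuous.measurable.comp h3
    simpa only [Function.comp_def, shiftTest] using this
  have hi1 : Integrable (fun w : (ℝ × Ω) × (Fin k → Vec d) =>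
      (∏ j, V w.1.1 w.1.2 (w.2 j) (I j)) * fderiv ℝ φ (w.1.1, w.2) (1, 0))
      (Q.prod volume) :=
    integrable_prod_mul Q volume hD (fun j z => V z.1.1 z.1.2 z.2 (I j)) hVm
      (Φ := fun w => fderiv ℝ φ (w.1.1, w.2) (1, 0))
      (hdcont.measurable.comp (by fun_prop)) (fun w => hKd _) (fun w hw => hsuppD' _ hw) hC't hVb
  have hgen : ∀ (l : Fin k) (m : Fin d) (g : Fin d → ℝ → Ω → Vec d → Fin N → ℝ)
      (hg : ∀ m (j : Fin k), Measurable fun z : (ℝ × Ω) × Vec d => g m z.1.1 z.1.2 z.2 (I j))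
      (hgb : ∀ m (j : Fin k), ∀ᵐ z ∂Q, ∫⁻ y in D, ‖g m z.1 z.2 y (I j)‖ₑ ≤ C')
      (Φ : (ℝ × Ω) × (Fin k → Vec d) → ℝ) (hΦm : Measurable Φ) (hΦ : ∀ w, |Φ w| ≤ Kφ)
      (hΦD : ∀ w, Φ w ≠ 0 → ∀ j, w.2 j ∈ D),
      Integrable (fun w : (ℝ × Ω) × (Fin k → Vec d) =>
        (∏ j, if j = l then g m w.1.1 w.1.2 (w.2 j) (I j) else V w.1.1 w.1.2 (w.2 j) (I j)) *
          Φ w) (Q.prod volume) := by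
    intro l m g hg hgb Φ hΦm hΦ hΦD
    refine integrable_prod_mul Q volume hD (fun j z => if j = l then g m z.1.1 z.1.2 z.2 (I j)
      else V z.1.1 z.1.2 z.2 (I j)) (fun j => ?_) hΦm hΦ hΦD hC't fun j => ?_
    · by_cases hj : j = l
      · simp only [if_pos hj]; exact hg m j
      · simp only [if_neg hj]; exact hVm j
    · by_cases hj : j = l
      · simp only [if_pos hj]; exact hgb m j
      · simp only [if_neg hj]; exact hVb j
  have hi2 : ∀ l m, Integrable (fun w : (ℝ × Ω) × (Fin k → Vec d) =>
      (∏ j, if j = l then fluxDiff Δ W m w.1.1 w.1.2 (w.2 j) (I j)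
        else V w.1.1 w.1.2 (w.2 j) (I j)) * φ (w.1.1, w.2)) (Q.prod volume) := fun l m =>
    hgen l m (fun m t ω y i => fluxDiff Δ W m t ω y i) hFm hFb _ hφm (fun w => hKφ _)
      (fun w hw => hsuppD _ hw)
  have hi3 : ∀ l m, Integrable (fun w : (ℝ × Ω) × (Fin k → Vec d) =>
      (∏ j, if j = l then W m w.1.1 w.1.2 (w.2 j) (I j)
        else V w.1.1 w.1.2 (w.2 j) (I j)) * φ (w.1.1, w.2)) (Q.prod volume) := fun l m =>
    hgen l m (fun m t ω y i => W m t ω y i) hWm hWb _ hφm (fun w => hKφ _)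
      (fun w hw => hsuppD _ hw)
  have hi4 : ∀ l m, Integrable (fun w : (ℝ × Ω) × (Fin k → Vec d) =>
      (∏ j, if j = l then W m w.1.1 w.1.2 (w.2 j) (I j)
        else V w.1.1 w.1.2 (w.2 j) (I j)) * shiftTest Δ φ l m (w.1.1, w.2)) (Q.prod volume) :=
    fun l m => hgen l m (fun m t ω y i => W m t ω y i) hWm hWb
      (fun w => shiftTest Δ φ l m (w.1.1, w.2)) (hsm l m) (fun w => hKφ _)
      (fun w hw => hshift l m _ hw)
  have hWsm : ∀ m (j : Fin k), Measurable fun z : (ℝ × Ω) × Vec d =>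
      W m z.1.1 z.1.2 (z.2 - EuclideanSpace.single m Δ) (I j) := fun m j => by
    have h3 : Measurable fun z : (ℝ × Ω) × Vec d => (z.1, z.2 - EuclideanSpace.single m Δ) := by
      fun_prop
    have := (hWm m j).comp h3
    simpa only [Function.comp_def] using this
  have hi5 : ∀ l m, Integrable (fun w : (ℝ × Ω) × (Fin k → Vec d) =>
      (∏ j, if j = l then W m w.1.1 w.1.2 (w.2 j - EuclideanSpace.single m Δ) (I j)
        else V w.1.1 w.1.2 (w.2 j) (I j)) * φ (w.1.1, w.2)) (Q.prod volume) := fun l m =>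
    hgen l m (fun m t ω y i => W m t ω (y - EuclideanSpace.single m Δ) i) hWsm hWsb _ hφm
      (fun w => hKφ _) (fun w hw => hsuppD _ hw)
  -- translation
  have htrans : ∀ l m, ∫ w : (ℝ × Ω) × (Fin k → Vec d), (∏ j, if j = l then fluxDiff Δ W m w.1.1 w.1.2 (w.2 j) (I j)
        else V w.1.1 w.1.2 (w.2 j) (I j)) * φ (w.1.1, w.2) ∂(Q.prod volume) =
      -∫ w : (ℝ × Ω) × (Fin k → Vec d), (∏ j, if j = l then W m w.1.1 w.1.2 (w.2 j) (I j)
        else V w.1.1 w.1.2 (w.2 j) (I j)) *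
        (Δ⁻¹ * (shiftTest Δ φ l m (w.1.1, w.2) - φ (w.1.1, w.2))) ∂(Q.prod volume) := by
    intro l m
    have e1 : ∫ w : (ℝ × Ω) × (Fin k → Vec d), (∏ j, if j = l then W m w.1.1 w.1.2 (w.2 j - EuclideanSpace.single m Δ) (I j)
        else V w.1.1 w.1.2 (w.2 j) (I j)) * φ (w.1.1, w.2) ∂(Q.prod volume) =
        ∫ w : (ℝ × Ω) × (Fin k → Vec d), (∏ j, if j = l then W m w.1.1 w.1.2 (w.2 j) (I j)
        else V w.1.1 w.1.2 (w.2 j) (I j)) * shiftTest Δ φ l m (w.1.1, w.2) ∂(Q.prod volume) := by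
      rw [integral_prod _ (hi5 l m), integral_prod _ (hi4 l m)]
      refine integral_congr_ae (ae_of_all _ fun z => ?_)
      simp only
      -- Only the variable x_l is translated; the factors in the other slots are unchanged.
      rw [← integral_add_right_eq_self _ (Pi.single l (EuclideanSpace.single m Δ) :
        Fin k → Vec d)]
      refine integral_congr_ae (ae_of_all _ fun x => ?_)
      simp only [shiftTest]
      congr 1
      refine Finset.prod_congr rfl fun j _ => ?_
      by_cases hj : j = l
      · subst hj; simp
      · simp [hj]
    have e2 : ∀ w : (ℝ × Ω) × (Fin k → Vec d),
        (∏ j, if j = l then fluxDiff Δ W m w.1.1 w.1.2 (w.2 j) (I j)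
          else V w.1.1 w.1.2 (w.2 j) (I j)) * φ (w.1.1, w.2) =
        Δ⁻¹ * ((∏ j, if j = l then W m w.1.1 w.1.2 (w.2 j) (I j)
          else V w.1.1 w.1.2 (w.2 j) (I j)) * φ (w.1.1, w.2) -
        (∏ j, if j = l then W m w.1.1 w.1.2 (w.2 j - EuclideanSpace.single m Δ) (I j)
          else V w.1.1 w.1.2 (w.2 j) (I j)) * φ (w.1.1, w.2)) := by
      intro w
      have e3 : ∀ g : Vec d → ℝ, (∏ j, if j = l then g (w.2 j)
          else V w.1.1 w.1.2 (w.2 j) (I j)) =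
          g (w.2 l) * ∏ j ∈ Finset.univ.erase l, V w.1.1 w.1.2 (w.2 j) (I j) := by
        intro g
        rw [← Finset.mul_prod_erase Finset.univ _ (Finset.mem_univ l), if_pos rfl]
        congr 1
        exact Finset.prod_congr rfl fun j hj => if_neg (Finset.ne_of_mem_erase hj)
      -- The component index is frozen at I l, so that the special slot becomes a single function of
      -- x_l that can be factored out.
      have e4 : ∀ g : Vec d → Vec N, (∏ j, if j = l then g (w.2 j) (I j)
          else V w.1.1 w.1.2 (w.2 j) (I j)) = ∏ j, if j = l then g (w.2 j) (I l)
          else V w.1.1 w.1.2 (w.2 j) (I j) := fun g => Finset.prod_congr rfl fun j _ => by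
        split_ifs with hj
        · rw [hj]
        · rfl
      rw [e4 (fun y => fluxDiff Δ W m w.1.1 w.1.2 y), e4 (fun y => W m w.1.1 w.1.2 y),
        e4 (fun y => W m w.1.1 w.1.2 (y - EuclideanSpace.single m Δ)),
        e3 (fun y => fluxDiff Δ W m w.1.1 w.1.2 y (I l)), e3 (fun y => W m w.1.1 w.1.2 y (I l)),
        e3 (fun y => W m w.1.1 w.1.2 (y - EuclideanSpace.single m Δ) (I l))]
      simp only [fluxDiff, PiLp.smul_apply, PiLp.sub_apply, smul_eq_mul]
      ring
    have e5 : ∀ w : (ℝ × Ω) × (Fin k → Vec d), (∏ j, if j = l then W m w.1.1 w.1.2 (w.2 j) (I j)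
        else V w.1.1 w.1.2 (w.2 j) (I j)) *
        (Δ⁻¹ * (shiftTest Δ φ l m (w.1.1, w.2) - φ (w.1.1, w.2))) =
        Δ⁻¹ * ((∏ j, if j = l then W m w.1.1 w.1.2 (w.2 j) (I j)
        else V w.1.1 w.1.2 (w.2 j) (I j)) * shiftTest Δ φ l m (w.1.1, w.2) -
        (∏ j, if j = l then W m w.1.1 w.1.2 (w.2 j) (I j)
        else V w.1.1 w.1.2 (w.2 j) (I j)) * φ (w.1.1, w.2)) := fun w => by ring
    simp only [e2, e5]
    rw [integral_const_mul, integral_const_mul, integral_sub (hi3 l m) (hi5 l m),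
      integral_sub (hi4 l m) (hi3 l m), e1]
    ring
  -- integration in time first
  have htot : ∫ w : (ℝ × Ω) × (Fin k → Vec d), ((∏ j, V w.1.1 w.1.2 (w.2 j) (I j)) * fderiv ℝ φ (w.1.1, w.2) (1, 0) -
      ∑ l, ∑ m, (∏ j, if j = l then fluxDiff Δ W m w.1.1 w.1.2 (w.2 j) (I j)
        else V w.1.1 w.1.2 (w.2 j) (I j)) * φ (w.1.1, w.2)) ∂(Q.prod volume) =
      -∫ w, (∏ j, V 0 w.1 (w.2 j) (I j)) * φ (0, w.2)
        ∂(Pm.prod (volume : Measure (Fin k → Vec d))) := by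
    have hinteg := hi1.sub (integrable_finsetSum Finset.univ fun l _ =>
      integrable_finsetSum Finset.univ fun m _ => hi2 l m)
    have hmp := (measurePreserving_prodAssoc (volume.restrict (Icc 0 T)) Pm
      (volume : Measure (Fin k → Vec d))).symm
    rw [hQ, ← hmp.integral_comp']
    rw [hQ] at hinteg
    have hinteg' := (hmp.integrable_comp_emb
      (MeasurableEquiv.prodAssoc.symm.measurableEmbedding)).2 hinteg
    rw [integral_prod_symm, ← integral_neg]
    · refine integral_congr_ae (ae_of_all _ fun v => ?_)
      exact h.integral_time hT I hφ hsupp v.1 v.2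
    · exact hinteg'
  rw [integral_sub hi1 (integrable_finsetSum Finset.univ fun l _ =>
      integrable_finsetSum Finset.univ fun m _ => hi2 l m),
    integral_finsetSum _ (fun l _ => integrable_finsetSum Finset.univ fun m _ => hi2 l m)] at htot
  have e6 : ∀ l, ∫ w : (ℝ × Ω) × (Fin k → Vec d), ∑ m, (∏ j, if j = l then fluxDiff Δ W m w.1.1 w.1.2 (w.2 j) (I j)
        else V w.1.1 w.1.2 (w.2 j) (I j)) * φ (w.1.1, w.2) ∂(Q.prod volume) =
      -∑ m, ∫ w : (ℝ × Ω) × (Fin k → Vec d), (∏ j, if j = l then W m w.1.1 w.1.2 (w.2 j) (I j)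
        else V w.1.1 w.1.2 (w.2 j) (I j)) *
        (Δ⁻¹ * (shiftTest Δ φ l m (w.1.1, w.2) - φ (w.1.1, w.2))) ∂(Q.prod volume) := by
    intro l
    rw [integral_finsetSum _ fun m _ => hi2 l m, ← Finset.sum_neg_distrib]
    exact Finset.sum_congr rfl fun m _ => htrans l m
  simp only [e6, Finset.sum_neg_distrib, sub_neg_eq_add] at htot
  linarith

end Weak

/-! ### The scheme as a semi-discrete equation for fields -/

section Geometry

variable {d : ℕ} {a : Vec d} {Δ : ℝ}

lemma cellIdx_sub_single (hΔ : 0 < Δ) (x : Vec d) (m : Fin d) :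
    cellIdx a Δ (x - EuclideanSpace.single m Δ) = cellIdx a Δ x - Pi.single m 1 := by
  have h := cellIdx_add_single (a := a) hΔ (x - EuclideanSpace.single m Δ) m 1
  simp only [Int.cast_one, one_mul, sub_add_cancel] at h
  rw [h, add_sub_cancel_right]

lemma cellIdx_mem_mesh {D K : Set (Vec d)} {δ : ℝ} (hδ : 0 ≤ δ)
    (hK : Metric.cthickening δ K ⊆ D) (hΔ : 0 < Δ) (hr : d * Δ ≤ δ / 2) {x : Vec d}
    (hx : x ∈ Metric.cthickening (δ / 2) K) : cellIdx a Δ x ∈ mesh D a Δ := by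
  intro y hy
  have h1 := norm_sub_le_of_mem_cell hΔ hy
  have h3 : y ∈ Metric.cthickening (δ / 2) (Metric.cthickening (δ / 2) K) :=
    Metric.mem_cthickening_of_dist_le y x _ _ hx (by rw [dist_eq_norm]; linarith)
  have h0 : 0 ≤ δ / 2 := by linarith
  have h4 := Metric.cthickening_cthickening_subset h0 h0 K h3
  rw [add_halves] at h4
  exact hK h4

end Geometry

section Scheme

variable {d N : ℕ} {p : ℝ≥0∞} [Fact (1 ≤ p)] {D : Set (Vec d)} {a : Vec d} {Δ T T' : ℝ} {q : ℕ}
  {F : Fin d → (Fin (2 * q) → Vec N) → Vec N} {S : ℝ → LpSpace d N p D → LpSpace d N p D}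

lemma cellVal_of_mem {t : ℝ} (ht : t ∈ Icc 0 T') (u : LpSpace d N p D) {i : Fin d → ℤ}
    (hi : i ∈ mesh D a Δ) : cellVal a Δ S T' t u i = cellAvg a Δ (S t u) i := by
  rw [cellVal, if_pos hi, clip_of_mem ht]

lemma cellVal_add_single (hΔ : 0 < Δ) (t : ℝ) (u : LpSpace d N p D) (x : Vec d) (m : Fin d)
    (j : ℤ) : cellVal a Δ S T' t u (cellIdx a Δ x + Pi.single m j) =
      field a Δ S T' t u (x + EuclideanSpace.single m (j * Δ)) := by
  rw [field, cellIdx_add_single hΔ]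

lemma continuous_cellVal (hΔ : 0 < Δ) (h : IsNumericalEvolution T a Δ q F S)
    (hT'0 : 0 ≤ T') (hT' : T' < T) (u : LpSpace d N p D) (i : Fin d → ℤ) :
    Continuous fun t => cellVal a Δ S T' t u i := by
  by_cases hi : i ∈ mesh D a Δ
  · simp only [cellVal, if_pos hi]
    exact ((h.cellAvg_scheme hΔ u).2.2.1 i hi).comp_continuous (continuous_clip T') fun t =>
      ⟨(clip_mem hT'0).1, (clip_mem hT'0).2.trans_lt hT'⟩
  · simp only [cellVal, if_neg hi]
    exact continuous_const

/-- The numerical flux through the right face of the cell of `x` in the direction `m`. -/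
def numFlux (a : Vec d) (Δ : ℝ) (q : ℕ) (F : Fin d → (Fin (2 * q) → Vec N) → Vec N)
    (S : ℝ → LpSpace d N p D → LpSpace d N p D) (T' : ℝ) (m : Fin d) (t : ℝ)
    (u : LpSpace d N p D) (x : Vec d) : Vec N :=
  F m (stencil q (cellVal a Δ S T' t u) m (cellIdx a Δ x))

lemma measurable_numFlux (hp : p ≠ ∞) (hΔ : 0 < Δ) (h : IsNumericalEvolution T a Δ q F S)
    (hT'0 : 0 ≤ T') (hT' : T' < T) (hF : ∀ m, Continuous (F m)) (m : Fin d) :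
    Measurable fun z : (ℝ × LpSpace d N p D) × Vec d =>
      numFlux a Δ q F S T' m z.1.1 z.1.2 z.2 := by
  have h1 : Measurable fun z : (ℝ × LpSpace d N p D) × Vec d =>
      stencil q (cellVal a Δ S T' z.1.1 z.1.2) m (cellIdx a Δ z.2) := by
    refine measurable_pi_lambda _ fun j => ?_
    have hI : Measurable fun x => cellIdx a Δ x + Pi.single m ((j : ℤ) - q + 1) :=
      (measurable_cellIdx a Δ).add_const _
    have := measurable_cellVal_comp hp hΔ h hT'0 hT' hI
    simpa only [stencil] using this
  have := (hF m).measurable.comp h1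
  simpa only [Function.comp_def, numFlux] using this

lemma measurable_lintegral_field (hp : p ≠ ∞) (hΔ : 0 < Δ) (h : IsNumericalEvolution T a Δ q F S)
    (hT'0 : 0 ≤ T') (hT' : T' < T) {b : Vec N → ℝ≥0∞} (hb : Measurable b) :
    Measurable fun z : ℝ × LpSpace d N p D => ∫⁻ x, b (field a Δ S T' z.1 z.2 x) := by
  have := hb.comp (measurable_field hp hΔ h hT'0 hT')
  exact this.lintegral_prod_right'

lemma ae_lintegral_field_le (hp : p ≠ ∞) (hDm : MeasurableSet D) (hΔ : 0 < Δ)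
    (h : IsNumericalEvolution T a Δ q F S) (hT'0 : 0 ≤ T') (hT' : T' < T)
    {μbar : Measure (LpSpace d N p D)} [IsProbabilityMeasure μbar] {P : ℝ} (hP : 1 ≤ P) {c : ℝ≥0}
    (hc : ∀ᵐ t ∂volume.restrict (Ico 0 T), ∀ᵐ u ∂μbar, ∫⁻ x in D, ‖S t u x‖ₑ ^ P ≤ c) :
    ∀ᵐ z ∂(volume.restrict (Icc 0 T')).prod μbar,
      ∫⁻ x, ‖field a Δ S T' z.1 z.2 x‖ₑ ^ P ≤ c := by
  have hm : MeasurableSet {z : ℝ × LpSpace d N p D |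
      ∫⁻ x, ‖field a Δ S T' z.1 z.2 x‖ₑ ^ P ≤ c} :=
    measurableSet_le (measurable_lintegral_field hp hΔ h hT'0 hT'
      (measurable_enorm.pow_const P)) measurable_const
  refine (Measure.ae_prod_mem_iff_ae_ae_mem hm).2 ?_
  have h1 : ∀ᵐ t ∂volume.restrict (Icc 0 T'), t ∈ Icc 0 T' := ae_restrict_mem measurableSet_Icc
  have h2 := ae_restrict_of_ae_restrict_of_subset
    (fun t ht => ⟨ht.1, ht.2.trans_lt hT'⟩ : Icc 0 T' ⊆ Ico 0 T) hc
  filter_upwards [h1, h2] with t ht htc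
  filter_upwards [htc] with u hu
  exact (lintegral_field_le hDm hΔ h hT' ht u (b := fun ξ => ‖ξ‖ₑ ^ P)
    (by simp; linarith)).trans hu

lemma enorm_le_one_add_rpow {P : ℝ} (hP : 1 ≤ P) (ξ : Vec N) : ‖ξ‖ₑ ≤ 1 * (1 + ‖ξ‖ₑ ^ P) := by
  rw [one_mul]
  rcases le_total ‖ξ‖ₑ 1 with h | h
  · exact h.trans le_self_add
  · refine le_trans ?_ le_add_self
    calc ‖ξ‖ₑ = ‖ξ‖ₑ ^ (1 : ℝ) := by simp
      _ ≤ _ := ENNReal.rpow_le_rpow_of_exponent_le h hP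

lemma enorm_flux_le {P C : ℝ} (hP : 0 ≤ P) {G : (Fin (2 * q) → Vec N) → Vec N}
    (hG : ∀ w, ‖G w‖ ≤ C * (1 + ∑ j, ‖w j‖ ^ P)) (w : Fin (2 * q) → Vec N) :
    ‖G w‖ₑ ≤ ENNReal.ofReal C * (1 + ∑ j, ‖w j‖ₑ ^ P) := by
  have h0 : (0 : ℝ) ≤ ∑ j, ‖w j‖ ^ P := by positivity
  rw [← ofReal_norm]
  refine (ENNReal.ofReal_le_ofReal (hG w)).trans ?_
  rw [ENNReal.ofReal_mul' (by positivity), ENNReal.ofReal_add zero_le_one h0,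
    ENNReal.ofReal_sum_of_nonneg (fun j _ => by positivity)]
  simp [enorm_rpow_eq_ofReal hP]

/-- Every stencil entry is a translate of the field, so growth of the flux and translation
invariance give the bound. The integral of the field is taken over the whole space because
translates may leave D. The free vector `v` covers the fluxes through both faces. -/
lemma lintegral_numFlux_le (hp : p ≠ ∞) (hΔ : 0 < Δ) (h : IsNumericalEvolution T a Δ q F S)
    (hT'0 : 0 ≤ T') (hT' : T' < T) {P C : ℝ} (hP : 1 ≤ P)
    (hF : ∀ m w, ‖F m w‖ ≤ C * (1 + ∑ j, ‖w j‖ ^ P)) (m : Fin d) {t : ℝ} {u : LpSpace d N p D}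
    {c : ℝ≥0} (hc : ∫⁻ x, ‖field a Δ S T' t u x‖ₑ ^ P ≤ c) (v : Vec d) :
    ∫⁻ x in D, ‖numFlux a Δ q F S T' m t u (x + v)‖ₑ ≤
      ENNReal.ofReal C * (volume D + (2 * q : ℕ) * c) := by
  have hm : Measurable (field a Δ S T' t u) := by
    have := (measurable_field hp hΔ h hT'0 hT').comp
      (measurable_prodMk_left (x := (t, u)) (β := Vec d))
    simpa only [Function.comp_def] using this
  have hmj : ∀ y : Vec d, Measurable fun x => ‖field a Δ S T' t u (x + y)‖ₑ ^ P := fun y =>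
    ((hm.comp (measurable_add_const y)).enorm).pow_const P
  calc _ ≤ ∫⁻ x in D, ENNReal.ofReal C * (1 + ∑ j : Fin (2 * q), ‖field a Δ S T' t u
        (x + (v + EuclideanSpace.single m ((((j : ℤ) - q + 1 : ℤ) : ℝ) * Δ)))‖ₑ ^ P) := by
        refine lintegral_mono fun x => ?_
        refine (enorm_flux_le (by linarith) (hF m) _).trans (le_of_eq ?_)
        simp only [stencil, cellVal_add_single hΔ, add_assoc]
    _ = ENNReal.ofReal C * (volume D + ∑ j : Fin (2 * q), ∫⁻ x in D, ‖field a Δ S T' t u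
        (x + (v + EuclideanSpace.single m ((((j : ℤ) - q + 1 : ℤ) : ℝ) * Δ)))‖ₑ ^ P) := by
        rw [lintegral_const_mul' _ _ ENNReal.ofReal_ne_top, lintegral_add_left measurable_const,
          lintegral_finsetSum _ fun j _ => hmj _]
        simp
    _ ≤ ENNReal.ofReal C * (volume D + ∑ _j : Fin (2 * q), (c : ℝ≥0∞)) := by
        gcongr with j
        refine (setLIntegral_le_lintegral _ _).trans ?_
        rw [lintegral_add_right_eq_self (fun x => ‖field a Δ S T' t u x‖ₑ ^ P)]
        exact hc
    _ = _ := by simp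

/-- The constant that bounds the fields and the fluxes. -/
def fluxBound (D : Set (Vec d)) (q : ℕ) (C : ℝ) (c : ℝ≥0) : ℝ≥0∞ :=
  (1 + ENNReal.ofReal C) * (volume D + (2 * q : ℕ) * c) + (volume D + c)

/-- Since (d + q)Δ ≤ δ/2, the cells of points of K and their stencils all lie in the mesh. There the
equation involves true cell averages only, whatever the boundary values are. -/
theorem semiDiscrete_scheme (hp : p ≠ ∞) (hDm : MeasurableSet D) (hΔ : 0 < Δ)
    (h : IsNumericalEvolution T a Δ q F S) (hT'0 : 0 ≤ T') (hT' : T' < T)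
    (hF : ∀ m, Continuous (F m)) {P C : ℝ} (hP : 1 ≤ P)
    (hFg : ∀ m w, ‖F m w‖ ≤ C * (1 + ∑ j, ‖w j‖ ^ P))
    {μbar : Measure (LpSpace d N p D)} [IsProbabilityMeasure μbar] {c : ℝ≥0}
    (hc : ∀ᵐ t ∂volume.restrict (Ico 0 T), ∀ᵐ u ∂μbar, ∫⁻ x in D, ‖S t u x‖ₑ ^ P ≤ c)
    {K : Set (Vec d)} {δ : ℝ} (hδ : 0 ≤ δ) (hK : Metric.cthickening δ K ⊆ D)
    (hr : (d + q) * Δ ≤ δ / 2) :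
    SemiDiscrete D K Δ T' (fluxBound D q C c) μbar (field a Δ S T') (numFlux a Δ q F S T') := by
  have hKt : K ⊆ Metric.cthickening (δ / 2) K := Metric.self_subset_cthickening K
  have hb := ae_lintegral_field_le hp hDm hΔ h hT'0 hT' hP hc
  have hm : ∀ z : ℝ × LpSpace d N p D, Measurable (field a Δ S T' z.1 z.2) := fun z => by
    have := (measurable_field hp hΔ h hT'0 hT').comp
      (measurable_prodMk_left (x := z) (β := Vec d))
    simpa only [Function.comp_def] using this
  have hcont : ∀ m (u : LpSpace d N p D) y,
      Continuous fun t => numFlux a Δ q F S T' m t u y := fun m u y =>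
    (hF m).comp (continuous_pi fun j => continuous_cellVal hΔ h hT'0 hT' u _)
  have hle : ENNReal.ofReal C * (volume D + (2 * q : ℕ) * c) ≤ fluxBound D q C c := by
    rw [fluxBound, add_mul]
    exact le_add_self.trans le_self_add
  refine ⟨measurable_field hp hΔ h hT'0 hT', measurable_numFlux hp hΔ h hT'0 hT' hF, ?_,
    fun m => ?_, fun m => ?_, fun m u y _ => (hcont m u y).continuousOn,
    fun m u y _ => (hcont m u _).continuousOn, ?_⟩
  · filter_upwards [hb] with z hz
    refine (lintegral_growth_le (D := D) (enorm_le_one_add_rpow hP) (hm z).aemeasurable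
      ((setLIntegral_le_lintegral _ _).trans hz)).trans ?_
    rw [one_mul]
    exact le_add_self
  · filter_upwards [hb] with z hz
    refine le_trans ?_ hle
    simpa using lintegral_numFlux_le hp hΔ h hT'0 hT' hP hFg m hz 0
  · filter_upwards [hb] with z hz
    refine le_trans ?_ hle
    simpa only [sub_eq_add_neg] using lintegral_numFlux_le hp hΔ h hT'0 hT' hP hFg m hz
      (-EuclideanSpace.single m Δ)
  · intro u y hy t ht
    have hmesh : cellIdx a Δ y ∈ mesh D a Δ := by
      refine cellIdx_mem_mesh hδ hK hΔ (le_trans ?_ hr) (hKt hy)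
      have : (0 : ℝ) ≤ q * Δ := by positivity
      linarith
    have hsub : Icc 0 T' ⊆ Ico 0 T := fun t ht => ⟨ht.1, ht.2.trans_lt hT'⟩
    have h1 := (h.cellAvg_scheme hΔ u).2.2.2 t (hsub ht) (cellIdx a Δ y) hmesh
      (fun m j hj => mem_mesh_of_mem_cthickening hδ hK hΔ hr (hKt hy) m hj)
      (cellVal a Δ S T' t u) (fun i' hi' => cellVal_of_mem ht u hi')
    refine ((h1.mono hsub).congr (fun τ hτ => cellVal_of_mem hτ u hmesh)
      (cellVal_of_mem ht u hmesh)).congr_deriv ?_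
    simp only [numFlux, cellIdx_sub_single hΔ]

end Scheme

/-! ### Integrals of the fields as moments of the correlation measures -/

section Link

variable {d N : ℕ} {p : ℝ≥0∞} [Fact (1 ≤ p)] {D : Set (Vec d)} {a : Vec d} {Δ T T' : ℝ} {q : ℕ}
  {F : Fin d → (Fin (2 * q) → Vec N) → Vec N} {S : ℝ → LpSpace d N p D → LpSpace d N p D}
  {μbar : Measure (LpSpace d N p D)} [IsProbabilityMeasure μbar] {P : ℝ} {c : ℝ≥0} {k : ℕ}
  {ν : TimeCorrFamily d N}

lemma TimeDualBdd.ae_lintegral_le (hm : ∀ t ∈ Ico 0 T, Measurable (S t))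
    (hb : TimeDualBdd T P c (fun t => μbar.map (S t)) ν) :
    ∀ᵐ t ∂volume.restrict (Ico 0 T), ∀ᵐ u ∂μbar, ∫⁻ x in D, ‖S t u x‖ₑ ^ P ≤ c := by
  filter_upwards [hb.slice, ae_restrict_mem measurableSet_Ico] with t ht htm
  exact ae_of_ae_map (hm t htm).aemeasurable ht.bound

lemma measurable_comp_field (hp : p ≠ ∞) (hΔ : 0 < Δ) (h : IsNumericalEvolution T a Δ q F S)
    (hT'0 : 0 ≤ T') (hT' : T' < T) {H : Vec N → ℝ} (hH : Measurable H) :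
    Measurable fun z : (ℝ × LpSpace d N p D) × Vec d => H (field a Δ S T' z.1.1 z.1.2 z.2) := by
  have := hH.comp (measurable_field hp hΔ h hT'0 hT')
  simpa only [Function.comp_def] using this

lemma ae_lintegral_comp_field_le (hp : p ≠ ∞) (hDm : MeasurableSet D) (hΔ : 0 < Δ)
    (h : IsNumericalEvolution T a Δ q F S) (hT'0 : 0 ≤ T') (hT' : T' < T) (hP : 1 ≤ P)
    (hb : TimeDualBdd T P c (fun t => μbar.map (S t)) ν) {H : Vec N → ℝ} {C : ℝ}
    (hC : ∀ ξ, |H ξ| ≤ C * (1 + ‖ξ‖ ^ P)) :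
    ∀ᵐ z ∂(volume.restrict (Icc 0 T')).prod μbar,
      ∫⁻ y in D, ‖H (field a Δ S T' z.1 z.2 y)‖ₑ ≤ ENNReal.ofReal C * (volume D + c) := by
  filter_upwards [ae_lintegral_field_le hp hDm hΔ h hT'0 hT' hP
    (hb.ae_lintegral_le h.measurable)] with z hz
  have hm : Measurable (field a Δ S T' z.1 z.2) := by
    have := (measurable_field hp hΔ h hT'0 hT').comp
      (measurable_prodMk_left (x := z) (β := Vec d))
    simpa only [Function.comp_def] using this
  exact lintegral_growth_le (b := fun ξ => ‖H ξ‖ₑ)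
    (fun ξ => enorm_le_growth (by linarith) (hC ξ)) hm.aemeasurable
    ((setLIntegral_le_lintegral _ _).trans hz)

/-- On the support of Φ the field is the numerical solution. For almost every t, the image of `μbar`
under `S t` is dual to the slice of ν, so the integral over (u,x) becomes one over (x,ξ). -/
theorem integral_field_eq (hp : p ≠ ∞) (hDm : MeasurableSet D) (hDf : volume D ≠ ∞) (hΔ : 0 < Δ)
    (h : IsNumericalEvolution T a Δ q F S) (hT'0 : 0 ≤ T') (hT' : T' < T) (hP : 1 ≤ P)
    (hb : TimeDualBdd T P c (fun t => μbar.map (S t)) ν) (H : Fin k → Vec N → ℝ)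
    (hH : ∀ j, Measurable (H j)) {C : ℝ} (hC : ∀ j ξ, |H j ξ| ≤ C * (1 + ‖ξ‖ ^ P))
    {Φ : ℝ × (Fin k → Vec d) → ℝ} (hΦm : Measurable Φ) {B : ℝ} (hB : ∀ z, |Φ z| ≤ B)
    (hΦ : ∀ z, Φ z ≠ 0 → z.1 ≤ T' ∧ ∀ j, z.2 j ∈ D ∧ cellIdx a Δ (z.2 j) ∈ mesh D a Δ) :
    ∫ w, (∏ j, H j (field a Δ S T' w.1.1 w.1.2 (w.2 j))) * Φ (w.1.1, w.2)
      ∂(((volume.restrict (Icc 0 T')).prod μbar).prod (volume : Measure (Fin k → Vec d))) =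
    ∫ w, Φ w.1 * ∏ j, H j (w.2 j) ∂(jointLaw D T ν k) := by
  have hfin : IsFiniteMeasure ((volume : Measure (Vec d)).restrict D) :=
    ⟨by simpa using hDf.lt_top⟩
  have hfink : IsFiniteMeasure ((volume : Measure (Fin k → Vec d)).restrict (domPow D k)) := by
    rw [volume_restrict_domPow]; infer_instance
  have hsub : Icc 0 T' ⊆ Ico 0 T := fun t ht => ⟨ht.1, ht.2.trans_lt hT'⟩
  obtain ⟨e, he, heu⟩ := exists_measurable_eval (N := N) hp D
  -- integrability
  have hΦm' : Measurable fun w : (ℝ × LpSpace d N p D) × (Fin k → Vec d) => Φ (w.1.1, w.2) :=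
    hΦm.comp (by fun_prop)
  have hil : Integrable (fun w : (ℝ × LpSpace d N p D) × (Fin k → Vec d) =>
      (∏ j, H j (field a Δ S T' w.1.1 w.1.2 (w.2 j))) * Φ (w.1.1, w.2))
      (((volume.restrict (Icc 0 T')).prod μbar).prod (volume : Measure (Fin k → Vec d))) :=
    integrable_prod_mul ((volume.restrict (Icc 0 T')).prod μbar) volume hDm
      (fun j z => H j (field a Δ S T' z.1.1 z.1.2 z.2))
      (fun j => measurable_comp_field hp hΔ h hT'0 hT' (hH j))
      (Φ := fun w => Φ (w.1.1, w.2)) hΦm' (fun w => hB _) (fun w hw j => ((hΦ _ hw).2 j).1)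
      (by finiteness : ENNReal.ofReal C * (volume D + c) ≠ ∞)
      (fun j => ae_lintegral_comp_field_le hp hDm hΔ h hT'0 hT' hP hb (hC j))
  have hir : Integrable (fun w : (ℝ × (Fin k → Vec d)) × (Fin k → Vec N) =>
      Φ w.1 * ∏ j, H j (w.2 j)) (jointLaw D T ν k) :=
    (hb.integrable_prod hp hDf (by linarith) H hH hC).bdd_mul
      (hΦm.comp measurable_fst).aestronglyMeasurable (ae_of_all _ fun w => hB w.1)
  rw [integral_prod _ hil, integral_prod _ hil.integral_prod_left, integral_jointLaw hb.markov hir]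
  -- restriction to times at most `T'`
  have hrest : ∫ t in Ico 0 T, ∫ y, Φ (t, y.1) * ∏ j, H j (y.2 j)
        ∂((volume.restrict (domPow D k)) ⊗ₘ (ν.slice t k)) =
      ∫ t in Icc 0 T', ∫ y, Φ (t, y.1) * ∏ j, H j (y.2 j)
        ∂((volume.restrict (domPow D k)) ⊗ₘ (ν.slice t k)) := by
    refine setIntegral_eq_of_subset_of_forall_diff_eq_zero measurableSet_Ico hsub fun t ht => ?_
    have : ∀ x, Φ (t, x) = 0 := fun x => by
      by_contra hne
      exact ht.2 ⟨ht.1.1, (hΦ _ hne).1⟩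
    simp [this]
  rw [hrest]
  refine integral_congr_ae ?_
  filter_upwards [ae_restrict_of_ae_restrict_of_subset hsub hb.slice,
    ae_restrict_of_ae_restrict_of_subset hsub (integrable_jointLaw_slice hb.markov hir),
    ae_restrict_mem measurableSet_Icc] with t ht hti htm
  have hSt := h.measurable t (hsub htm)
  have := ht.prob
  have hg : Measurable fun y : (Fin k → Vec d) × (Fin k → Vec N) =>
      Φ (t, y.1) * ∏ j, H j (y.2 j) :=
    (hΦm.comp (by fun_prop)).mul (Finset.measurable_fun_prod _ fun j _ =>
      (hH j).comp (by fun_prop))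
  rw [compProd_eq_map_evalPow hDf he heu ht.markov ht.dual k] at hti ⊢
  rw [integrable_map_measure hg.aestronglyMeasurable (measurable_evalPow he k).aemeasurable] at hti
  rw [integral_map (measurable_evalPow he k).aemeasurable hg.aestronglyMeasurable]
  simp only [Function.comp_def] at hti
  rw [integral_prod _ hti, integral_map hSt.aemeasurable]
  · refine integral_congr_ae (ae_of_all _ fun u => ?_)
    simp only [Function.comp_def, evalPow]
    have hset : ∫ x, (∏ j, H j (field a Δ S T' t u (x j))) * Φ (t, x) =
        ∫ x in domPow D k, (∏ j, H j (field a Δ S T' t u (x j))) * Φ (t, x) := by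
      refine (setIntegral_eq_integral_of_forall_compl_eq_zero fun x hx => ?_).symm
      have : Φ (t, x) = 0 := by
        by_contra hne
        exact hx fun j _ => ((hΦ _ hne).2 j).1
      simp [this]
    rw [hset]
    refine integral_congr_ae ?_
    rw [volume_restrict_domPow]
    have hae : ∀ᵐ y ∂volume.restrict D, cellIdx a Δ y ∈ mesh D a Δ →
        field a Δ S T' t u y = e (S t u, y) := by
      filter_upwards [heu (S t u), ae_restrict_of_ae (ae_field_eq hΔ h hT' htm u)] with y h1 h2 hy
      rw [h1, (h2 hy).2]
    filter_upwards [ae_pi_of_ae _ hae] with x hx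
    by_cases hne : Φ (t, x) = 0
    · simp [hne]
    · rw [mul_comm]
      congr 1
      exact Finset.prod_congr rfl fun j _ => by rw [hx j ((hΦ _ hne).2 j).2]
  · exact hti.integral_prod_left.aestronglyMeasurable

end Link

/-! ### Consistency of the numerical flux -/

section Consistency

variable {N : ℕ}

lemma norm_sub_le_sum_jumps (w : ℤ → Vec N) {a b : ℤ} (hab : a ≤ b) :
    ‖w b - w a‖ ≤ ∑ i ∈ Finset.Ico a b, ‖w (i + 1) - w i‖ := by
  induction b, hab using Int.le_induction with
  | base => simp
  | succ b hab ih =>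
    have e : Finset.Ico a (b + 1) = insert b (Finset.Ico a b) := by
      ext i; simp only [Finset.mem_Ico, Finset.mem_insert]; omega
    rw [e, Finset.sum_insert (by simp), show w (b + 1) - w a = (w (b + 1) - w b) + (w b - w a) by
      abel]
    exact (norm_add_le _ _).trans (by gcongr)

lemma norm_sub_le_sum_stencil {q : ℕ} (w : ℤ → Vec N) {j : ℤ}
    (hj : j ∈ Finset.Icc (1 - (q : ℤ)) q) (hq : 1 ≤ q) :
    ‖w 0 - w j‖ ≤ ∑ i ∈ Finset.Ico (1 - (q : ℤ)) q, ‖w (i + 1) - w i‖ := by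
  rw [Finset.mem_Icc] at hj
  rcases le_total j 0 with h | h
  · refine (norm_sub_le_sum_jumps w h).trans
      (Finset.sum_le_sum_of_subset_of_nonneg (Finset.Ico_subset_Ico hj.1 (by omega))
        fun _ _ _ => norm_nonneg _)
  · rw [norm_sub_rev]
    refine (norm_sub_le_sum_jumps w h).trans
      (Finset.sum_le_sum_of_subset_of_nonneg (Finset.Ico_subset_Ico (by omega) hj.2)
        fun _ _ _ => norm_nonneg _)

/-- Either x ≤ ε, or (x/ε)^s ≥ 1 and x ≤ R. This permits an arbitrary exponent s > 0 in the weak BV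
bound. -/
lemma le_add_mul_rpow {x R ε s : ℝ} (hx : 0 ≤ x) (hxR : x ≤ R) (hε : 0 < ε) (hs : 0 < s) :
    x ≤ ε + R * ε ^ (-s) * x ^ s := by
  rcases le_total x ε with h | h
  · have : 0 ≤ R := hx.trans hxR
    have : 0 ≤ R * ε ^ (-s) * x ^ s := by positivity
    linarith
  · have h1 : 1 ≤ ε ^ (-s) * x ^ s := by
      rw [Real.rpow_neg hε.le, ← div_eq_inv_mul, one_le_div (by positivity)]
      exact Real.rpow_le_rpow hε.le h hs.le
    have : R * 1 ≤ R * (ε ^ (-s) * x ^ s) :=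
      mul_le_mul_of_nonneg_left h1 (hx.trans hxR)
    linarith

/-- The consistency error of a numerical flux in terms of powers of the jumps and of the tails of
the values. -/
lemma exists_norm_flux_sub_le {q : ℕ} (hq : 1 ≤ q) {P s : ℝ} (hP : 0 ≤ P) (hs : 0 < s) (L : ℝ)
    {R ε : ℝ} (hR : 1 ≤ R) (hε : 0 < ε) : ∃ A : ℝ, 0 ≤ A ∧
      ∀ (G : (Fin (2 * q) → Vec N) → Vec N) (f : Vec N → Vec N) (B B' : ℝ),
        (∀ w, ‖G w‖ ≤ B * (1 + ∑ j, ‖w j‖ ^ P)) → (∀ u, ‖f u‖ ≤ B' * (1 + ‖u‖ ^ P)) →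
        (∀ w : ℤ → Vec N, (∀ j ∈ Finset.Icc (1 - (q : ℤ)) q, ‖w j‖ ≤ R) →
          ‖G (fun j => w ((j : ℤ) - q + 1)) - f (w 0)‖ ≤
            L * ∑ j ∈ Finset.Icc (1 - (q : ℤ)) q, ‖w 0 - w j‖) →
        ∀ w : ℤ → Vec N, ‖G (fun j => w ((j : ℤ) - q + 1)) - f (w 0)‖ ≤
          ε + A * ∑ i ∈ Finset.Ico (1 - (q : ℤ)) q, ‖w (i + 1) - w i‖ ^ s +
          (|B| + |B'|) * (4 * q + 1) *
            ∑ j ∈ Finset.Icc (1 - (q : ℤ)) q, if R < ‖w j‖ then ‖w j‖ ^ P else 0 := by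
  have hq0 : (1 : ℝ) ≤ q := by exact_mod_cast hq
  set M : ℝ := |L| * (2 * q) with hM
  have hM0 : 0 ≤ M := by positivity
  -- There are at most 2q stencil differences, each bounded by at most 2q jumps, and each jump
  -- contributes ε'; the total |L|(2q)(2q)ε' must not exceed ε.
  set ε' : ℝ := ε / (M * (2 * q) + 1) with hε'
  have hε'0 : 0 < ε' := by positivity
  have hA0 : 0 ≤ M * ((2 * R) * ε' ^ (-s)) := by positivity
  refine ⟨M * ((2 * R) * ε' ^ (-s)), hA0, fun G f B B' hG hf hL w => ?_⟩
  set tl : Vec N → ℝ := fun ξ => if R < ‖ξ‖ then ‖ξ‖ ^ P else 0 with htl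
  have htl0 : ∀ ξ, 0 ≤ tl ξ := fun ξ => by simp only [htl]; split_ifs <;> positivity
  change _ ≤ _ + (|B| + |B'|) * (4 * q + 1) * ∑ j ∈ Finset.Icc (1 - (q : ℤ)) q, tl (w j)
  set tails := ∑ j ∈ Finset.Icc (1 - (q : ℤ)) q, tl (w j) with htails
  set jumps := ∑ i ∈ Finset.Ico (1 - (q : ℤ)) q, ‖w (i + 1) - w i‖ ^ s with hjumps
  have htails0 : 0 ≤ tails := Finset.sum_nonneg fun j _ => htl0 _
  have hjumps0 : 0 ≤ jumps := Finset.sum_nonneg fun j _ => Real.rpow_nonneg (norm_nonneg _) _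
  by_cases hw : ∀ j ∈ Finset.Icc (1 - (q : ℤ)) q, ‖w j‖ ≤ R
  · have h1 : ∑ i ∈ Finset.Ico (1 - (q : ℤ)) q, ‖w (i + 1) - w i‖ ≤
        (2 * q) * ε' + (2 * R) * ε' ^ (-s) * jumps := by
      calc _ ≤ ∑ i ∈ Finset.Ico (1 - (q : ℤ)) q,
            (ε' + (2 * R) * ε' ^ (-s) * ‖w (i + 1) - w i‖ ^ s) := by
            refine Finset.sum_le_sum fun i hi => le_add_mul_rpow (norm_nonneg _) ?_ hε'0 hs
            rw [Finset.mem_Ico] at hi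
            have h2 := hw (i + 1) (by rw [Finset.mem_Icc]; omega)
            have h3 := hw i (by rw [Finset.mem_Icc]; omega)
            linarith [norm_sub_le (w (i + 1)) (w i)]
        _ ≤ _ := by
            rw [Finset.sum_add_distrib, ← Finset.mul_sum, Finset.sum_const, nsmul_eq_mul]
            gcongr
            simp only [Int.card_Ico]
            have : ((q : ℤ) - (1 - (q : ℤ))).toNat ≤ 2 * q := by omega
            exact_mod_cast this
    have h2 : ∑ j ∈ Finset.Icc (1 - (q : ℤ)) q, ‖w 0 - w j‖ ≤
        (2 * q) * ∑ i ∈ Finset.Ico (1 - (q : ℤ)) q, ‖w (i + 1) - w i‖ := by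
      refine (Finset.sum_le_sum fun j hj => norm_sub_le_sum_stencil w hj hq).trans ?_
      rw [Finset.sum_const, nsmul_eq_mul]
      gcongr
      simp only [Int.card_Icc]
      have : ((q : ℤ) + 1 - (1 - (q : ℤ))).toNat ≤ 2 * q := by omega
      exact_mod_cast this
    have h3 : M * ((2 * q) * ε') ≤ ε := by
      rw [hε', ← mul_assoc, mul_div_assoc', div_le_iff₀ (by positivity)]
      nlinarith
    calc _ ≤ L * ∑ j ∈ Finset.Icc (1 - (q : ℤ)) q, ‖w 0 - w j‖ := hL w hw
      _ ≤ |L| * ∑ j ∈ Finset.Icc (1 - (q : ℤ)) q, ‖w 0 - w j‖ :=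
          mul_le_mul_of_nonneg_right (le_abs_self L) (Finset.sum_nonneg fun _ _ => norm_nonneg _)
      _ ≤ |L| * ((2 * q) * ((2 * q) * ε' + (2 * R) * ε' ^ (-s) * jumps)) := by
          gcongr
          exact h2.trans (by gcongr)
      _ = M * ((2 * q) * ε') + M * ((2 * R) * ε' ^ (-s)) * jumps := by rw [hM]; ring
      _ ≤ ε + M * ((2 * R) * ε' ^ (-s)) * jumps := by gcongr
      _ ≤ _ := by
          have := mul_nonneg (by positivity : 0 ≤ (|B| + |B'|) * (4 * (q : ℝ) + 1)) htails0
          linarith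
  · push Not at hw
    obtain ⟨j₀, hj₀, hj₀R⟩ := hw
    have hle : ∀ j ∈ Finset.Icc (1 - (q : ℤ)) q, tl (w j) ≤ tails := fun j hj =>
      Finset.single_le_sum (f := fun j => tl (w j)) (fun j _ => htl0 _) hj
    -- One entry exceeds R ≥ 1, so the tails are at least R^P ≥ 1. They dominate the constant 1 and
    -- the powers of all entries below R, and growth alone suffices.
    have hRP : R ^ P ≤ tails := by
      refine le_trans ?_ (hle j₀ hj₀)
      simp only [htl, if_pos hj₀R]
      exact Real.rpow_le_rpow (by linarith) hj₀R.le hP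
    have h1 : 1 ≤ tails := (Real.one_le_rpow hR hP).trans hRP
    have h2 : ∀ j ∈ Finset.Icc (1 - (q : ℤ)) q, ‖w j‖ ^ P ≤ 2 * tails := by
      intro j hj
      by_cases hj' : R < ‖w j‖
      · have := hle j hj
        simp only [htl, if_pos hj'] at this
        linarith
      · have := Real.rpow_le_rpow (norm_nonneg _) (not_lt.1 hj') hP
        linarith
    have h3 : ‖G fun j => w ((j : ℤ) - q + 1)‖ ≤ |B| * ((4 * q + 1) * tails) := by
      -- The sum of 2q powers, each at most twice the tails, together with the constant 1 gives the
      -- factor 4q + 1.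
      have h4 : ∑ j : Fin (2 * q), ‖w ((j : ℤ) - q + 1)‖ ^ P ≤ (2 * q) * (2 * tails) := by
        refine (Finset.sum_le_sum fun j _ => h2 _ ?_).trans (by simp)
        have := j.2
        rw [Finset.mem_Icc]; omega
      have h0 : 0 ≤ ∑ j : Fin (2 * q), ‖w ((j : ℤ) - q + 1)‖ ^ P :=
        Finset.sum_nonneg fun j _ => Real.rpow_nonneg (norm_nonneg _) _
      refine (hG _).trans ((mul_le_mul_of_nonneg_right (le_abs_self B) (by linarith)).trans ?_)
      exact mul_le_mul_of_nonneg_left (by linarith) (abs_nonneg B)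
    have h5 : ‖f (w 0)‖ ≤ |B'| * ((4 * q + 1) * tails) := by
      have h0 : 0 ≤ ‖w 0‖ ^ P := Real.rpow_nonneg (norm_nonneg _) _
      refine (hf _).trans ((mul_le_mul_of_nonneg_right (le_abs_self B') (by linarith)).trans ?_)
      refine mul_le_mul_of_nonneg_left ?_ (abs_nonneg B')
      have := h2 0 (by rw [Finset.mem_Icc]; omega)
      nlinarith
    have h6 := norm_sub_le (G fun j => w ((j : ℤ) - q + 1)) (f (w 0))
    have h7 := mul_nonneg hA0 hjumps0
    linarith

lemma ofReal_tail {P R : ℝ} (hP : 0 ≤ P) (ξ : Vec N) :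
    ENNReal.ofReal (if R < ‖ξ‖ then ‖ξ‖ ^ P else 0) = tail P R ξ := by
  rw [tail, indicator_apply]
  by_cases h : R < ‖ξ‖
  · rw [if_pos h, if_pos (by exact h), enorm_rpow_eq_ofReal hP]
  · rw [if_neg h, if_neg (by exact h), ENNReal.ofReal_zero]

lemma exists_enorm_flux_sub_le {q : ℕ} (hq : 1 ≤ q) {P s : ℝ} (hP : 0 ≤ P) (hs : 0 < s) (L : ℝ)
    {R ε : ℝ} (hR : 1 ≤ R) (hε : 0 < ε) : ∃ A : ℝ, 0 ≤ A ∧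
      ∀ (G : (Fin (2 * q) → Vec N) → Vec N) (f : Vec N → Vec N) (B B' : ℝ),
        (∀ w, ‖G w‖ ≤ B * (1 + ∑ j, ‖w j‖ ^ P)) → (∀ u, ‖f u‖ ≤ B' * (1 + ‖u‖ ^ P)) →
        (∀ w : ℤ → Vec N, (∀ j ∈ Finset.Icc (1 - (q : ℤ)) q, ‖w j‖ ≤ R) →
          ‖G (fun j => w ((j : ℤ) - q + 1)) - f (w 0)‖ ≤
            L * ∑ j ∈ Finset.Icc (1 - (q : ℤ)) q, ‖w 0 - w j‖) →
        ∀ w : ℤ → Vec N, ‖G (fun j => w ((j : ℤ) - q + 1)) - f (w 0)‖ₑ ≤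
          ENNReal.ofReal ε +
          ENNReal.ofReal A * ∑ i ∈ Finset.Ico (1 - (q : ℤ)) q, ‖w (i + 1) - w i‖ₑ ^ s +
          ENNReal.ofReal ((|B| + |B'|) * (4 * q + 1)) *
            ∑ j ∈ Finset.Icc (1 - (q : ℤ)) q, tail P R (w j) := by
  obtain ⟨A, hA0, hA⟩ := exists_norm_flux_sub_le (N := N) hq hP hs L hR hε
  refine ⟨A, hA0, fun G f B B' hG hf hL w => ?_⟩
  rw [← ofReal_norm]
  refine (ENNReal.ofReal_le_ofReal (hA G f B B' hG hf hL w)).trans ?_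
  have htl0 : ∀ j ∈ Finset.Icc (1 - (q : ℤ)) q,
    0 ≤ if R < ‖w j‖ then ‖w j‖ ^ P else 0 := fun j _ => by split_ifs <;> positivity
  rw [ENNReal.ofReal_add (by positivity) (mul_nonneg (by positivity) (Finset.sum_nonneg htl0)),
    ENNReal.ofReal_add hε.le (by positivity), ENNReal.ofReal_mul hA0,
    ENNReal.ofReal_mul (by positivity),
    ENNReal.ofReal_sum_of_nonneg (fun j _ => by positivity), ENNReal.ofReal_sum_of_nonneg htl0]
  simp only [ofReal_tail hP, enorm_rpow_eq_ofReal hs.le]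
  exact le_rfl

end Consistency

/-! ### The consistency error of the scheme -/

section Jumps

variable {d N : ℕ} {p : ℝ≥0∞} [Fact (1 ≤ p)] {D : Set (Vec d)} {a : Vec d} {Δ T T' s : ℝ} {q : ℕ}
  {F : Fin d → (Fin (2 * q) → Vec N) → Vec N} {S : ℝ → LpSpace d N p D → LpSpace d N p D}

/-- The cells of the mesh whose left neighbour in the direction `m` belongs to the mesh. -/
def innerMesh (D : Set (Vec d)) (a : Vec d) (Δ : ℝ) (m : Fin d) : Set (Fin d → ℤ) :=
  {i | i ∈ mesh D a Δ ∧ i - Pi.single m 1 ∈ mesh D a Δ}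

/-- The power `s` of the jump of the field in the direction `m` between neighbouring cells of the
mesh. -/
def jumpDensity (a : Vec d) (Δ : ℝ) (S : ℝ → LpSpace d N p D → LpSpace d N p D) (T' s : ℝ)
    (m : Fin d) (t : ℝ) (u : LpSpace d N p D) (y : Vec d) : ℝ≥0∞ :=
  (cellIdx a Δ ⁻¹' innerMesh D a Δ m).indicator
    (fun y => ‖field a Δ S T' t u y - field a Δ S T' t u (y - EuclideanSpace.single m Δ)‖ₑ ^ s) y

lemma measurable_jumpDensity (hp : p ≠ ∞) (hΔ : 0 < Δ) (h : IsNumericalEvolution T a Δ q F S)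
    (hT'0 : 0 ≤ T') (hT' : T' < T) (m : Fin d) :
    Measurable fun z : (ℝ × LpSpace d N p D) × Vec d =>
      jumpDensity a Δ S T' s m z.1.1 z.1.2 z.2 := by
  have h1 := measurable_field hp hΔ h hT'0 hT'
  have h3 : Measurable fun z : (ℝ × LpSpace d N p D) × Vec d =>
      (z.1, z.2 - EuclideanSpace.single m Δ) := by fun_prop
  have h2 := h1.comp h3
  simp only [Function.comp_def] at h2
  have hs : MeasurableSet (cellIdx a Δ ⁻¹' innerMesh D a Δ m) :=
    measurable_cellIdx a Δ MeasurableSet.of_discrete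
  have h4 := (((h1.sub h2).enorm).pow_const s).indicator (measurable_snd hs)
  refine (congrArg Measurable ?_).mp h4
  funext z
  rw [jumpDensity]
  by_cases hz : z.2 ∈ cellIdx a Δ ⁻¹' innerMesh D a Δ m
  · rw [indicator_of_mem (mem_preimage.2 hz), indicator_of_mem hz]
    rfl
  · rw [indicator_of_notMem (fun hz' => hz (mem_preimage.1 hz')), indicator_of_notMem hz]

/-- Each fibre of `cellIdx` has volume Δ^d. This identifies the weighted sums over cells in the weak
BV bound with integrals in space. -/
lemma lintegral_comp_cellIdx (hΔ : 0 < Δ) (g : (Fin d → ℤ) → ℝ≥0∞) :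
    ∫⁻ y, g (cellIdx a Δ y) = ENNReal.ofReal Δ ^ d * ∑' i, g i := by
  rw [← lintegral_map (Measurable.of_discrete (f := g)) (measurable_cellIdx a Δ),
    lintegral_countable', mul_comm, ← ENNReal.tsum_mul_right]
  refine tsum_congr fun i => ?_
  rw [Measure.map_apply (measurable_cellIdx a Δ) (measurableSet_singleton i),
    volume_cellIdx_fiber hΔ]

lemma jumpDensity_eq (hΔ : 0 < Δ) (m : Fin d) {t : ℝ} (ht : t ∈ Icc 0 T')
    (u : LpSpace d N p D) (y : Vec d) :
    jumpDensity a Δ S T' s m t u y = (innerMesh D a Δ m).indicator (fun i =>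
      ‖cellAvg a Δ (S t u) i - cellAvg a Δ (S t u) (i - Pi.single m 1)‖ₑ ^ s) (cellIdx a Δ y) := by
  rw [jumpDensity]
  by_cases hy : cellIdx a Δ y ∈ innerMesh D a Δ m
  · rw [indicator_of_mem (mem_preimage.2 hy), indicator_of_mem hy]
    simp only [field, cellIdx_sub_single hΔ, cellVal_of_mem ht u hy.1, cellVal_of_mem ht u hy.2]
  · rw [indicator_of_notMem (fun hy' => hy (mem_preimage.1 hy')), indicator_of_notMem hy]

lemma tsum_innerMesh_le (v : Vec d → Vec N) (m : Fin d) :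
    ∑' i : innerMesh D a Δ m, ‖cellAvg a Δ v i.1 - cellAvg a Δ v (i.1 - Pi.single m 1)‖ₑ ^ s ≤
      jumpSum D a Δ s v := by
  have h := Finset.single_le_sum_of_canonicallyOrdered (s := Finset.univ) (f := fun m : Fin d =>
    ∑' i : innerMesh D a Δ m, ‖cellAvg a Δ v i.1 - cellAvg a Δ v (i.1 - Pi.single m 1)‖ₑ ^ s)
    (Finset.mem_univ m)
  have e : jumpSum D a Δ s v = ∑ m, ∑' i : innerMesh D a Δ m,
    ‖cellAvg a Δ v i.1 - cellAvg a Δ v (i.1 - Pi.single m 1)‖ₑ ^ s := rfl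
  rw [e]
  exact h

lemma lintegral_jumpDensity_le (hΔ : 0 < Δ) (m : Fin d) {t : ℝ} (ht : t ∈ Icc 0 T')
    (u : LpSpace d N p D) :
    ∫⁻ y, jumpDensity a Δ S T' s m t u y ≤ ENNReal.ofReal Δ ^ d * jumpSum D a Δ s (S t u) := by
  simp only [jumpDensity_eq hΔ m ht]
  rw [lintegral_comp_cellIdx hΔ, ← tsum_subtype]
  exact mul_le_mul_right (tsum_innerMesh_le _ m) _

lemma measurable_jumpSum (hp : p ≠ ∞) :
    Measurable fun u : LpSpace d N p D => jumpSum D a Δ s u := by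
  unfold jumpSum
  refine Finset.measurable_fun_sum _ fun m _ => Measurable.ennreal_tsum fun i => ?_
  exact (((measurable_cellAvg hp i.2.1).sub (measurable_cellAvg hp i.2.2)).enorm).pow_const s

lemma lintegral_jumpDensity_prod_le (hp : p ≠ ∞) (hΔ : 0 < Δ)
    (h : IsNumericalEvolution T a Δ q F S) (hT'0 : 0 ≤ T') (hT' : T' < T) (m : Fin d)
    (μbar : Measure (LpSpace d N p D)) [IsProbabilityMeasure μbar] :
    ∫⁻ z, (∫⁻ y, jumpDensity a Δ S T' s m z.1 z.2 y) ∂((volume.restrict (Icc 0 T')).prod μbar) ≤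
      ENNReal.ofReal Δ ^ d *
        ∫⁻ t in Ico 0 T, ∫⁻ u, jumpSum D a Δ s u ∂(μbar.map (S t)) := by
  have hsub : Icc 0 T' ⊆ Ico 0 T := fun t ht => ⟨ht.1, ht.2.trans_lt hT'⟩
  rw [lintegral_prod _ (measurable_jumpDensity hp hΔ h hT'0 hT'
    m).lintegral_prod_right'.aemeasurable,
    ← lintegral_const_mul' _ _ (by finiteness)]
  refine le_trans ?_ (lintegral_mono_set hsub)
  refine setLIntegral_mono' measurableSet_Icc fun t ht => ?_
  rw [lintegral_map (measurable_jumpSum hp) (h.measurable t (hsub ht)),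
    ← lintegral_const_mul' _ _ (by finiteness)]
  exact lintegral_mono fun u => lintegral_jumpDensity_le hΔ m ht u

lemma lintegral_tail_field_le (hp : p ≠ ∞) (hDm : MeasurableSet D) (hDf : volume D ≠ ∞)
    (hΔ : 0 < Δ) (h : IsNumericalEvolution T a Δ q F S) (hT'0 : 0 ≤ T') (hT' : T' < T)
    {P R : ℝ} (hR : 0 ≤ R) {c : ℝ≥0} {ν : TimeCorrFamily d N} {μbar : Measure (LpSpace d N p D)}
    [IsProbabilityMeasure μbar] (hb : TimeDualBdd T P c (fun t => μbar.map (S t)) ν) :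
    ∫⁻ z, (∫⁻ y, tail P R (field a Δ S T' z.1 z.2 y)) ∂((volume.restrict (Icc 0 T')).prod μbar) ≤
      ∫⁻ w, tail P R (w.2 0) ∂(jointLaw D T ν 1) := by
  have hsub : Icc 0 T' ⊆ Ico 0 T := fun t ht => ⟨ht.1, ht.2.trans_lt hT'⟩
  have hm1 : Measurable fun w : (ℝ × (Fin 1 → Vec d)) × (Fin 1 → Vec N) => tail P R (w.2 0) :=
    (measurable_tail P R).comp (by fun_prop)
  rw [lintegral_prod _ (measurable_lintegral_field hp hΔ h hT'0 hT'
    (measurable_tail P R)).aemeasurable, lintegral_jointLaw hb.markov hm1]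
  refine le_trans ?_ (lintegral_mono_set hsub)
  refine lintegral_mono_ae ?_
  filter_upwards [ae_restrict_of_ae_restrict_of_subset hsub hb.slice,
    ae_restrict_mem measurableSet_Icc] with t ht htm
  have := ht.prob
  rw [lintegral_compProd_one hp hDf ht.markov ht.dual (measurable_tail P R),
    lintegral_map (measurable_lintegral_comp hp (measurable_tail P R)) (h.measurable t (hsub htm))]
  refine lintegral_mono fun u => lintegral_field_le hDm hΔ h hT' htm u ?_
  rw [tail, indicator_of_notMem]
  simpa using hR

/-- The one-dimensional estimate is applied to the values of the field along the line x + jΔe_m. The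
jump from index i to i + 1 appears as the density at x + (i+1)Δe_m, because the density compares
with the left neighbour. -/
lemma enorm_numFlux_sub_le (hΔ : 0 < Δ) {P R : ℝ} {f : Fin d → Vec N → Vec N} {ε A B : ℝ≥0∞}
    (hA : ∀ m, ∀ w : ℤ → Vec N, ‖F m (fun j => w ((j : ℤ) - q + 1)) - f m (w 0)‖ₑ ≤
      ε + A * ∑ i ∈ Finset.Ico (1 - (q : ℤ)) q, ‖w (i + 1) - w i‖ₑ ^ s +
      B * ∑ j ∈ Finset.Icc (1 - (q : ℤ)) q, tail P R (w j))
    (m : Fin d) (t : ℝ) (u : LpSpace d N p D) {x : Vec d}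
    (hx : ∀ j : ℤ, |j| ≤ q → cellIdx a Δ x + Pi.single m j ∈ mesh D a Δ) :
    ‖numFlux a Δ q F S T' m t u x - f m (field a Δ S T' t u x)‖ₑ ≤
      ε + A * ∑ i ∈ Finset.Ico (1 - (q : ℤ)) q,
        jumpDensity a Δ S T' s m t u (x + EuclideanSpace.single m (((i + 1 : ℤ) : ℝ) * Δ)) +
      B * ∑ j ∈ Finset.Icc (1 - (q : ℤ)) q,
        tail P R (field a Δ S T' t u (x + EuclideanSpace.single m ((j : ℝ) * Δ))) := by
  have h1 := hA m fun j => field a Δ S T' t u (x + EuclideanSpace.single m ((j : ℝ) * Δ))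
  have h0 : EuclideanSpace.single m (((0 : ℤ) : ℝ) * Δ) = (0 : Vec d) := by simp
  simp only [h0, add_zero] at h1
  have e : numFlux a Δ q F S T' m t u x = F m fun j : Fin (2 * q) =>
      field a Δ S T' t u (x + EuclideanSpace.single m ((((j : ℤ) - q + 1 : ℤ) : ℝ) * Δ)) := by
    simp only [numFlux, ← cellVal_add_single hΔ]
    rfl
  rw [e]
  refine h1.trans (le_of_eq ?_)
  congr 3
  refine Finset.sum_congr rfl fun i hi => ?_
  rw [Finset.mem_Ico] at hi
  rw [jumpDensity, indicator_of_mem]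
  · have e2 : x + EuclideanSpace.single m (((i + 1 : ℤ) : ℝ) * Δ) - EuclideanSpace.single m Δ =
        x + EuclideanSpace.single m ((i : ℝ) * Δ) := by
      ext j
      by_cases hj : j = m
      · subst hj; simp; ring
      · simp [hj]
    rw [e2]
  · rw [mem_preimage, innerMesh, mem_setOf_eq, cellIdx_add_single hΔ]
    refine ⟨hx _ (by rw [abs_le]; constructor <;> omega), ?_⟩
    rw [add_sub_assoc, ← Pi.single_sub, add_sub_cancel_right]
    exact hx _ (by rw [abs_le]; constructor <;> omega)

/-- Integrated over the whole space, all translates of the jump density, and likewise of the tail,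
have the same integral; the stencil only contributes the count 2q. -/
lemma lintegral_numFlux_sub_le (hp : p ≠ ∞) (hDm : MeasurableSet D) (hDf : volume D ≠ ∞)
    (hΔ : 0 < Δ) (h : IsNumericalEvolution T a Δ q F S) (hT'0 : 0 ≤ T') (hT' : T' < T)
    {P R : ℝ} (hR : 0 ≤ R) {c : ℝ≥0} {ν : TimeCorrFamily d N} {μbar : Measure (LpSpace d N p D)}
    [IsProbabilityMeasure μbar] (hb : TimeDualBdd T P c (fun t => μbar.map (S t)) ν)
    {f : Fin d → Vec N → Vec N} {ε A B : ℝ≥0∞} (hAt : A ≠ ∞) (hBt : B ≠ ∞)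
    (hA : ∀ m, ∀ w : ℤ → Vec N, ‖F m (fun j => w ((j : ℤ) - q + 1)) - f m (w 0)‖ₑ ≤
      ε + A * ∑ i ∈ Finset.Ico (1 - (q : ℤ)) q, ‖w (i + 1) - w i‖ₑ ^ s +
      B * ∑ j ∈ Finset.Icc (1 - (q : ℤ)) q, tail P R (w j))
    (m : Fin d) {K : Set (Vec d)} (hKm : MeasurableSet K)
    (hK : ∀ x ∈ K, ∀ j : ℤ, |j| ≤ q → cellIdx a Δ x + Pi.single m j ∈ mesh D a Δ) :
    ∫⁻ z, (∫⁻ y in K, ‖numFlux a Δ q F S T' m z.1 z.2 y - f m (field a Δ S T' z.1 z.2 y)‖ₑ)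
      ∂((volume.restrict (Icc 0 T')).prod μbar) ≤
      ε * volume K * ENNReal.ofReal T' +
      A * ((2 * q : ℕ) * (ENNReal.ofReal Δ ^ d *
        ∫⁻ t in Ico 0 T, ∫⁻ u, jumpSum D a Δ s u ∂(μbar.map (S t)))) +
      B * ((2 * q : ℕ) * ∫⁻ w, tail P R (w.2 0) ∂(jointLaw D T ν 1)) := by
  have hjm : ∀ z : ℝ × LpSpace d N p D, Measurable (jumpDensity a Δ S T' s m z.1 z.2) := fun z => by
    have := (measurable_jumpDensity (s := s) hp hΔ h hT'0 hT' m).comp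
      (measurable_prodMk_left (x := z) (β := Vec d))
    simpa only [Function.comp_def] using this
  have htm : ∀ z : ℝ × LpSpace d N p D,
      Measurable fun y => tail P R (field a Δ S T' z.1 z.2 y) := fun z => by
    have := ((measurable_tail P R).comp (measurable_field hp hΔ h hT'0 hT')).comp
      (measurable_prodMk_left (x := z) (β := Vec d))
    simpa only [Function.comp_def] using this
  have hc1 : (Finset.Ico (1 - (q : ℤ)) q).card ≤ 2 * q := by
    rw [Int.card_Ico]; omega
  have hc2 : (Finset.Icc (1 - (q : ℤ)) q).card ≤ 2 * q := by
    rw [Int.card_Icc]; omega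
  have key : ∀ z : ℝ × LpSpace d N p D,
      ∫⁻ y in K, ‖numFlux a Δ q F S T' m z.1 z.2 y - f m (field a Δ S T' z.1 z.2 y)‖ₑ ≤
      ε * volume K + A * ((2 * q : ℕ) * ∫⁻ y, jumpDensity a Δ S T' s m z.1 z.2 y) +
      B * ((2 * q : ℕ) * ∫⁻ y, tail P R (field a Δ S T' z.1 z.2 y)) := by
    intro z
    calc _ ≤ ∫⁻ x in K, (ε + A * ∑ i ∈ Finset.Ico (1 - (q : ℤ)) q,
          jumpDensity a Δ S T' s m z.1 z.2 (x + EuclideanSpace.single m (((i + 1 : ℤ) : ℝ) * Δ)) +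
          B * ∑ j ∈ Finset.Icc (1 - (q : ℤ)) q,
          tail P R (field a Δ S T' z.1 z.2 (x + EuclideanSpace.single m ((j : ℝ) * Δ)))) :=
          setLIntegral_mono' hKm fun x hx => enorm_numFlux_sub_le hΔ hA m z.1 z.2 (hK x hx)
      _ = ε * volume K + A * ∑ i ∈ Finset.Ico (1 - (q : ℤ)) q, (∫⁻ x in K,
          jumpDensity a Δ S T' s m z.1 z.2 (x + EuclideanSpace.single m (((i + 1 : ℤ) : ℝ) * Δ))) +
          B * ∑ j ∈ Finset.Icc (1 - (q : ℤ)) q, (∫⁻ x in K,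
          tail P R (field a Δ S T' z.1 z.2 (x + EuclideanSpace.single m ((j : ℝ) * Δ)))) := by
          have h1 : ∀ v : Vec d, Measurable fun x => jumpDensity a Δ S T' s m z.1 z.2 (x + v) :=
            fun v => (hjm z).comp (measurable_add_const v)
          have h2 : ∀ v : Vec d, Measurable fun x =>
              tail P R (field a Δ S T' z.1 z.2 (x + v)) :=
            fun v => (htm z).comp (measurable_add_const v)
          rw [lintegral_add_right _
            ((Finset.measurable_fun_sum _ fun j _ => h2 _).const_mul B),
            lintegral_add_left measurable_const, lintegral_const_mul' _ _ hAt,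
            lintegral_const_mul' _ _ hBt, lintegral_finsetSum _ fun j _ => h1 _,
            lintegral_finsetSum _ fun j _ => h2 _]
          simp
      _ ≤ ε * volume K + A * ∑ _i ∈ Finset.Ico (1 - (q : ℤ)) q,
          (∫⁻ y, jumpDensity a Δ S T' s m z.1 z.2 y) +
          B * ∑ _j ∈ Finset.Icc (1 - (q : ℤ)) q,
          (∫⁻ y, tail P R (field a Δ S T' z.1 z.2 y)) := by
          refine add_le_add (add_le_add le_rfl (mul_le_mul_right (Finset.sum_le_sum fun i _ => ?_) _))
            (mul_le_mul_right (Finset.sum_le_sum fun j _ => ?_) _)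
          · refine (setLIntegral_le_lintegral _ _).trans (le_of_eq ?_)
            exact lintegral_add_right_eq_self (fun x => jumpDensity a Δ S T' s m z.1 z.2 x) _
          · refine (setLIntegral_le_lintegral _ _).trans (le_of_eq ?_)
            exact lintegral_add_right_eq_self (fun x => tail P R (field a Δ S T' z.1 z.2 x)) _
      _ ≤ _ := by
          simp only [Finset.sum_const, nsmul_eq_mul]
          gcongr
  have hTm := measurable_lintegral_field hp hΔ h hT'0 hT' (measurable_tail (N := N) P R)
  refine (lintegral_mono key).trans ?_
  rw [lintegral_add_right _ ((hTm.const_mul _).const_mul _), lintegral_add_left measurable_const,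
    lintegral_const_mul' _ _ hAt, lintegral_const_mul' _ _ hBt,
    lintegral_const_mul' _ _ (ENNReal.natCast_ne_top _),
    lintegral_const_mul' _ _ (ENNReal.natCast_ne_top _), lintegral_const]
  have hQ : ((volume.restrict (Icc 0 T')).prod μbar) univ = ENNReal.ofReal T' := by
    rw [← univ_prod_univ, Measure.prod_prod]
    simp
  rw [hQ]
  gcongr
  · exact lintegral_jumpDensity_prod_le hp hΔ h hT'0 hT' m μbar
  · exact lintegral_tail_field_le hp hDm hDf hΔ h hT'0 hT' hR hb

end Jumps

/-! ### Passage to the limit in the flux terms -/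

lemma tendsto_of_enorm_sub_tendsto_zero {x y : ℕ → ℝ} {L : ℝ}
    (h : Tendsto (fun n => ‖x n - y n‖ₑ) atTop (𝓝 0)) (hy : Tendsto y atTop (𝓝 L)) :
    Tendsto x atTop (𝓝 L) := by
  have h1 : Tendsto (fun n => x n - y n) atTop (𝓝 0) := by
    rw [tendsto_iff_edist_tendsto_0]
    simpa [edist_eq_enorm_sub] using h
  simpa using h1.add hy

/-- Difference quotients of test functions converge uniformly. -/
lemma exists_forall_abs_diffQuot_sub_le {E : Type*} [NormedAddCommGroup E] [NormedSpace ℝ E]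
    {φ : E → ℝ} (hφ : ContDiff ℝ 1 φ) (hφc : HasCompactSupport φ) (v : E) {ε : ℝ} (hε : 0 < ε) :
    ∃ r > 0, ∀ h : ℝ, 0 < h → h < r → ∀ z,
      |h⁻¹ * (φ (z + h • v) - φ z) - fderiv ℝ φ z v| ≤ ε := by
  have huc : UniformContinuous (fderiv ℝ φ) :=
    (hφc.fderiv (𝕜 := ℝ)).uniformContinuous_of_continuous (hφ.continuous_fderiv (by norm_num))
  obtain ⟨r, hr, hr'⟩ := Metric.uniformContinuous_iff.1 huc (ε / (‖v‖ + 1)) (by positivity)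
  refine ⟨r / (‖v‖ + 1), by positivity, fun h hh hhr z => ?_⟩
  rw [lt_div_iff₀ (by positivity)] at hhr
  have hmem : z + h • v ∈ Metric.ball z r := by
    rw [mem_ball_iff_norm, add_sub_cancel_left, norm_smul, Real.norm_of_nonneg hh.le]
    nlinarith
  -- The mean value inequality, with the oscillation of the derivative over the ball as the
  -- constant.
  have h1 := (convex_ball z r).norm_image_sub_le_of_norm_fderiv_le' (𝕜 := ℝ) (f := φ)
    (φ := fderiv ℝ φ z) (C := ε / (‖v‖ + 1))
    (fun x _ => (hφ.differentiable (by norm_num)) x)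
    (fun x hx => by
      rw [← dist_eq_norm]
      exact (hr' (Metric.mem_ball.1 hx)).le) (Metric.mem_ball_self hr) hmem
  rw [add_sub_cancel_left, map_smul, smul_eq_mul, norm_smul, Real.norm_of_nonneg hh.le,
    Real.norm_eq_abs] at h1
  have e : h⁻¹ * (φ (z + h • v) - φ z) - fderiv ℝ φ z v =
      h⁻¹ * (φ (z + h • v) - φ z - h * fderiv ℝ φ z v) := by field_simp
  rw [e, abs_mul, abs_of_pos (inv_pos.2 hh)]
  calc h⁻¹ * |φ (z + h • v) - φ z - h * fderiv ℝ φ z v|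
      ≤ h⁻¹ * (ε / (‖v‖ + 1) * (h * ‖v‖)) := by gcongr
    _ = ε * (‖v‖ / (‖v‖ + 1)) := by field_simp
    _ ≤ ε * 1 := by
        gcongr
        rw [div_le_one (by positivity)]
        linarith
    _ = ε := mul_one ε

lemma shiftTest_eq {d k : ℕ} (Δ : ℝ) (φ : ℝ × (Fin k → Vec d) → ℝ) (l : Fin k) (m : Fin d)
    (z : ℝ × (Fin k → Vec d)) :
    shiftTest Δ φ l m z =
      φ (z + Δ • ((0, Pi.single l (EuclideanSpace.single m 1)) : ℝ × (Fin k → Vec d))) := by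
  have e : (Δ • Pi.single l (EuclideanSpace.single m 1) : Fin k → Vec d) =
      Pi.single l (EuclideanSpace.single m Δ) := by
    rw [← Pi.single_smul]
    congr 1
    ext j
    by_cases hj : j = m
    · subst hj; simp
    · simp [hj]
  rw [shiftTest]
  congr 1
  refine Prod.ext ?_ ?_
  · simp
  · rw [Prod.snd_add, Prod.smul_snd]
    simp only [e]

lemma mem_of_shiftTest_ne_zero {d k : ℕ} {Δ δ T' : ℝ} {K : Set (Vec d)} (hΔ : 0 < Δ)
    (hδ : Δ ≤ δ) {φ : ℝ × (Fin k → Vec d) → ℝ} (hsupp : tsupport φ ⊆ Iio T' ×ˢ domPow K k)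
    {l : Fin k} {m : Fin d} {z : ℝ × (Fin k → Vec d)} (hz : shiftTest Δ φ l m z ≠ 0) :
    z.1 < T' ∧ ∀ j, z.2 j ∈ Metric.cthickening δ K := by
  obtain ⟨h1, h2⟩ := hsupp (subset_tsupport _ hz)
  refine ⟨h1, fun j => Metric.mem_cthickening_of_dist_le _ _ _ _ (h2 j (mem_univ j)) ?_⟩
  simp only [Pi.add_apply]
  rw [dist_self_add_right]
  by_cases hj : j = l
  · subst hj
    rw [Pi.single_eq_same, EuclideanSpace.norm_single, Real.norm_of_nonneg hΔ.le]
    exact hδ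
  · rw [Pi.single_eq_of_ne hj, norm_zero]
    linarith

/-- The standing assumptions on a sequence of numerical schemes and the limit of the approximate
statistical solutions. -/
structure SchemeLimit {d N : ℕ} {p : ℝ≥0∞} [Fact (1 ≤ p)] {D : Set (Vec d)} (T P : ℝ) (c : ℝ≥0)
    (q : ℕ) (f : Fin d → Vec N → Vec N) (Δ : ℕ → ℝ) (a : ℕ → Vec d)
    (F : ℕ → Fin d → (Fin (2 * q) → Vec N) → Vec N)
    (S : ℕ → ℝ → LpSpace d N p D → LpSpace d N p D) (μbar : Measure (LpSpace d N p D))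
    (νn : ℕ → TimeCorrFamily d N) (μ : ℝ → Measure (LpSpace d N p D)) (ν : TimeCorrFamily d N)
    (s C : ℝ) : Prop where
  ne_top : p ≠ ∞
  isOpen : IsOpen D
  volume_ne_top : volume D ≠ ∞
  time_pos : 0 < T
  one_le : 1 ≤ P
  bounded_seq : ∀ n, TimeDualBdd T P c (fun t => μbar.map (S n t)) (νn n)
  bounded : TimeDualBdd T P c μ ν
  observables : ObservablesConverge D T P νn ν
  mesh_pos : ∀ n, 0 < Δ n
  mesh_tendsto : Tendsto Δ atTop (𝓝 0)
  one_le_stencil : 1 ≤ q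
  flux_continuous : ∀ n m, Continuous (F n m)
  flux_growth : ∀ n m w, ‖F n m w‖ ≤ C * (1 + ∑ j, ‖w j‖ ^ P)
  flux_consistent : ∀ R : ℝ, ∃ L : ℝ, ∀ n m, ∀ w : ℤ → Vec N,
    (∀ j ∈ Finset.Icc (1 - (q : ℤ)) q, ‖w j‖ ≤ R) →
      ‖F n m (fun j => w ((j : ℤ) - q + 1)) - f m (w 0)‖ ≤
        L * ∑ j ∈ Finset.Icc (1 - (q : ℤ)) q, ‖w 0 - w j‖
  growth : ∀ m u, ‖f m u‖ ≤ C * (1 + ‖u‖ ^ P)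
  moment : ∀ m i, IsMomentFn P C fun ξ => f m ξ i
  one_le_const : 1 ≤ C
  evolution : ∀ n, IsNumericalEvolution T (a n) (Δ n) q (F n) (S n)
  exponent_pos : 0 < s
  weakBV : ∀ n, ENNReal.ofReal (Δ n) ^ d *
    ∫⁻ t in Ico 0 T, ∫⁻ u, jumpSum D (a n) (Δ n) s u ∂(μbar.map (S n t)) ≤
      ENNReal.ofReal (C * Δ n)

section Limit

variable {d N : ℕ} {p : ℝ≥0∞} [Fact (1 ≤ p)] {D : Set (Vec d)} {T P : ℝ} {c : ℝ≥0} {q : ℕ}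
  {f : Fin d → Vec N → Vec N} {Δ : ℕ → ℝ} {a : ℕ → Vec d}
  {F : ℕ → Fin d → (Fin (2 * q) → Vec N) → Vec N}
  {S : ℕ → ℝ → LpSpace d N p D → LpSpace d N p D} {μbar : Measure (LpSpace d N p D)}
  [IsProbabilityMeasure μbar]
  {νn : ℕ → TimeCorrFamily d N} {μ : ℝ → Measure (LpSpace d N p D)} {ν : TimeCorrFamily d N}
  {s C T' : ℝ}

/-- The numerical fluxes converge to the fluxes of the numerical solutions in `L^1`. -/
theorem SchemeLimit.tendsto_consistency
    (h : SchemeLimit T P c q f Δ a F S μbar νn μ ν s C) (hT'0 : 0 ≤ T') (hT' : T' < T)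
    (m : Fin d) {K : Set (Vec d)} (hKm : MeasurableSet K) (hKf : volume K ≠ ∞)
    (hK : ∀ᶠ n in atTop, ∀ x ∈ K, ∀ j : ℤ, |j| ≤ q →
      cellIdx (a n) (Δ n) x + Pi.single m j ∈ mesh D (a n) (Δ n)) :
    Tendsto (fun n => ∫⁻ z, (∫⁻ y in K, ‖numFlux (a n) (Δ n) q (F n) (S n) T' m z.1 z.2 y -
      f m (field (a n) (Δ n) (S n) T' z.1 z.2 y)‖ₑ) ∂((volume.restrict (Icc 0 T')).prod μbar))
      atTop (𝓝 0) := by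
  have hP0 : 0 ≤ P := zero_le_one.trans h.one_le
  have hC0 : 0 ≤ C := zero_le_one.trans h.one_le_const
  rw [ENNReal.tendsto_nhds_zero]
  intro η hη
  obtain ⟨η', hη', hη'le⟩ : ∃ η' : ℝ, 0 < η' ∧ ENNReal.ofReal (3 * η') ≤ η := by
    by_cases ht : η = ∞
    · exact ⟨1, one_pos, by simp [ht]⟩
    · refine ⟨η.toReal / 3, div_pos (ENNReal.toReal_pos hη.ne' ht) three_pos, ?_⟩
      rw [mul_div_cancel₀ _ three_ne_zero, ENNReal.ofReal_toReal ht]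
  set B : ℝ := (|C| + |C|) * (4 * q + 1) with hB
  have hB0 : 0 ≤ B := by positivity
  -- The three errors are each made at most η'. The order of choice matters: the tail level R, then
  -- the consistency constant L on that ball, then ε and the jump coefficient A, which may be huge,
  -- and only then n, so that AΔ is small.
  set ε₁ : ℝ := η' / (B * (2 * q) + 1) with hε₁
  obtain ⟨R, hR, hRn, -⟩ := exists_tail_le h.ne_top h.volume_ne_top h.one_le h.bounded_seq h.bounded
    h.observables (ε := ε₁) (by positivity)
  obtain ⟨L, hL⟩ := h.flux_consistent R
  set vK : ℝ := (volume K).toReal with hvK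
  have hvK0 : 0 ≤ vK := ENNReal.toReal_nonneg
  set ε : ℝ := η' / (vK * T' + 1) with hε
  have hε0 : 0 < ε := by positivity
  obtain ⟨A, hA0, hA⟩ := exists_enorm_flux_sub_le (N := N) h.one_le_stencil hP0 h.exponent_pos L hR
    hε0
  have hΔs : ∀ᶠ n in atTop, A * (2 * q * (C * Δ n)) < η' := by
    have h1 : Tendsto (fun n => A * (2 * q * (C * Δ n))) atTop (𝓝 (A * (2 * q * (C * 0)))) :=
      ((h.mesh_tendsto.const_mul C).const_mul _).const_mul A
    rw [mul_zero, mul_zero, mul_zero] at h1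
    exact h1.eventually_lt_const hη'
  filter_upwards [hK, hRn, hΔs] with n hKn hRn hΔn
  have hb := lintegral_numFlux_sub_le h.ne_top h.isOpen.measurableSet h.volume_ne_top
    (h.mesh_pos n) (h.evolution n) hT'0 hT' (by linarith) (h.bounded_seq n) (f := f)
    ENNReal.ofReal_ne_top ENNReal.ofReal_ne_top
    (fun m w => hA (F n m) (f m) C C (h.flux_growth n m) (h.growth m) (hL n m) w) m hKm hKn
  refine hb.trans ?_
  have e1 : ENNReal.ofReal ε * volume K * ENNReal.ofReal T' ≤ ENNReal.ofReal η' := by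
    rw [← ENNReal.ofReal_toReal hKf, ← ENNReal.ofReal_mul hε0.le,
      ← ENNReal.ofReal_mul (by positivity)]
    refine ENNReal.ofReal_le_ofReal ?_
    rw [← hvK, hε, div_mul_eq_mul_div, div_mul_eq_mul_div, div_le_iff₀ (by positivity)]
    nlinarith
  have e2 : ENNReal.ofReal A * ((2 * q : ℕ) * (ENNReal.ofReal (Δ n) ^ d *
        ∫⁻ t in Ico 0 T, ∫⁻ u, jumpSum D (a n) (Δ n) s u ∂(μbar.map (S n t)))) ≤
      ENNReal.ofReal η' := by
    calc _ ≤ ENNReal.ofReal A * ((2 * q : ℕ) * ENNReal.ofReal (C * Δ n)) := by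
          gcongr
          exact h.weakBV n
      _ = ENNReal.ofReal (A * (2 * q * (C * Δ n))) := by
          rw [ENNReal.ofReal_mul hA0, ENNReal.ofReal_mul (by positivity : (0 : ℝ) ≤ 2 * q)]
          congr 2
          rw [← ENNReal.ofReal_natCast]
          push_cast
          rfl
      _ ≤ _ := ENNReal.ofReal_le_ofReal hΔn.le
  have e3 : ENNReal.ofReal B * ((2 * q : ℕ) *
      ∫⁻ w, tail P R (w.2 0) ∂(jointLaw D T (νn n) 1)) ≤ ENNReal.ofReal η' := by
    calc _ ≤ ENNReal.ofReal B * ((2 * q : ℕ) * ENNReal.ofReal ε₁) := by gcongr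
      _ = ENNReal.ofReal (B * (2 * q * ε₁)) := by
          rw [ENNReal.ofReal_mul hB0, ENNReal.ofReal_mul (by positivity : (0 : ℝ) ≤ 2 * q)]
          congr 2
          rw [← ENNReal.ofReal_natCast]
          push_cast
          rfl
      _ ≤ _ := by
          refine ENNReal.ofReal_le_ofReal ?_
          rw [hε₁, ← mul_assoc, mul_div_assoc', div_le_iff₀ (by positivity)]
          nlinarith
  refine (add_le_add (add_le_add e1 e2) e3).trans (le_trans (le_of_eq ?_) hη'le)
  rw [← ENNReal.ofReal_add hη'.le hη'.le, ← ENNReal.ofReal_add (by positivity) hη'.le]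
  congr 1
  ring

end Limit

/-- The effect of changing one factor and the test function in an integral of a product. -/
lemma enorm_integral_prod_sub_le {Z X : Type*} [MeasurableSpace Z] [MeasurableSpace X] {k : ℕ}
    (Q : Measure Z) [IsFiniteMeasure Q] (m : Measure X) [SigmaFinite m] {K : Set X}
    (hK : MeasurableSet K) {b b' : Fin k → Z × X → ℝ} (hb : ∀ j, Measurable (b j))
    (hb' : ∀ j, Measurable (b' j)) {l : Fin k} (hbb : ∀ j, j ≠ l → b j = b' j)
    {Ψ Ψ' : Z × (Fin k → X) → ℝ} (hΨ : Measurable Ψ) (hΨ' : Measurable Ψ') {B ε : ℝ}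
    (hB : ∀ w, |Ψ w| ≤ B) (hB' : ∀ w, |Ψ' w| ≤ B) (hε : ∀ w, |Ψ w - Ψ' w| ≤ ε)
    (hs : ∀ w, Ψ w ≠ 0 → ∀ j, w.2 j ∈ K) (hs' : ∀ w, Ψ' w ≠ 0 → ∀ j, w.2 j ∈ K)
    {C : ℝ≥0∞} (hC : C ≠ ∞) (hbC : ∀ j, ∀ᵐ z ∂Q, ∫⁻ y in K, ‖b j (z, y)‖ₑ ∂m ≤ C)
    (hbC' : ∀ j, ∀ᵐ z ∂Q, ∫⁻ y in K, ‖b' j (z, y)‖ₑ ∂m ≤ C) :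
    ‖(∫ w, (∏ j, b j (w.1, w.2 j)) * Ψ w ∂(Q.prod (Measure.pi fun _ => m))) -
      ∫ w, (∏ j, b' j (w.1, w.2 j)) * Ψ' w ∂(Q.prod (Measure.pi fun _ => m))‖ₑ ≤
    ENNReal.ofReal B * (C ^ (k - 1) * ∫⁻ z, ∫⁻ y in K, ‖b l (z, y) - b' l (z, y)‖ₑ ∂m ∂Q) +
      ENNReal.ofReal ε * (C ^ k * Q univ) := by
  classical
  -- The difference splits into one term with the changed factor in slot l and one term with the
  -- changed test function.
  set bD : Fin k → Z × X → ℝ := fun j z => if j = l then b j z - b' j z else b' j z with hbD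
  have hbDm : ∀ j, Measurable (bD j) := fun j => by
    by_cases hj : j = l
    · simp only [hbD, if_pos hj]; exact (hb j).sub (hb' j)
    · simp only [hbD, if_neg hj]; exact hb' j
  have hsplit : ∀ w : Z × (Fin k → X),
      (∏ j, b j (w.1, w.2 j)) * Ψ w - (∏ j, b' j (w.1, w.2 j)) * Ψ' w =
      (∏ j, bD j (w.1, w.2 j)) * Ψ w + (∏ j, b' j (w.1, w.2 j)) * (Ψ w - Ψ' w) := by
    intro w
    have e3 : ∀ g : Fin k → ℝ, (∀ j, j ≠ l → g j = b' j (w.1, w.2 j)) →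
        ∏ j, g j = g l * ∏ j ∈ Finset.univ.erase l, b' j (w.1, w.2 j) := by
      intro g hg
      rw [← Finset.mul_prod_erase Finset.univ _ (Finset.mem_univ l)]
      congr 1
      exact Finset.prod_congr rfl fun j hj => hg j (Finset.ne_of_mem_erase hj)
    rw [e3 (fun j => b j (w.1, w.2 j)) fun j hj => by rw [hbb j hj],
      e3 (fun j => bD j (w.1, w.2 j)) fun j hj => if_neg hj,
      e3 (fun j => b' j (w.1, w.2 j)) fun j hj => rfl]
    simp only [hbD, if_true]
    ring
  rw [← integral_sub (integrable_prod_mul Q m hK b hb hΨ hB hs hC hbC)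
    (integrable_prod_mul Q m hK b' hb' hΨ' hB' hs' hC hbC')]
  simp only [hsplit]
  have hm1 : Measurable fun w : Z × (Fin k → X) => (∏ j, bD j (w.1, w.2 j)) * Ψ w :=
    (Finset.measurable_fun_prod _ fun j _ => (hbDm j).comp (by fun_prop)).mul hΨ
  refine (enorm_integral_le_lintegral_enorm _).trans
    ((lintegral_mono fun w => enorm_add_le _ _).trans ?_)
  rw [lintegral_add_left hm1.enorm]
  refine add_le_add ?_ ?_
  · refine (lintegral_enorm_prod_mul_le_single Q m hK bD hbDm hB hs l (C := C) ?_).trans ?_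
    · filter_upwards [ae_all_iff.2 hbC'] with z hz j hj
      simp only [hbD, if_neg hj]
      exact hz j
    · simp only [hbD, if_true]
      exact le_rfl
  · refine (lintegral_enorm_prod_mul_le Q m hK b' hb' hε fun w hw j => ?_).trans ?_
    · by_cases h0 : Ψ w = 0
      · exact hs' w (fun h1 => hw (by simp only [h0, h1, sub_zero])) j
      · exact hs w h0 j
    · gcongr
      rw [← lintegral_const]
      refine lintegral_mono_ae ?_
      filter_upwards [ae_all_iff.2 hbC'] with z hz
      calc _ ≤ ∏ _j : Fin k, C := Finset.prod_le_prod' fun j _ => hz j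
        _ = _ := by simp

section Limit

variable {d N : ℕ} {p : ℝ≥0∞} [Fact (1 ≤ p)] {D : Set (Vec d)} {T P : ℝ} {c : ℝ≥0} {q : ℕ}
  {f : Fin d → Vec N → Vec N} {Δ : ℕ → ℝ} {a : ℕ → Vec d}
  {F : ℕ → Fin d → (Fin (2 * q) → Vec N) → Vec N}
  {S : ℕ → ℝ → LpSpace d N p D → LpSpace d N p D} {μbar : Measure (LpSpace d N p D)}
  [IsProbabilityMeasure μbar]
  {νn : ℕ → TimeCorrFamily d N} {μ : ℝ → Measure (LpSpace d N p D)} {ν : TimeCorrFamily d N}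
  {s C T' δ : ℝ} {k : ℕ} {K : Set (Vec d)}

lemma isMomentFn_coord {P C : ℝ} (hP : 1 ≤ P) (hC : 1 ≤ C) (i : Fin N) :
    IsMomentFn P C fun ξ : Vec N => ξ i := by
  refine ⟨by fun_prop, fun ξ => ?_, fun R => ⟨1, zero_le_one, fun ζ ξ _ _ => ?_⟩⟩
  · have h1 : |ξ i| ≤ ‖ξ‖ := PiLp.norm_apply_le ξ i
    have h2 : ‖ξ‖ ≤ 1 + ‖ξ‖ ^ P := by
      rcases le_total ‖ξ‖ 1 with h | h
      · have : 0 ≤ ‖ξ‖ ^ P := by positivity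
        linarith
      · have := Real.self_le_rpow_of_one_le h hP
        linarith
    have h3 : 0 ≤ 1 + ‖ξ‖ ^ P := by positivity
    nlinarith
  · rw [one_mul]
    exact PiLp.norm_apply_le (ζ - ξ) i

lemma SchemeLimit.eventually_mesh (h : SchemeLimit T P c q f Δ a F S μbar νn μ ν s C)
    (hδ : 0 < δ) : ∀ᶠ n in atTop, (d + q + 1) * Δ n ≤ δ / 2 := by
  have h1 : Tendsto (fun n => (d + q + 1) * Δ n) atTop (𝓝 ((d + q + 1) * 0)) :=
    h.mesh_tendsto.const_mul _
  rw [mul_zero] at h1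
  exact (h1.eventually_lt_const (half_pos hδ)).mono fun n hn => hn.le

/-- Moments of the numerical solutions converge to moments of the limit. -/
theorem SchemeLimit.tendsto_integral_field (h : SchemeLimit T P c q f Δ a F S μbar νn μ ν s C)
    (hT'0 : 0 ≤ T') (hT' : T' < T) (hδ : 0 < δ) (hK : Metric.cthickening δ K ⊆ D)
    {Φ : ℝ × (Fin k → Vec d) → ℝ} (hΦ : Continuous Φ) (hΦc : HasCompactSupport Φ)
    (hsupp : ∀ z, Φ z ≠ 0 → z.1 < T' ∧ ∀ j, z.2 j ∈ K) (H : Fin k → Vec N → ℝ)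
    (hH : ∀ j, IsMomentFn P C (H j)) :
    Tendsto (fun n => ∫ w, (∏ j, H j (field (a n) (Δ n) (S n) T' w.1.1 w.1.2 (w.2 j))) *
        Φ (w.1.1, w.2)
      ∂(((volume.restrict (Icc 0 T')).prod μbar).prod (volume : Measure (Fin k → Vec d)))) atTop
      (𝓝 (∫ w, Φ w.1 * ∏ j, H j (w.2 j) ∂(jointLaw D T ν k))) := by
  have hC0 : 0 ≤ C := zero_le_one.trans h.one_le_const
  obtain ⟨B, hB⟩ := hΦc.exists_bound_of_continuous hΦ
  refine (tendsto_integral_mul_prod h.ne_top h.isOpen.measurableSet h.volume_ne_top h.time_pos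
    h.one_le h.bounded_seq h.bounded h.observables hΦ hΦc hC0 H hH).congr' ?_
  filter_upwards [h.eventually_mesh hδ] with n hn
  refine (integral_field_eq h.ne_top h.isOpen.measurableSet h.volume_ne_top (h.mesh_pos n)
    (h.evolution n) hT'0 hT' h.one_le (h.bounded_seq n) H (fun j => (hH j).continuous.measurable)
    (fun j => (hH j).growth) hΦ.measurable hB fun z hz => ?_).symm
  obtain ⟨h1, h2⟩ := hsupp z hz
  refine ⟨h1.le, fun j => ⟨hK (Metric.self_subset_cthickening K (h2 j)), ?_⟩⟩
  refine cellIdx_mem_mesh hδ.le hK (h.mesh_pos n) (le_trans ?_ hn)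
    (Metric.self_subset_cthickening K (h2 j))
  have := h.mesh_pos n
  have : (0 : ℝ) ≤ (q + 1) * Δ n := by positivity
  linarith

/-- The flux terms of the weak form converge. -/
theorem SchemeLimit.tendsto_flux_term (h : SchemeLimit T P c q f Δ a F S μbar νn μ ν s C)
    (hT'0 : 0 ≤ T') (hT' : T' < T) (hδ : 0 < δ) (hK : Metric.cthickening δ K ⊆ D)
    {φ : ℝ × (Fin k → Vec d) → ℝ} (hφ : ContDiff ℝ 1 φ) (hφc : HasCompactSupport φ)
    (hsupp : tsupport φ ⊆ Iio T' ×ˢ domPow K k) (I : Fin k → Fin N) (l : Fin k) (m : Fin d) :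
    Tendsto (fun n => ∫ w, (∏ j, if j = l
          then numFlux (a n) (Δ n) q (F n) (S n) T' m w.1.1 w.1.2 (w.2 j) (I j)
          else field (a n) (Δ n) (S n) T' w.1.1 w.1.2 (w.2 j) (I j)) *
        ((Δ n)⁻¹ * (shiftTest (Δ n) φ l m (w.1.1, w.2) - φ (w.1.1, w.2)))
      ∂(((volume.restrict (Icc 0 T')).prod μbar).prod (volume : Measure (Fin k → Vec d)))) atTop
      (𝓝 (∫ w, fderiv ℝ φ w.1 (0, Pi.single l (EuclideanSpace.single m 1)) *
        ∏ j, (if j = l then f m (w.2 j) (I j) else w.2 j (I j)) ∂(jointLaw D T ν k))) := by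
  set Q := (volume.restrict (Icc 0 T')).prod μbar with hQ
  have hC0 : 0 ≤ C := zero_le_one.trans h.one_le_const
  have hDm := h.isOpen.measurableSet
  have hDf := h.volume_ne_top
  set v : ℝ × (Fin k → Vec d) := (0, Pi.single l (EuclideanSpace.single m 1)) with hv
  set Ψ : ℝ × (Fin k → Vec d) → ℝ := fun z => fderiv ℝ φ z v with hΨ
  set Ψn : ℕ → ℝ × (Fin k → Vec d) → ℝ := fun n z =>
    (Δ n)⁻¹ * (shiftTest (Δ n) φ l m z - φ z) with hΨn
  set H : Fin k → Vec N → ℝ := fun j ξ => if j = l then f m ξ (I j) else ξ (I j) with hH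
  have hHm : ∀ j, IsMomentFn P C (H j) := by
    intro j
    by_cases hj : j = l
    · simp only [hH, if_pos hj]
      exact h.moment m (I j)
    · simp only [hH, if_neg hj]
      exact isMomentFn_coord h.one_le h.one_le_const (I j)
  have hΨc : Continuous Ψ := (hφ.continuous_fderiv (by norm_num)).clm_apply continuous_const
  have hΨs : HasCompactSupport Ψ :=
    (hφc.fderiv (𝕜 := ℝ)).comp_left (g := fun L : (ℝ × (Fin k → Vec d)) →L[ℝ] ℝ => L v) rfl
  obtain ⟨B, hB⟩ := hΨs.exists_bound_of_continuous hΨc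
  have hsuppφ : ∀ z, φ z ≠ 0 → z.1 < T' ∧ ∀ j, z.2 j ∈ K := fun z hz =>
    ⟨(hsupp (subset_tsupport _ hz)).1, fun j => (hsupp (subset_tsupport _ hz)).2 j (mem_univ j)⟩
  have hsuppΨ : ∀ z, Ψ z ≠ 0 → z.1 < T' ∧ ∀ j, z.2 j ∈ K := fun z hz => by
    have h1 : z ∈ tsupport φ := by
      refine tsupport_fderiv_subset ℝ (subset_tsupport _ fun h0 => hz ?_)
      simp only [hΨ, h0]
      rfl
    exact ⟨(hsupp h1).1, fun j => (hsupp h1).2 j (mem_univ j)⟩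
  -- The difference quotient of φ may be nonzero slightly outside the support of φ; for small Δ it
  -- lives on this enlarged set.
  set K₁ := Metric.cthickening (δ / 2) K with hK₁
  have hK₁m : MeasurableSet K₁ := Metric.isClosed_cthickening.measurableSet
  have hKK₁ : K ⊆ K₁ := Metric.self_subset_cthickening K
  have hK₁D : K₁ ⊆ D := (Metric.cthickening_mono (by linarith) K).trans hK
  have hK₁f : volume K₁ ≠ ∞ := ((measure_mono hK₁D).trans_lt hDf.lt_top).ne
  -- the uniform distance of the difference quotients to the derivative
  set e : ℕ → ℝ≥0∞ := fun n => ⨆ z, ‖Ψn n z - Ψ z‖ₑ with he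
  have he0 : Tendsto e atTop (𝓝 0) := by
    have h1 : ∀ ε : ℝ, 0 < ε → ∀ᶠ n in atTop, e n ≤ ENNReal.ofReal ε := by
      intro ε hε
      obtain ⟨r, hr, hr'⟩ := exists_forall_abs_diffQuot_sub_le hφ hφc v hε
      filter_upwards [h.mesh_tendsto.eventually_lt_const hr] with n hn
      refine iSup_le fun z => ?_
      rw [Real.enorm_eq_ofReal_abs]
      refine ENNReal.ofReal_le_ofReal ?_
      simp only [hΨn, hΨ, shiftTest_eq]
      exact hr' (Δ n) (h.mesh_pos n) hn z
    rw [ENNReal.tendsto_nhds_zero]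
    intro η hη
    by_cases ht : η = ∞
    · simp [ht]
    · filter_upwards [h1 η.toReal (ENNReal.toReal_pos hη.ne' ht)] with n hn
      rwa [ENNReal.ofReal_toReal ht] at hn
  set E : ℕ → ℝ≥0∞ := fun n => ∫⁻ z, (∫⁻ y in K₁,
    ‖numFlux (a n) (Δ n) q (F n) (S n) T' m z.1 z.2 y -
      f m (field (a n) (Δ n) (S n) T' z.1 z.2 y)‖ₑ) ∂Q with hE
  have hE0 : Tendsto E atTop (𝓝 0) := by
    refine h.tendsto_consistency hT'0 hT' m hK₁m hK₁f ?_
    filter_upwards [h.eventually_mesh hδ] with n hn x hx j hj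
    have := h.mesh_pos n
    exact mem_mesh_of_mem_cthickening hδ.le hK (h.mesh_pos n) (by linarith) hx m hj
  set Cb : ℝ≥0∞ := fluxBound D q C c + ENNReal.ofReal C * (volume D + c) with hCb
  have hCbt : Cb ≠ ∞ := by
    rw [hCb, fluxBound]
    finiteness
  -- Comparison with the integral in which W is replaced by f(V) and the difference quotient by the
  -- derivative; the limit of the latter is already known.
  refine tendsto_of_enorm_sub_tendsto_zero ?_
    (h.tendsto_integral_field hT'0 hT' hδ hK hΨc hΨs hsuppΨ H hHm)
  have hlim : Tendsto (fun n => ENNReal.ofReal (B + 1) * (Cb ^ (k - 1) * E n) +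
      e n * (Cb ^ k * Q univ)) atTop (𝓝 0) := by
    have h1 : Tendsto (fun n => ENNReal.ofReal (B + 1) * (Cb ^ (k - 1) * E n)) atTop
        (𝓝 (ENNReal.ofReal (B + 1) * (Cb ^ (k - 1) * 0))) :=
      ENNReal.Tendsto.const_mul (ENNReal.Tendsto.const_mul hE0 (Or.inr (by finiteness)))
        (Or.inr (by finiteness))
    have h2 : Tendsto (fun n => e n * (Cb ^ k * Q univ)) atTop (𝓝 (0 * (Cb ^ k * Q univ))) :=
      ENNReal.Tendsto.mul_const he0 (Or.inr (by finiteness))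
    simpa using h1.add h2
  refine tendsto_of_tendsto_of_tendsto_of_le_of_le' tendsto_const_nhds hlim
    (Eventually.of_forall fun n => zero_le) ?_
  filter_upwards [h.eventually_mesh hδ, he0.eventually_le_const (zero_lt_one)] with n hn hen
  have hΔn := h.mesh_pos n
  have hsd := semiDiscrete_scheme h.ne_top hDm hΔn (h.evolution n) hT'0 hT' (h.flux_continuous n)
    h.one_le (h.flux_growth n) ((h.bounded_seq n).ae_lintegral_le (h.evolution n).measurable)
    hδ.le hK (by linarith)
  set V := field (a n) (Δ n) (S n) T' with hV
  set W := numFlux (a n) (Δ n) q (F n) (S n) T' with hW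
  have hent : e n ≠ ∞ := (hen.trans_lt ENNReal.one_lt_top).ne
  have hdiff : ∀ z, |Ψn n z - Ψ z| ≤ (e n).toReal := fun z => by
    have h1 : ‖Ψn n z - Ψ z‖ₑ ≤ e n := le_iSup (fun z => ‖Ψn n z - Ψ z‖ₑ) z
    rw [Real.enorm_eq_ofReal_abs] at h1
    exact (ENNReal.ofReal_le_iff_le_toReal hent).1 h1
  have hen1 : (e n).toReal ≤ 1 := by
    have := ENNReal.toReal_mono ENNReal.one_ne_top hen
    simpa using this
  have hΨnB : ∀ z, |Ψn n z| ≤ B + 1 := fun z => by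
    have h1 := hdiff z
    have h2 : |Ψ z| ≤ B := hB z
    have h3 : |Ψn n z| ≤ |Ψn n z - Ψ z| + |Ψ z| := by
      simpa using abs_add_le (Ψn n z - Ψ z) (Ψ z)
    linarith
  have hsuppΨn : ∀ z, Ψn n z ≠ 0 → ∀ j, z.2 j ∈ K₁ := by
    intro z hz j
    by_cases hs0 : shiftTest (Δ n) φ l m z = 0
    · refine hKK₁ ((hsuppφ z fun hφ0 => hz ?_).2 j)
      simp [hΨn, hs0, hφ0]
    · have : Δ n ≤ δ / 2 := by
        have : (0 : ℝ) ≤ (d + q) * Δ n := by positivity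
        linarith
      exact (mem_of_shiftTest_ne_zero hΔn this hsupp hs0).2 j
  have hΨnm : Measurable fun w : (ℝ × LpSpace d N p D) × (Fin k → Vec d) =>
      Ψn n (w.1.1, w.2) := by
    have h1 : Continuous (Ψn n) := by
      have h2 : Continuous fun z => φ (z + Δ n • v) := hφ.continuous.comp (by fun_prop)
      simp only [hΨn, shiftTest_eq]
      exact continuous_const.mul (h2.sub hφ.continuous)
    exact h1.measurable.comp (by fun_prop)
  have hΨm : Measurable fun w : (ℝ × LpSpace d N p D) × (Fin k → Vec d) => Ψ (w.1.1, w.2) :=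
    hΨc.measurable.comp (by fun_prop)
  -- measurability and bounds for the factors
  have hVm : ∀ j : Fin k, Measurable fun z : (ℝ × LpSpace d N p D) × Vec d =>
      V z.1.1 z.1.2 z.2 (I j) := fun j => measurable_coord hsd.measurable_field _
  have hWm : ∀ j : Fin k, Measurable fun z : (ℝ × LpSpace d N p D) × Vec d =>
      W m z.1.1 z.1.2 z.2 (I j) := fun j => measurable_coord (hsd.measurable_flux m) _
  have hHVm : ∀ j : Fin k, Measurable fun z : (ℝ × LpSpace d N p D) × Vec d =>
      H j (V z.1.1 z.1.2 z.2) := fun j =>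
    measurable_comp_field h.ne_top hΔn (h.evolution n) hT'0 hT' (hHm j).continuous.measurable
  have hle1 : fluxBound D q C c ≤ Cb := le_self_add
  have hle2 : ENNReal.ofReal C * (volume D + c) ≤ Cb := le_add_self
  have hVb : ∀ j : Fin k, ∀ᵐ z ∂Q, ∫⁻ y in D, ‖V z.1 z.2 y (I j)‖ₑ ≤ Cb := fun j => by
    filter_upwards [hsd.bound_field] with z hz
    exact (lintegral_mono fun y => enorm_apply_le _ _).trans (hz.trans hle1)
  have hWb : ∀ j : Fin k, ∀ᵐ z ∂Q, ∫⁻ y in D, ‖W m z.1 z.2 y (I j)‖ₑ ≤ Cb := fun j => by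
    filter_upwards [hsd.bound_flux m] with z hz
    exact (lintegral_mono fun y => enorm_apply_le _ _).trans (hz.trans hle1)
  have hHVb : ∀ j : Fin k, ∀ᵐ z ∂Q, ∫⁻ y in D, ‖H j (V z.1 z.2 y)‖ₑ ≤ Cb := fun j => by
    filter_upwards [ae_lintegral_comp_field_le h.ne_top hDm hΔn (h.evolution n) hT'0 hT' h.one_le
      (h.bounded_seq n) (hHm j).growth] with z hz
    exact hz.trans hle2
  set bW : Fin k → (ℝ × LpSpace d N p D) × Vec d → ℝ := fun j z =>
    if j = l then W m z.1.1 z.1.2 z.2 (I j) else V z.1.1 z.1.2 z.2 (I j) with hbW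
  have hbWm : ∀ j, Measurable (bW j) := fun j => by
    by_cases hj : j = l
    · simp only [hbW, if_pos hj]; exact hWm j
    · simp only [hbW, if_neg hj]; exact hVm j
  have hbWb : ∀ j, ∀ᵐ z ∂Q, ∫⁻ y in D, ‖bW j (z, y)‖ₑ ≤ Cb := fun j => by
    by_cases hj : j = l
    · simp only [hbW, if_pos hj]; exact hWb j
    · simp only [hbW, if_neg hj]; exact hVb j
  have hΨB : ∀ z, |Ψ z| ≤ B + 1 := fun z => by
    have h2 : |Ψ z| ≤ B := hB z
    linarith
  have hbb : ∀ j, j ≠ l → bW j = fun z => H j (V z.1.1 z.1.2 z.2) := fun j hj => by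
    simp only [hbW, hH, if_neg hj]
  have hbWb' : ∀ j, ∀ᵐ z ∂Q, ∫⁻ y in K₁, ‖bW j (z, y)‖ₑ ≤ Cb := fun j => by
    filter_upwards [hbWb j] with z hz
    exact (lintegral_mono_set hK₁D).trans hz
  have hHVb' : ∀ j : Fin k, ∀ᵐ z ∂Q, ∫⁻ y in K₁, ‖H j (V z.1 z.2 y)‖ₑ ≤ Cb := fun j => by
    filter_upwards [hHVb j] with z hz
    exact (lintegral_mono_set hK₁D).trans hz
  have key := enorm_integral_prod_sub_le Q (volume : Measure (Vec d)) hK₁m (b := bW)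
    (b' := fun j z => H j (V z.1.1 z.1.2 z.2)) hbWm hHVm (l := l) hbb
    (Ψ := fun w => Ψn n (w.1.1, w.2)) (Ψ' := fun w => Ψ (w.1.1, w.2)) hΨnm hΨm
    (B := B + 1) (ε := (e n).toReal) (fun w => hΨnB (w.1.1, w.2)) (fun w => hΨB (w.1.1, w.2))
    (fun w => hdiff (w.1.1, w.2)) (fun w hw => hsuppΨn (w.1.1, w.2) hw)
    (fun w hw j => hKK₁ ((hsuppΨ (w.1.1, w.2) hw).2 j)) hCbt hbWb' hHVb'
  refine key.trans ?_
  rw [ENNReal.ofReal_toReal hent]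
  refine add_le_add (mul_le_mul_right (mul_le_mul_right
    (lintegral_mono fun z => lintegral_mono fun y => ?_) _) _) le_rfl
  simp only [hbW, if_true, hH]
  exact enorm_apply_le (W m z.1 z.2 y - f m (V z.1 z.2 y)) (I l)

end Limit

/-! ### The initial data -/

/-- Adding ∏|b_j| on the left gives a right side that is a full product and factorises upon
integration. When the one-slot errors vanish it tends to the added term, so the difference of the
products tends to 0. -/
lemma enorm_prod_sub_prod_add_le {ι : Type*} (s : Finset ι) (a b : ι → ℝ) :
    ‖∏ j ∈ s, a j - ∏ j ∈ s, b j‖ₑ + ∏ j ∈ s, ‖b j‖ₑ ≤ ∏ j ∈ s, (‖b j‖ₑ + ‖a j - b j‖ₑ) := by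
  classical
  induction s using Finset.induction_on with
  | empty => simp
  | insert i s hi ih =>
    rw [Finset.prod_insert hi, Finset.prod_insert hi, Finset.prod_insert hi, Finset.prod_insert hi]
    set A := ∏ j ∈ s, a j
    set B := ∏ j ∈ s, b j
    have hB : ∏ j ∈ s, ‖b j‖ₑ = ‖B‖ₑ := (enorm_prod_real s b).symm
    rw [hB] at ih ⊢
    have hA : ‖A‖ₑ ≤ ‖A - B‖ₑ + ‖B‖ₑ := by simpa using enorm_add_le (A - B) B
    have e : a i * A - b i * B = (a i - b i) * A + b i * (A - B) := by ring
    calc _ ≤ ‖a i - b i‖ₑ * ‖A‖ₑ + ‖b i‖ₑ * ‖A - B‖ₑ + ‖b i‖ₑ * ‖B‖ₑ := by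
          rw [e]
          gcongr
          refine (enorm_add_le _ _).trans (le_of_eq ?_)
          rw [enorm_mul, enorm_mul]
      _ = ‖a i - b i‖ₑ * ‖A‖ₑ + ‖b i‖ₑ * (‖A - B‖ₑ + ‖B‖ₑ) := by ring
      _ ≤ ‖a i - b i‖ₑ * ∏ j ∈ s, (‖b j‖ₑ + ‖a j - b j‖ₑ) +
          ‖b i‖ₑ * ∏ j ∈ s, (‖b j‖ₑ + ‖a j - b j‖ₑ) := by
          gcongr
          exact hA.trans ih
      _ = _ := by ring

/-! ### Limits of products whose factors converge in L^1 -/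

section ProductLimit

variable {Z X : Type*} [MeasurableSpace Z] [MeasurableSpace X] {k : ℕ}

lemma lintegral_prod_sub_prod_add_le (m : Measure X) [SigmaFinite m] {a b : Fin k → X → ℝ}
    (ha : ∀ j, Measurable (a j)) (hb : ∀ j, Measurable (b j)) :
    ∫⁻ x, ‖∏ j, a j (x j) - ∏ j, b j (x j)‖ₑ ∂(Measure.pi fun _ : Fin k => m) +
      ∏ j, ∫⁻ y, ‖b j y‖ₑ ∂m ≤ ∏ j, (∫⁻ y, ‖b j y‖ₑ ∂m + ∫⁻ y, ‖a j y - b j y‖ₑ ∂m) := by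
  have h1 : ∀ j, ∫⁻ y, ‖b j y‖ₑ ∂m + ∫⁻ y, ‖a j y - b j y‖ₑ ∂m =
      ∫⁻ y, (‖b j y‖ₑ + ‖a j y - b j y‖ₑ) ∂m := fun j =>
    (lintegral_add_left (hb j).enorm _).symm
  have hm : Measurable fun x : Fin k → X => ∏ j, ‖b j (x j)‖ₑ :=
    Finset.measurable_fun_prod _ fun j _ => ((hb j).comp (measurable_pi_apply j)).enorm
  simp only [h1]
  rw [← lintegral_pi_prod m (fun j y => ‖b j y‖ₑ) fun j => (hb j).enorm,
    ← lintegral_pi_prod m (fun j y => ‖b j y‖ₑ + ‖a j y - b j y‖ₑ) fun j =>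
      (hb j).enorm.add ((ha j).sub (hb j)).enorm, ← lintegral_add_right _ hm]
  exact lintegral_mono fun x => enorm_prod_sub_prod_add_le Finset.univ (fun j => a j (x j))
    fun j => b j (x j)

/-- Convergence of integrals of products of factors that converge in `L^1`. -/
lemma tendsto_integral_prod_mul (Q : Measure Z) [IsFiniteMeasure Q] (m : Measure X)
    [SigmaFinite m] {K : Set X} (hK : MeasurableSet K) {bn : ℕ → Fin k → Z × X → ℝ}
    {b : Fin k → Z × X → ℝ} (hbn : ∀ n j, Measurable (bn n j)) (hb : ∀ j, Measurable (b j))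
    {Φ : Z × (Fin k → X) → ℝ} (hΦ : Measurable Φ) {B : ℝ} (hB : ∀ w, |Φ w| ≤ B)
    (hs : ∀ w, Φ w ≠ 0 → ∀ j, w.2 j ∈ K) {C : ℝ≥0∞} (hC : C ≠ ∞)
    (hbnC : ∀ᶠ n in atTop, ∀ j, ∀ᵐ z ∂Q, ∫⁻ y in K, ‖bn n j (z, y)‖ₑ ∂m ≤ C)
    (hbC : ∀ j, ∀ᵐ z ∂Q, ∫⁻ y in K, ‖b j (z, y)‖ₑ ∂m ≤ C)
    (hlim : ∀ j, ∀ᵐ z ∂Q,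
      Tendsto (fun n => ∫⁻ y in K, ‖bn n j (z, y) - b j (z, y)‖ₑ ∂m) atTop (𝓝 0)) :
    Tendsto (fun n => ∫ w, (∏ j, bn n j (w.1, w.2 j)) * Φ w ∂(Q.prod (Measure.pi fun _ => m)))
      atTop (𝓝 (∫ w, (∏ j, b j (w.1, w.2 j)) * Φ w ∂(Q.prod (Measure.pi fun _ => m)))) := by
  have hsl : ∀ (g : Z × X → ℝ), Measurable g → ∀ z, Measurable fun y => g (z, y) :=
    fun g hg z => hg.comp measurable_prodMk_left
  set J : ℕ → Z → ℝ≥0∞ := fun n z => ∫⁻ x, ‖∏ j, bn n j (z, x j) - ∏ j, b j (z, x j)‖ₑ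
    ∂(Measure.pi fun _ : Fin k => m.restrict K) with hJ
  have hJm : ∀ n, Measurable (J n) := by
    intro n
    have h1 : Measurable fun w : Z × (Fin k → X) =>
        ‖∏ j, bn n j (w.1, w.2 j) - ∏ j, b j (w.1, w.2 j)‖ₑ :=
      ((Finset.measurable_fun_prod _ fun j _ => (hbn n j).comp (by fun_prop)).sub
        (Finset.measurable_fun_prod _ fun j _ => (hb j).comp (by fun_prop))).enorm
    exact h1.lintegral_prod_right'
  have hJle : ∀ n z, J n z + ∏ j, ∫⁻ y in K, ‖b j (z, y)‖ₑ ∂m ≤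
      ∏ j, (∫⁻ y in K, ‖b j (z, y)‖ₑ ∂m + ∫⁻ y in K, ‖bn n j (z, y) - b j (z, y)‖ₑ ∂m) :=
    fun n z => lintegral_prod_sub_prod_add_le (m.restrict K) (fun j => hsl _ (hbn n j) z)
      fun j => hsl _ (hb j) z
  have hJ0 : Tendsto (fun n => ∫⁻ z, J n z ∂Q) atTop (𝓝 0) := by
    rw [← lintegral_zero (μ := Q)]
    refine tendsto_lintegral_filter_of_dominated_convergence (fun _ => (C + (C + C)) ^ k)
      (Eventually.of_forall hJm) ?_ ?_ ?_
    · filter_upwards [hbnC] with n hn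
      filter_upwards [ae_all_iff.2 hn, ae_all_iff.2 hbC] with z h1 h2
      refine (le_self_add.trans (hJle n z)).trans ?_
      calc _ ≤ ∏ _j : Fin k, (C + (C + C)) := by
            refine Finset.prod_le_prod' fun j _ => add_le_add (h2 j) ?_
            refine (lintegral_mono fun y => enorm_sub_le).trans ?_
            rw [lintegral_add_left (hsl _ (hbn n j) z).enorm]
            exact add_le_add (h1 j) (h2 j)
        _ = _ := by simp
    · rw [lintegral_const]
      finiteness
    · filter_upwards [ae_all_iff.2 hbC, ae_all_iff.2 hlim] with z h1 h2
      set β : ℝ≥0∞ := ∏ j, ∫⁻ y in K, ‖b j (z, y)‖ₑ ∂m with hβ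
      have hβt : β ≠ ∞ := by
        refine ((Finset.prod_le_prod' fun j _ => h1 j).trans_lt ?_).ne
        simp only [Finset.prod_const]
        finiteness
      have h3 : Tendsto (fun n => ∏ j, (∫⁻ y in K, ‖b j (z, y)‖ₑ ∂m +
          ∫⁻ y in K, ‖bn n j (z, y) - b j (z, y)‖ₑ ∂m)) atTop (𝓝 β) := by
        have h4 : ∀ j, Tendsto (fun n => ∫⁻ y in K, ‖b j (z, y)‖ₑ ∂m +
            ∫⁻ y in K, ‖bn n j (z, y) - b j (z, y)‖ₑ ∂m) atTop
            (𝓝 (∫⁻ y in K, ‖b j (z, y)‖ₑ ∂m)) := fun j => by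
          simpa using tendsto_const_nhds.add (h2 j)
        have h5 : ∀ t : Finset (Fin k), Tendsto (fun n => ∏ j ∈ t, (∫⁻ y in K, ‖b j (z, y)‖ₑ ∂m +
            ∫⁻ y in K, ‖bn n j (z, y) - b j (z, y)‖ₑ ∂m)) atTop
            (𝓝 (∏ j ∈ t, ∫⁻ y in K, ‖b j (z, y)‖ₑ ∂m)) := by
          intro t
          induction t using Finset.induction_on with
          | empty => simp
          | insert i t hi ih =>
            simp only [Finset.prod_insert hi]
            refine ENNReal.Tendsto.mul (h4 i) (Or.inr ?_) ih (Or.inr ?_)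
            · refine ((Finset.prod_le_prod' fun j _ => h1 j).trans_lt ?_).ne
              simp only [Finset.prod_const]
              finiteness
            · exact ((h1 i).trans_lt hC.lt_top).ne
        exact h5 Finset.univ
      -- Subtraction of the finite limit β turns the additive estimate into convergence of J to 0.
      have h6 := ENNReal.Tendsto.sub h3 (tendsto_const_nhds (x := β)) (Or.inl hβt)
      rw [tsub_self] at h6
      refine tendsto_of_tendsto_of_tendsto_of_le_of_le tendsto_const_nhds h6 (fun n => zero_le)
        fun n => ENNReal.le_sub_of_add_le_right hβt (hJle n z)
  refine tendsto_of_enorm_sub_tendsto_zero ?_ tendsto_const_nhds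
  have hlim0 : Tendsto (fun n => ENNReal.ofReal B * ∫⁻ z, J n z ∂Q) atTop (𝓝 0) := by
    simpa using ENNReal.Tendsto.const_mul hJ0 (Or.inr (ENNReal.ofReal_ne_top (r := B)))
  refine tendsto_of_tendsto_of_tendsto_of_le_of_le' tendsto_const_nhds hlim0
    (Eventually.of_forall fun n => zero_le) ?_
  filter_upwards [hbnC] with n hn
  rw [← integral_sub (integrable_prod_mul Q m hK (bn n) (hbn n) hΦ hB hs hC hn)
    (integrable_prod_mul Q m hK b hb hΦ hB hs hC hbC)]
  refine (enorm_integral_le_lintegral_enorm _).trans ?_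
  have hm : Measurable fun w : Z × (Fin k → X) =>
      ‖(∏ j, bn n j (w.1, w.2 j)) * Φ w - (∏ j, b j (w.1, w.2 j)) * Φ w‖ₑ :=
    (((Finset.measurable_fun_prod _ fun j _ => (hbn n j).comp (by fun_prop)).mul hΦ).sub
      ((Finset.measurable_fun_prod _ fun j _ => (hb j).comp (by fun_prop)).mul hΦ)).enorm
  rw [lintegral_prod _ hm.aemeasurable, ← lintegral_const_mul' _ _ ENNReal.ofReal_ne_top]
  refine lintegral_mono fun z => ?_
  simp only [hJ]
  rw [← Measure.restrict_pi_pi, ← lintegral_const_mul' _ _ ENNReal.ofReal_ne_top,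
    ← lintegral_indicator (MeasurableSet.univ_pi fun _ => hK)]
  refine lintegral_mono fun x => ?_
  by_cases hx : Φ (z, x) = 0
  · simp [hx]
  · rw [indicator_of_mem (by exact fun j _ => hs _ hx j), ← sub_mul, enorm_mul, mul_comm]
    gcongr
    rw [Real.enorm_eq_ofReal_abs]
    exact ENNReal.ofReal_le_ofReal (hB _)

end ProductLimit

/-! ### Cell averages: contraction and convergence in L^1 -/

section CellAverages

variable {d N : ℕ} {D : Set (Vec d)} {a : Vec d} {Δ : ℝ}

lemma disjoint_cell (hΔ : 0 < Δ) : Pairwise (Function.onFun Disjoint (cell a Δ)) := by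
  intro i j hij
  rw [Function.onFun, Set.disjoint_left]
  intro x hi hj
  exact hij ((cellIdx_eq_of_mem_cell hΔ hi).symm.trans (cellIdx_eq_of_mem_cell hΔ hj))

lemma volume_cell_mul_enorm_cellAvg_le (hΔ : 0 < Δ) (v : Vec d → Vec N) (i : Fin d → ℤ) :
    ENNReal.ofReal Δ ^ d * ‖cellAvg a Δ v i‖ₑ ≤ ∫⁻ x in cell a Δ i, ‖v x‖ₑ := by
  have h0 : 0 < volume.real (cell a Δ i) :=
    ENNReal.toReal_pos (volume_cell_pos hΔ a i) (volume_cell_ne_top a Δ i)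
  rw [← volume_cell a Δ i, cellAvg, setAverage_eq, enorm_smul, enorm_inv h0.ne',
    Real.enorm_of_nonneg h0.le, Measure.real, ENNReal.ofReal_toReal (volume_cell_ne_top a Δ i),
    ← mul_assoc, ENNReal.mul_inv_cancel (volume_cell_pos hΔ a i) (volume_cell_ne_top a Δ i),
    one_mul]
  exact enorm_integral_le_lintegral_enorm _

/-- Cell averages are a contraction in `L^1`. -/
lemma lintegral_cellAvg_le (hΔ : 0 < Δ) (v : Vec d → Vec N) {K : Set (Vec d)}
    (hKm : MeasurableSet K) (hK : ∀ x ∈ K, cellIdx a Δ x ∈ mesh D a Δ) :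
    ∫⁻ x in K, ‖cellAvg a Δ v (cellIdx a Δ x)‖ₑ ≤ ∫⁻ x in D, ‖v x‖ₑ := by
  calc _ ≤ ∫⁻ x, (mesh D a Δ).indicator (fun i => ‖cellAvg a Δ v i‖ₑ) (cellIdx a Δ x) := by
        rw [← lintegral_indicator hKm]
        refine lintegral_mono fun x => ?_
        by_cases hx : x ∈ K
        · rw [indicator_of_mem hx, indicator_of_mem (hK x hx)]
        · rw [indicator_of_notMem hx]
          exact zero_le
    _ = ∑' i, ENNReal.ofReal Δ ^ d * (mesh D a Δ).indicator (fun i => ‖cellAvg a Δ v i‖ₑ) i := by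
        rw [lintegral_comp_cellIdx hΔ, ENNReal.tsum_mul_left]
    _ ≤ ∑' i, ∫⁻ x in cell a Δ i, ‖v x‖ₑ ∂(volume.restrict D) := by
        refine ENNReal.tsum_le_tsum fun i => ?_
        by_cases hi : i ∈ mesh D a Δ
        · rw [indicator_of_mem hi, Measure.restrict_restrict (measurableSet_cell a Δ i),
            inter_eq_left.2 hi]
          exact volume_cell_mul_enorm_cellAvg_le hΔ v i
        · rw [indicator_of_notMem hi, mul_zero]
          exact zero_le
    _ = ∫⁻ x in ⋃ i, cell a Δ i, ‖v x‖ₑ ∂(volume.restrict D) :=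
        (lintegral_iUnion (measurableSet_cell a Δ) (disjoint_cell hΔ) _).symm
    _ ≤ _ := setLIntegral_le_lintegral _ _

lemma cellAvg_sub {u v : Vec d → Vec N} {i : Fin d → ℤ} (hu : IntegrableOn u (cell a Δ i))
    (hv : IntegrableOn v (cell a Δ i)) :
    cellAvg a Δ (fun x => u x - v x) i = cellAvg a Δ u i - cellAvg a Δ v i := by
  simp only [cellAvg, setAverage_eq]
  rw [integral_sub hu hv, smul_sub]

lemma norm_cellAvg_sub_le (hΔ : 0 < Δ) {g : Vec d → Vec N} (hg : Integrable g) {ε r : ℝ}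
    (hr : ∀ x y, dist x y < r → dist (g x) (g y) ≤ ε) (hΔr : d * Δ < r) (x : Vec d) :
    ‖cellAvg a Δ g (cellIdx a Δ x) - g x‖ ≤ ε := by
  have h := (convex_closedBall (g x) ε).set_average_mem Metric.isClosed_closedBall
    (volume_cell_pos hΔ a (cellIdx a Δ x)) (volume_cell_ne_top a Δ (cellIdx a Δ x))
    (f := g) ?_ hg.integrableOn
  · rw [← dist_eq_norm]
    exact h
  · filter_upwards [ae_restrict_mem (measurableSet_cell a Δ (cellIdx a Δ x))] with y hy
    refine hr y x ?_
    rw [dist_eq_norm]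
    exact (norm_sub_le_of_mem_cell hΔ hy).trans_lt hΔr

/-- Cell averages converge in `L^1` as the mesh is refined. -/
lemma tendsto_lintegral_cellAvg_sub {Δ : ℕ → ℝ} {a : ℕ → Vec d} (hΔ : ∀ n, 0 < Δ n)
    (hΔ0 : Tendsto Δ atTop (𝓝 0)) (hDm : MeasurableSet D) {u : Vec d → Vec N}
    (hu : IntegrableOn u D)
    {K : Set (Vec d)} (hKm : MeasurableSet K) (hKD : K ⊆ D) (hDf : volume D ≠ ∞)
    (hK : ∀ᶠ n in atTop, ∀ x ∈ K, cellIdx (a n) (Δ n) x ∈ mesh D (a n) (Δ n)) :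
    Tendsto (fun n => ∫⁻ x in K, ‖cellAvg (a n) (Δ n) u (cellIdx (a n) (Δ n) x) - u x‖ₑ) atTop
      (𝓝 0) := by
  have hstep : ∀ ε : ℝ, 0 < ε → ∀ᶠ n in atTop,
      ∫⁻ x in K, ‖cellAvg (a n) (Δ n) u (cellIdx (a n) (Δ n) x) - u x‖ₑ ≤
        ENNReal.ofReal ε * (2 + volume D) := by
    intro ε hε
    have hε' : ENNReal.ofReal ε ≠ 0 := by simpa using hε
    -- Density of continuous functions of compact support. The difference u − g enters twice, once
    -- directly and once through its averages, which do not increase the L^1 norm; for g itself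
    -- uniform continuity suffices. This gives the factor 2 + |D|.
    obtain ⟨g, hgc, hgε, hgcont, -⟩ :=
      ((integrable_indicator_iff hDm).2 hu).exists_hasCompactSupport_lintegral_sub_le hε'
    have hgi : Integrable g := hgcont.integrable_of_hasCompactSupport hgc
    have hgD : ∫⁻ x in D, ‖u x - g x‖ₑ ≤ ENNReal.ofReal ε := by
      refine le_trans ?_ hgε
      refine le_trans (le_of_eq ?_) (setLIntegral_le_lintegral D _)
      refine setLIntegral_congr_fun hDm fun x hx => ?_
      simp only [indicator_of_mem hx]
    obtain ⟨r, hr, hr'⟩ := Metric.uniformContinuous_iff.1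
      (hgc.uniformContinuous_of_continuous hgcont) ε hε
    have hsmall : ∀ᶠ n in atTop, d * Δ n < r := by
      have h1 : Tendsto (fun n => d * Δ n) atTop (𝓝 (d * 0)) := hΔ0.const_mul _
      rw [mul_zero] at h1
      exact h1.eventually_lt_const hr
    filter_upwards [hK, hsmall] with n hKn hn
    have hgm : Measurable fun x => ‖cellAvg (a n) (Δ n) g (cellIdx (a n) (Δ n) x) - g x‖ₑ :=
      ((Measurable.of_discrete (f := cellAvg (a n) (Δ n) g)).comp
        (measurable_cellIdx (a n) (Δ n)) |>.sub hgcont.measurable).enorm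
    have hdm : Measurable fun x => ‖cellAvg (a n) (Δ n) (fun y => u y - g y)
        (cellIdx (a n) (Δ n) x)‖ₑ :=
      ((Measurable.of_discrete (f := cellAvg (a n) (Δ n) fun y => u y - g y)).comp
        (measurable_cellIdx (a n) (Δ n))).enorm
    calc _ ≤ ∫⁻ x in K, (‖cellAvg (a n) (Δ n) (fun y => u y - g y) (cellIdx (a n) (Δ n) x)‖ₑ +
          ‖cellAvg (a n) (Δ n) g (cellIdx (a n) (Δ n) x) - g x‖ₑ + ‖u x - g x‖ₑ) := by
          refine setLIntegral_mono' hKm fun x hx => ?_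
          have h1 := cellAvg_sub (hu.mono_set (hKn x hx))
            (hgi.integrableOn (s := cell (a n) (Δ n) (cellIdx (a n) (Δ n) x)))
          have e : cellAvg (a n) (Δ n) u (cellIdx (a n) (Δ n) x) - u x =
              (cellAvg (a n) (Δ n) (fun y => u y - g y) (cellIdx (a n) (Δ n) x) +
              (cellAvg (a n) (Δ n) g (cellIdx (a n) (Δ n) x) - g x)) - (u x - g x) := by
            rw [h1]; abel
          rw [e]
          exact enorm_sub_le.trans (add_le_add (enorm_add_le _ _) le_rfl)
      _ = (∫⁻ x in K, ‖cellAvg (a n) (Δ n) (fun y => u y - g y) (cellIdx (a n) (Δ n) x)‖ₑ) +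
          (∫⁻ x in K, ‖cellAvg (a n) (Δ n) g (cellIdx (a n) (Δ n) x) - g x‖ₑ) +
          ∫⁻ x in K, ‖u x - g x‖ₑ := by
          have hsum : Measurable fun x =>
              ‖cellAvg (a n) (Δ n) (fun y => u y - g y) (cellIdx (a n) (Δ n) x)‖ₑ +
                ‖cellAvg (a n) (Δ n) g (cellIdx (a n) (Δ n) x) - g x‖ₑ := hdm.add hgm
          rw [lintegral_add_left hsum, lintegral_add_left hdm]
      _ ≤ ENNReal.ofReal ε + ENNReal.ofReal ε * volume D + ENNReal.ofReal ε := by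
          refine add_le_add (add_le_add ?_ ?_) ?_
          · exact (lintegral_cellAvg_le (hΔ n) _ hKm hKn).trans hgD
          · calc _ ≤ ∫⁻ _x in K, ENNReal.ofReal ε := by
                  refine lintegral_mono fun x => ?_
                  rw [← ofReal_norm]
                  exact ENNReal.ofReal_le_ofReal (norm_cellAvg_sub_le (hΔ n) hgi
                    (fun x y hxy => (hr' hxy).le) hn x)
              _ ≤ _ := by
                  rw [setLIntegral_const]
                  gcongr
          · exact (lintegral_mono_set hKD).trans hgD
      _ = _ := by ring
  rw [ENNReal.tendsto_nhds_zero]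
  intro η hη
  by_cases ht : η = ∞
  · simp [ht]
  · have hv : (2 + volume D) ≠ ∞ := by finiteness
    have hv0 : (2 + volume D) ≠ 0 := by simp
    have h1 : 0 < (η / (2 + volume D)).toReal :=
      ENNReal.toReal_pos (ENNReal.div_pos hη.ne' hv).ne' (ENNReal.div_ne_top ht hv0)
    filter_upwards [hstep _ h1] with n hn
    rwa [ENNReal.ofReal_toReal (ENNReal.div_ne_top ht hv0), ENNReal.div_mul_cancel hv0 hv] at hn

end CellAverages

/-! ### Convergence of the initial terms -/

section Initial

variable {d N : ℕ} {p : ℝ≥0∞} [Fact (1 ≤ p)] {D : Set (Vec d)} {T P : ℝ} {c : ℝ≥0} {q : ℕ}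
  {f : Fin d → Vec N → Vec N} {Δ : ℕ → ℝ} {a : ℕ → Vec d}
  {F : ℕ → Fin d → (Fin (2 * q) → Vec N) → Vec N}
  {S : ℕ → ℝ → LpSpace d N p D → LpSpace d N p D} {μbar : Measure (LpSpace d N p D)}
  [IsProbabilityMeasure μbar]
  {νn : ℕ → TimeCorrFamily d N} {μ : ℝ → Measure (LpSpace d N p D)} {ν : TimeCorrFamily d N}
  {s C T' δ : ℝ} {k : ℕ} {K : Set (Vec d)}

/-- The initial terms of the weak form converge. -/
theorem SchemeLimit.tendsto_initial_term (h : SchemeLimit T P c q f Δ a F S μbar νn μ ν s C)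
    (hT'0 : 0 ≤ T') (hT' : T' < T) (hδ : 0 < δ) (hKc : IsCompact K)
    (hK : Metric.cthickening δ K ⊆ D) {νbar : CorrFamily d N} {c₀ : ℝ≥0}
    (hbar : DualBdd P c₀ μbar νbar) {φ : (Fin k → Vec d) → ℝ} (hφ : Continuous φ)
    (hφc : HasCompactSupport φ) (hsupp : ∀ x, φ x ≠ 0 → ∀ j, x j ∈ K) (I : Fin k → Fin N) :
    Tendsto (fun n => ∫ w, (∏ j, field (a n) (Δ n) (S n) T' 0 w.1 (w.2 j) (I j)) * φ w.2
      ∂(μbar.prod (volume : Measure (Fin k → Vec d)))) atTop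
      (𝓝 (∫ y, φ y.1 * ∏ j, y.2 j (I j) ∂((volume.restrict (domPow D k)) ⊗ₘ (νbar k)))) := by
  have hDm := h.isOpen.measurableSet
  have hDf := h.volume_ne_top
  have hfin : IsFiniteMeasure ((volume : Measure (Vec d)).restrict D) :=
    ⟨by simpa using hDf.lt_top⟩
  obtain ⟨e, he, heu⟩ := exists_measurable_eval (N := N) h.ne_top D
  obtain ⟨B, hB⟩ := hφc.exists_bound_of_continuous hφ
  have hKm : MeasurableSet K := hKc.measurableSet
  have hKD : K ⊆ D := (Metric.self_subset_cthickening K).trans hK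
  have h0T' : (0 : ℝ) ∈ Icc 0 T' := ⟨le_rfl, hT'0⟩
  have hmesh : ∀ᶠ n in atTop, ∀ x ∈ K, cellIdx (a n) (Δ n) x ∈ mesh D (a n) (Δ n) := by
    filter_upwards [h.eventually_mesh hδ] with n hn x hx
    refine cellIdx_mem_mesh hδ.le hK (h.mesh_pos n) (le_trans ?_ hn)
      (Metric.self_subset_cthickening K hx)
    have := h.mesh_pos n
    have : (0 : ℝ) ≤ (q + 1) * Δ n := by positivity
    linarith
  have hfield : ∀ n, (∀ x ∈ K, cellIdx (a n) (Δ n) x ∈ mesh D (a n) (Δ n)) →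
      ∀ (u : LpSpace d N p D), ∀ x ∈ K, field (a n) (Δ n) (S n) T' 0 u x =
        cellAvg (a n) (Δ n) u (cellIdx (a n) (Δ n) x) := by
    intro n hn u x hx
    rw [field, cellVal_of_mem h0T' u (hn x hx)]
    exact ((h.evolution n).cellAvg_scheme (h.mesh_pos n) u).2.1 h.time_pos _ (hn x hx)
  have hbound : ∀ᵐ u ∂μbar, ∫⁻ x in D, ‖u x‖ₑ ≤ volume D + c₀ := by
    filter_upwards [hbar.bound] with u hu
    have := lintegral_growth_le (D := D) (enorm_le_one_add_rpow h.one_le)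
      (Lp.aestronglyMeasurable u).aemeasurable hu
    rwa [one_mul] at this
  have heK : ∀ u : LpSpace d N p D, ∀ᵐ x ∂volume.restrict K, e (u, x) = u x := fun u =>
    ae_restrict_of_ae_restrict_of_subset hKD (heu u)
  have hVm : ∀ n (j : Fin k), Measurable fun z : LpSpace d N p D × Vec d =>
      field (a n) (Δ n) (S n) T' 0 z.1 z.2 (I j) := by
    intro n j
    have h1 : Measurable fun z : LpSpace d N p D × Vec d =>
        (((0 : ℝ), z.1), z.2) := by fun_prop
    have := (measurable_field h.ne_top (h.mesh_pos n) (h.evolution n) hT'0 hT').comp h1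
    simp only [Function.comp_def] at this
    exact measurable_coord this (I j)
  have hem : ∀ j : Fin k, Measurable fun z : LpSpace d N p D × Vec d => e z (I j) := fun j =>
    measurable_coord he (I j)
  have hφm : Measurable fun w : LpSpace d N p D × (Fin k → Vec d) => φ w.2 :=
    hφ.measurable.comp measurable_snd
  have hCt : volume D + (c₀ : ℝ≥0∞) ≠ ∞ := by finiteness
  have hebound : ∀ j : Fin k, ∀ᵐ u ∂μbar, ∫⁻ y in K, ‖e (u, y) (I j)‖ₑ ≤ volume D + c₀ := by
    intro j
    filter_upwards [hbound] with u hu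
    refine le_trans ?_ ((lintegral_mono_set hKD).trans hu)
    refine lintegral_mono_ae ?_
    filter_upwards [heK u] with x hx
    rw [hx]
    exact enorm_apply_le _ _
  -- The jointly measurable evaluation replaces the representatives of u, so that the limiting
  -- product is measurable in (u,x).
  have hlim := tendsto_integral_prod_mul μbar (volume : Measure (Vec d)) hKm
    (bn := fun n j z => field (a n) (Δ n) (S n) T' 0 z.1 z.2 (I j))
    (b := fun j z => e z (I j)) hVm hem (Φ := fun w => φ w.2) hφm (B := B) (fun w => hB w.2)
    (fun w hw => hsupp w.2 hw) hCt ?_ hebound ?_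
  · have hlimeq : ∫ w, (∏ j, e (w.1, w.2 j) (I j)) * φ w.2
        ∂(μbar.prod (Measure.pi fun _ : Fin k => (volume : Measure (Vec d)))) =
        ∫ y, φ y.1 * ∏ j, y.2 j (I j) ∂((volume.restrict (domPow D k)) ⊗ₘ (νbar k)) := by
      have hg : Measurable fun y : (Fin k → Vec d) × (Fin k → Vec N) =>
          φ y.1 * ∏ j, y.2 j (I j) :=
        (hφ.measurable.comp measurable_fst).mul (Finset.measurable_fun_prod _ fun j _ => by
          fun_prop)
      rw [compProd_eq_map_evalPow hDf he heu hbar.markov hbar.dual k,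
        integral_map (measurable_evalPow he k).aemeasurable hg.aestronglyMeasurable]
      simp only [evalPow]
      have h1 : μbar.prod (volume.restrict (domPow D k)) =
          (μbar.prod (volume : Measure (Fin k → Vec d))).restrict (univ ×ˢ domPow D k) := by
        rw [← Measure.prod_restrict, Measure.restrict_univ]
      rw [h1, setIntegral_eq_integral_of_forall_compl_eq_zero]
      · refine integral_congr_ae (ae_of_all _ fun w => mul_comm _ _)
      · intro w hw
        have : φ w.2 = 0 := by
          by_contra hne
          exact hw ⟨mem_univ _, fun j _ => hKD (hsupp _ hne j)⟩
        rw [this, zero_mul]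
    rw [← hlimeq]
    exact hlim
  · filter_upwards [hmesh] with n hn j
    filter_upwards [hbound] with u hu
    refine le_trans ?_ ((lintegral_cellAvg_le (h.mesh_pos n) u hKm hn).trans hu)
    refine setLIntegral_mono' hKm fun x hx => ?_
    rw [← hfield n hn u x hx]
    exact enorm_apply_le _ _
  · intro j
    refine ae_of_all _ fun u => ?_
    have hui : IntegrableOn u D := (Lp.memLp u).integrable (Fact.out : 1 ≤ p)
    refine tendsto_of_tendsto_of_tendsto_of_le_of_le' tendsto_const_nhds
      (tendsto_lintegral_cellAvg_sub h.mesh_pos h.mesh_tendsto hDm hui hKm hKD hDf hmesh)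
      (Eventually.of_forall fun n => zero_le) ?_
    filter_upwards [hmesh] with n hn
    refine lintegral_mono_ae ?_
    filter_upwards [heK u, ae_restrict_mem hKm] with x hx hxK
    rw [hx, hfield n hn u x hxK]
    exact enorm_apply_le (cellAvg (a n) (Δ n) u (cellIdx (a n) (Δ n) x) - u x) (I j)

end Initial

/-! ### The equations for the moments of the limit -/

/-- The joint law of a time-dependent correlation measure is determined by the measure on
`L^p` to which it is dual. -/
lemma TimeDualBdd.jointLaw_congr {d N : ℕ} {p : ℝ≥0∞} [Fact (1 ≤ p)] {D : Set (Vec d)} {T P : ℝ}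
    {c : ℝ≥0} {μ : ℝ → Measure (LpSpace d N p D)} {ν ν' : TimeCorrFamily d N} (hp : p ≠ ∞)
    (hDf : volume D ≠ ∞) (h : TimeDualBdd T P c μ ν) (h' : TimeDualBdd T P c μ ν') (k : ℕ) :
    jointLaw D T ν k = jointLaw D T ν' k := by
  obtain ⟨e, he, heu⟩ := exists_measurable_eval (N := N) hp D
  refine Measure.ext_of_lintegral _ fun g hg => ?_
  rw [lintegral_jointLaw h.markov hg, lintegral_jointLaw h'.markov hg]
  refine lintegral_congr_ae ?_
  filter_upwards [h.slice, h'.slice] with t ht ht'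
  have := ht.prob
  rw [compProd_eq_map_evalPow hDf he heu ht.markov ht.dual k,
    compProd_eq_map_evalPow hDf he heu ht'.markov ht'.dual k]

lemma integral_compProd_mul {X Y : Type*} [MeasurableSpace X] [MeasurableSpace Y] {m : Measure X}
    [SFinite m] {κ : Kernel X Y} [IsSFiniteKernel κ] {Ψ : X → ℝ} (hΨ : Measurable Ψ) {B : ℝ}
    (hB : ∀ x, |Ψ x| ≤ B) {G : Y → ℝ} (hG : Integrable (fun w : X × Y => G w.2) (m ⊗ₘ κ)) :
    Integrable (fun x => (∫ y, G y ∂(κ x)) * Ψ x) m ∧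
      ∫ x, (∫ y, G y ∂(κ x)) * Ψ x ∂m = ∫ w, Ψ w.1 * G w.2 ∂(m ⊗ₘ κ) := by
  have hi : Integrable (fun w : X × Y => Ψ w.1 * G w.2) (m ⊗ₘ κ) :=
    hG.bdd_mul (hΨ.comp measurable_fst).aestronglyMeasurable (ae_of_all _ fun w => hB w.1)
  have e : ∀ x, ∫ y, Ψ x * G y ∂(κ x) = (∫ y, G y ∂(κ x)) * Ψ x := fun x => by
    rw [integral_const_mul, mul_comm]
  refine ⟨?_, ?_⟩
  · have := MeasureTheory.Integrable.integral_compProd (κ := Kernel.const Unit m)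
      (η := Kernel.prodMkLeft Unit κ) (a := ()) hi
    simpa only [Kernel.prodMkLeft_apply, Kernel.const_apply, e] using this
  · rw [Measure.integral_compProd hi]
    simp only [e]

lemma fluxEntry_eq {d N k : ℕ} (f : Fin d → Vec N → Vec N) (i : Fin k) (m : Fin d)
    (ξ : Fin k → Vec N) (I : Fin k → Fin N) :
    fluxEntry f i m ξ I = ∏ j, if j = i then f m (ξ j) (I j) else ξ j (I j) := by
  rw [fluxEntry, tensorEntry]
  refine Finset.prod_congr rfl fun j _ => ?_
  by_cases hj : j = i
  · subst hj; simp
  · simp [hj]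

section Equation

variable {d N : ℕ} {p : ℝ≥0∞} [Fact (1 ≤ p)] {D : Set (Vec d)} {T P : ℝ} {c : ℝ≥0} {q : ℕ}
  {f : Fin d → Vec N → Vec N} {Δ : ℕ → ℝ} {a : ℕ → Vec d}
  {F : ℕ → Fin d → (Fin (2 * q) → Vec N) → Vec N}
  {S : ℕ → ℝ → LpSpace d N p D → LpSpace d N p D} {μbar : Measure (LpSpace d N p D)}
  [IsProbabilityMeasure μbar]
  {νn : ℕ → TimeCorrFamily d N} {μ : ℝ → Measure (LpSpace d N p D)} {ν : TimeCorrFamily d N}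
  {s C : ℝ} {k : ℕ}

/-- Compactness keeps the support away from T, so the fields are only needed on [0,T'] with T' < T.
-/
lemma exists_time_lt {E : Type*} [TopologicalSpace E] {A : Set (ℝ × E)} (hA : IsCompact A)
    (hT : 0 < T) (h : ∀ z ∈ A, z.1 < T) : ∃ T' : ℝ, 0 ≤ T' ∧ T' < T ∧ ∀ z ∈ A, z.1 < T' := by
  rcases A.eq_empty_or_nonempty with rfl | hne
  · exact ⟨0, le_rfl, hT, by simp⟩
  · obtain ⟨z₀, hz₀, hmax⟩ := hA.exists_isMaxOn hne continuous_fst.continuousOn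
    have h1 : max z₀.1 0 < T := max_lt (h z₀ hz₀) hT
    refine ⟨(max z₀.1 0 + T) / 2, ?_, by linarith, fun z hz => ?_⟩
    · have := le_max_right z₀.1 0
      linarith
    · have h2 : z.1 ≤ z₀.1 := hmax hz
      have := le_max_left z₀.1 0
      linarith

/-- The weak form of the equation for one entry of the moments. -/
theorem SchemeLimit.scalar_equation (h : SchemeLimit T P c q f Δ a F S μbar νn μ ν s C)
    {νbar : CorrFamily d N} {c₀ : ℝ≥0} (hbar : DualBdd P c₀ μbar νbar)
    {φ : ℝ × (Fin k → Vec d) → ℝ} (hφ : ContDiff ℝ 1 φ) (hφc : HasCompactSupport φ)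
    (hsupp : tsupport φ ⊆ Iio T ×ˢ domPow D k) (I : Fin k → Fin N) :
    (∫ w, fderiv ℝ φ w.1 (1, 0) * ∏ j, w.2 j (I j) ∂(jointLaw D T ν k)) +
    (∑ l, ∑ m, ∫ w, fderiv ℝ φ w.1 (0, Pi.single l (EuclideanSpace.single m 1)) *
        ∏ j, (if j = l then f m (w.2 j) (I j) else w.2 j (I j)) ∂(jointLaw D T ν k)) +
    ∫ y, φ (0, y.1) * ∏ j, y.2 j (I j) ∂((volume.restrict (domPow D k)) ⊗ₘ (νbar k)) = 0 := by
  obtain ⟨T', hT'0, hT', hφT'⟩ := exists_time_lt hφc h.time_pos fun z hz => (hsupp hz).1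
  -- The union of all k spatial projections of the support: a single compact subset of D that
  -- contains every variable.
  set K : Set (Vec d) := ⋃ j : Fin k, (fun z : ℝ × (Fin k → Vec d) => z.2 j) '' tsupport φ with hKdef
  have hφK : ∀ z ∈ tsupport φ, ∀ j, z.2 j ∈ K := fun z hz j =>
    mem_iUnion.2 ⟨j, mem_image_of_mem (fun z : ℝ × (Fin k → Vec d) => z.2 j) hz⟩
  have hKc : IsCompact K := isCompact_iUnion fun j => hφc.isCompact.image (by fun_prop)
  have hKD : K ⊆ D := iUnion_subset fun j => by
    rintro _ ⟨z, hz, rfl⟩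
    exact (hsupp hz).2 j (mem_univ j)
  have hsuppK : tsupport φ ⊆ Iio T' ×ˢ domPow K k := fun z hz =>
    ⟨hφT' z hz, fun j _ => hφK z hz j⟩
  obtain ⟨δ, hδ, hδD⟩ := hKc.exists_cthickening_subset_open h.isOpen hKD
  have hC0 : 0 ≤ C := zero_le_one.trans h.one_le_const
  have hdcont : Continuous fun z => fderiv ℝ φ z (1, 0) :=
    (hφ.continuous_fderiv (by norm_num)).clm_apply continuous_const
  have hdc : HasCompactSupport fun z => fderiv ℝ φ z (1, 0) :=
    (hφc.fderiv (𝕜 := ℝ)).comp_left (g := fun L : (ℝ × (Fin k → Vec d)) →L[ℝ] ℝ => L (1, 0)) rfl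
  have hdsupp : ∀ z, fderiv ℝ φ z (1, 0) ≠ 0 → z.1 < T' ∧ ∀ j, z.2 j ∈ K := fun z hz => by
    have h1 : z ∈ tsupport φ := by
      refine tsupport_fderiv_subset ℝ (subset_tsupport _ fun h0 => hz ?_)
      rw [h0]
      rfl
    exact ⟨hφT' z h1, hφK z h1⟩
  have hA := h.tendsto_integral_field hT'0 hT' hδ hδD hdcont hdc hdsupp (fun j ξ => ξ (I j))
    fun j => isMomentFn_coord h.one_le h.one_le_const (I j)
  have hBt : Tendsto _ atTop (𝓝 _) := tendsto_finsetSum Finset.univ fun l _ =>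
    tendsto_finsetSum Finset.univ fun m _ =>
      h.tendsto_flux_term hT'0 hT' hδ hδD hφ hφc hsuppK I l m
  have hφ0 : HasCompactSupport fun x : Fin k → Vec d => φ (0, x) := by
    refine HasCompactSupport.intro (hφc.isCompact.image continuous_snd) fun x hx => ?_
    by_contra hne
    exact hx ⟨(0, x), subset_tsupport _ hne, rfl⟩
  have hCt := h.tendsto_initial_term hT'0 hT' hδ hKc hδD hbar (φ := fun x => φ (0, x))
    (hφ.continuous.comp (by fun_prop)) hφ0
    (fun x hx => hφK (0, x) (subset_tsupport _ hx)) I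
  -- The sum of the three convergent terms is 0 for all fine meshes, by the exact weak form, and so
  -- is its limit.
  refine tendsto_nhds_unique ((hA.add hBt).add hCt) ?_
  refine (tendsto_const_nhds (x := (0 : ℝ))).congr' ?_
  filter_upwards [h.eventually_mesh hδ] with n hn
  have hΔn := h.mesh_pos n
  have hsd := semiDiscrete_scheme h.ne_top h.isOpen.measurableSet hΔn (h.evolution n) hT'0 hT'
    (h.flux_continuous n) h.one_le (h.flux_growth n)
    ((h.bounded_seq n).ae_lintegral_le (h.evolution n).measurable) hδ.le hδD (by linarith)
  have hct : fluxBound D q C c ≠ ∞ := by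
    have := h.volume_ne_top
    rw [fluxBound]
    finiteness
  have hΔδ : Δ n ≤ δ := by
    have : (0 : ℝ) ≤ (d + q) * Δ n := by positivity
    linarith
  exact (hsd.weak_form h.isOpen.measurableSet hct hΔn hT'0 I hφ hφc hsuppK hKD
    fun l m z hz j => hδD ((mem_of_shiftTest_ne_zero hΔn hΔδ hsuppK hz).2 j)).symm

/-- The vector equation is a finite sum of scalar ones over the multiindices I. Integrals against
the kernels are rewritten as integrals against the joint law, for which the equation is known. -/
theorem SchemeLimit.momentEquation (h : SchemeLimit T P c q f Δ a F S μbar νn μ ν s C)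
    {νbar : CorrFamily d N} {c₀ : ℝ≥0} (hbar : DualBdd P c₀ μbar νbar) {ν' : TimeCorrFamily d N}
    (hν' : TimeDualBdd T P c μ ν') (k : ℕ) : MomentEquation D T f νbar ν' k := by
  have hP0 : 0 ≤ P := zero_le_one.trans h.one_le
  have := hbar.markov k
  have := hν'.markov k
  have hcoord : ∀ i : Fin N, IsMomentFn P C fun ξ : Vec N => ξ i := fun i =>
    isMomentFn_coord h.one_le h.one_le_const i
  have hi0 : ∀ I : Fin k → Fin N,
      Integrable (fun w : (Fin k → Vec d) × (Fin k → Vec N) => tensorEntry w.2 I)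
        ((volume.restrict (domPow D k)) ⊗ₘ (νbar k)) := fun I =>
    hbar.integrable_prod h.ne_top h.volume_ne_top hP0 (fun j ξ => ξ (I j))
      (fun j => (hcoord (I j)).continuous.measurable) fun j => (hcoord (I j)).growth
  have hi1 : ∀ I : Fin k → Fin N,
      Integrable (fun w : (ℝ × (Fin k → Vec d)) × (Fin k → Vec N) => tensorEntry w.2 I)
        ((volume.restrict (Ico 0 T ×ˢ domPow D k)) ⊗ₘ (ν' k)) := fun I =>
    hν'.integrable_prod h.ne_top h.volume_ne_top hP0 (fun j ξ => ξ (I j))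
      (fun j => (hcoord (I j)).continuous.measurable) fun j => (hcoord (I j)).growth
  have hi2 : ∀ (i : Fin k) (m : Fin d) (I : Fin k → Fin N),
      Integrable (fun w : (ℝ × (Fin k → Vec d)) × (Fin k → Vec N) => fluxEntry f i m w.2 I)
        ((volume.restrict (Ico 0 T ×ˢ domPow D k)) ⊗ₘ (ν' k)) := by
    intro i m I
    have hH : ∀ j : Fin k, IsMomentFn P C fun ξ : Vec N =>
        if j = i then f m ξ (I j) else ξ (I j) := by
      intro j
      by_cases hj : j = i
      · simp only [if_pos hj]; exact h.moment m (I j)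
      · simp only [if_neg hj]; exact hcoord (I j)
    simp only [fluxEntry_eq]
    exact hν'.integrable_prod h.ne_top h.volume_ne_top hP0
      (fun j ξ => if j = i then f m ξ (I j) else ξ (I j))
      (fun j => (hH j).continuous.measurable) fun j => (hH j).growth
  refine ⟨hi0, hi1, hi2, fun φ hφ => ?_⟩
  have hφd : ContDiff ℝ 1 φ := hφ.smooth.of_le (by exact_mod_cast le_top)
  -- the entries of the test function
  have hφI : ∀ I, ContDiff ℝ 1 fun z => φ z I := fun I => contDiff_pi.1 hφd I
  have hφIc : ∀ I, HasCompactSupport fun z => φ z I := fun I =>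
    hφ.compact.comp_left (g := fun y : (Fin k → Fin N) → ℝ => y I) rfl
  have hφIs : ∀ I, tsupport (fun z => φ z I) ⊆ Iio T ×ˢ domPow D k := fun I =>
    (closure_mono fun z hz => by
      intro h0
      exact hz (congrFun h0 I)).trans hφ.support
  have hder : ∀ z v I, fderiv ℝ φ z v I = fderiv ℝ (fun z => φ z I) z v := by
    intro z v I
    have h1 := (hφd.differentiable (by norm_num)) z
    have h2 := (hasFDerivAt_pi'.1 h1.hasFDerivAt I).fderiv
    rw [h2]
    rfl
  simp only [hder]
  have hdb : ∀ (I : Fin k → Fin N) (v : ℝ × (Fin k → Vec d)),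
      Measurable (fun z => fderiv ℝ (fun z => φ z I) z v) ∧
      ∃ B, ∀ z, |fderiv ℝ (fun z => φ z I) z v| ≤ B := by
    intro I v
    have h1 : Continuous fun z => fderiv ℝ (fun z => φ z I) z v :=
      ((hφI I).continuous_fderiv (by norm_num)).clm_apply continuous_const
    have h2 : HasCompactSupport fun z => fderiv ℝ (fun z => φ z I) z v :=
      ((hφIc I).fderiv (𝕜 := ℝ)).comp_left
        (g := fun L : (ℝ × (Fin k → Vec d)) →L[ℝ] ℝ => L v) rfl
    exact ⟨h1.measurable, h2.exists_bound_of_continuous h1⟩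
  have hterm : ∀ (I : Fin k → Fin N) (v : ℝ × (Fin k → Vec d)) (G : (Fin k → Vec N) → ℝ),
      Integrable (fun w : (ℝ × (Fin k → Vec d)) × (Fin k → Vec N) => G w.2)
        ((volume.restrict (Ico 0 T ×ˢ domPow D k)) ⊗ₘ (ν' k)) →
      Integrable (fun z => (∫ ξ, G ξ ∂(ν' k z)) * fderiv ℝ (fun z => φ z I) z v)
        (volume.restrict (Ico 0 T ×ˢ domPow D k)) ∧
      ∫ z in Ico 0 T ×ˢ domPow D k, (∫ ξ, G ξ ∂(ν' k z)) * fderiv ℝ (fun z => φ z I) z v =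
        ∫ w, fderiv ℝ (fun z => φ z I) w.1 v * G w.2 ∂(jointLaw D T ν k) := by
    intro I v G hG
    obtain ⟨hm, B, hB⟩ := hdb I v
    -- The joint law depends on μ only, so the equation passes from the correlation measure of the
    -- convergence to an arbitrary dual one.
    rw [h.bounded.jointLaw_congr h.ne_top h.volume_ne_top hν' k]
    exact integral_compProd_mul hm hB hG
  have hterm0 : ∀ I : Fin k → Fin N,
      Integrable (fun x => (∫ ξ, tensorEntry ξ I ∂(νbar k x)) * φ (0, x) I)
        (volume.restrict (domPow D k)) ∧
      ∫ x in domPow D k, (∫ ξ, tensorEntry ξ I ∂(νbar k x)) * φ (0, x) I =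
        ∫ y, φ (0, y.1) I * tensorEntry y.2 I
          ∂((volume.restrict (domPow D k)) ⊗ₘ (νbar k)) := by
    intro I
    obtain ⟨B, hB⟩ := (hφIc I).exists_bound_of_continuous (hφI I).continuous
    have hc : Continuous fun x : Fin k → Vec d => φ (0, x) I :=
      (hφI I).continuous.comp (by fun_prop : Continuous fun x : Fin k → Vec d => ((0 : ℝ), x))
    exact integral_compProd_mul hc.measurable (fun x => hB (0, x)) (hi0 I)
  rw [integral_finsetSum, integral_finsetSum _ fun I _ => (hterm0 I).1, ← Finset.sum_add_distrib]
  · refine Finset.sum_eq_zero fun I _ => ?_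
    rw [integral_add (hterm I _ _ (hi1 I)).1 (integrable_finsetSum _ fun i _ =>
      integrable_finsetSum _ fun m _ => (hterm I _ _ (hi2 i m I)).1), integral_finsetSum _
      fun i _ => integrable_finsetSum _ fun m _ => (hterm I _ _ (hi2 i m I)).1,
      (hterm I _ _ (hi1 I)).2, (hterm0 I).2]
    have e : ∀ i, ∫ z in Ico 0 T ×ˢ domPow D k, ∑ m, (∫ ξ, fluxEntry f i m ξ I ∂(ν' k z)) *
        fderiv ℝ (fun z => φ z I) z (0, Pi.single i (EuclideanSpace.single m 1)) =
        ∑ m, ∫ w, fderiv ℝ (fun z => φ z I) w.1 (0, Pi.single i (EuclideanSpace.single m 1)) *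
          fluxEntry f i m w.2 I ∂(jointLaw D T ν k) := by
      intro i
      rw [integral_finsetSum _ fun m _ => (hterm I _ _ (hi2 i m I)).1]
      exact Finset.sum_congr rfl fun m _ => (hterm I _ _ (hi2 i m I)).2
    simp only [e]
    simp only [fluxEntry_eq, tensorEntry]
    exact h.scalar_equation hbar (hφI I) (hφIc I) (hφIs I) I
  · exact fun I _ => (hterm I _ _ (hi1 I)).1.add (integrable_finsetSum _ fun i _ =>
      integrable_finsetSum _ fun m _ => (hterm I _ _ (hi2 i m I)).1)

end Equation

/-! ### Bounds in terms of the norm of `L^p` -/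

section Norms

variable {d N : ℕ} {p : ℝ≥0∞} [Fact (1 ≤ p)] {D : Set (Vec d)}

lemma toReal_pos_of_fact (hp : p ≠ ∞) : 0 < p.toReal :=
  ENNReal.toReal_pos (zero_lt_one.trans_le (Fact.out : 1 ≤ p)).ne' hp

lemma eLpNorm_rpow_eq (hp : p ≠ ∞) (u : LpSpace d N p D) :
    eLpNorm u p (volume.restrict D) ^ p.toReal = ∫⁻ x in D, ‖u x‖ₑ ^ p.toReal := by
  have h0 := toReal_pos_of_fact hp
  rw [eLpNorm_eq_lintegral_rpow_enorm_toReal (zero_lt_one.trans_le (Fact.out : 1 ≤ p)).ne' hp,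
    ← ENNReal.rpow_mul, one_div, inv_mul_cancel₀ h0.ne', ENNReal.rpow_one]

lemma lintegral_le_of_norm_le (hp : p ≠ ∞) {u : LpSpace d N p D} {M : ℝ} (h : ‖u‖ ≤ M) :
    ∫⁻ x in D, ‖u x‖ₑ ^ p.toReal ≤ ((M.toNNReal ^ p.toReal : ℝ≥0) : ℝ≥0∞) := by
  rw [← eLpNorm_rpow_eq hp, ENNReal.coe_rpow_of_nonneg _ (toReal_pos_of_fact hp).le]
  refine ENNReal.rpow_le_rpow ?_ (toReal_pos_of_fact hp).le
  rw [← Lp.enorm_def, ← ofReal_norm]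
  exact ENNReal.ofReal_le_ofReal h

lemma norm_le_of_lintegral_le (hp : p ≠ ∞) {u : LpSpace d N p D} {c : ℝ≥0}
    (h : ∫⁻ x in D, ‖u x‖ₑ ^ p.toReal ≤ c) : ‖u‖ ≤ ((c : ℝ≥0∞) ^ p.toReal⁻¹).toReal := by
  have h0 := toReal_pos_of_fact hp
  rw [← eLpNorm_rpow_eq hp] at h
  rw [Lp.norm_def]
  refine ENNReal.toReal_mono (by finiteness) ?_
  rwa [ENNReal.le_rpow_inv_iff h0]

end Norms

/-- On a ball the weight max(|u|,|v|)^(P−1) is bounded because P ≥ 1, so the weighted Lipschitz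
condition gives local Lipschitz continuity and, in particular, continuity. -/
lemma isMomentFn_flux {N : ℕ} {P C L : ℝ} (hP : 1 ≤ P) {g : Vec N → Vec N}
    (hg : ∀ u, ‖g u‖ ≤ C * (1 + ‖u‖ ^ P))
    (hL : ∀ u v, ‖g u - g v‖ ≤ L * ‖u - v‖ * max ‖u‖ ‖v‖ ^ (P - 1)) (i : Fin N) :
    IsMomentFn P C fun ξ => g ξ i := by
  have hlip : ∀ R : ℝ, ∃ L' : ℝ≥0, ∀ u v, ‖u‖ ≤ R → ‖v‖ ≤ R → ‖g u - g v‖ ≤ L' * ‖u - v‖ := by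
    intro R
    refine ⟨(|L| * |R| ^ (P - 1)).toNNReal, fun u v hu hv => (hL u v).trans ?_⟩
    rw [Real.coe_toNNReal _ (by positivity)]
    have h1 : max ‖u‖ ‖v‖ ^ (P - 1) ≤ |R| ^ (P - 1) :=
      Real.rpow_le_rpow (by positivity) ((max_le hu hv).trans (le_abs_self R)) (by linarith)
    calc L * ‖u - v‖ * max ‖u‖ ‖v‖ ^ (P - 1)
        ≤ |L| * ‖u - v‖ * |R| ^ (P - 1) := by
          gcongr
          exact le_abs_self L
      _ = |L| * |R| ^ (P - 1) * ‖u - v‖ := by ring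
  have hcont : Continuous g := by
    refine LocallyLipschitz.continuous fun u => ?_
    obtain ⟨L', hL'⟩ := hlip (‖u‖ + 1)
    refine ⟨L', Metric.ball u 1, Metric.ball_mem_nhds u one_pos, ?_⟩
    have hb : ∀ v ∈ Metric.ball u 1, ‖v‖ ≤ ‖u‖ + 1 := fun v hv => by
      have h1 : ‖v - u‖ < 1 := by simpa [dist_eq_norm] using hv
      have h2 : ‖v‖ ≤ ‖v - u‖ + ‖u‖ := by simpa using norm_add_le (v - u) u
      linarith
    refine LipschitzOnWith.of_dist_le_mul fun v hv w hw => ?_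
    rw [dist_eq_norm, dist_eq_norm]
    exact hL' v w (hb v hv) (hb w hw)
  refine ⟨(EuclideanSpace.proj i : Vec N →L[ℝ] ℝ).continuous.comp hcont, fun ξ => ?_, fun R => ?_⟩
  · exact (PiLp.norm_apply_le (g ξ) i).trans (hg ξ)
  · obtain ⟨L', hL'⟩ := hlip R
    refine ⟨L', L'.2, fun ζ ξ hζ hξ => ?_⟩
    exact (PiLp.norm_apply_le (g ζ - g ξ) i).trans (hL' ζ ξ hζ hξ)

lemma Corresponds.timeDualBdd {d N : ℕ} {p : ℝ≥0∞} [Fact (1 ≤ p)] {D : Set (Vec d)} {T P : ℝ}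
    {c : ℝ≥0} {μ : ℝ → Measure (LpSpace d N p D)} {ν : TimeCorrFamily d N}
    (h : Corresponds T μ ν) (hμ : ∀ t ∈ Ico 0 T, IsProbabilityMeasure (μ t))
    (hb : ∀ᵐ t ∂volume.restrict (Ico 0 T), ∀ᵐ u ∂(μ t), ∫⁻ x in D, ‖u x‖ₑ ^ P ≤ c) :
    TimeDualBdd T P c μ ν := by
  refine ⟨h.isTimeCorrelationMeasure.markov, ?_⟩
  filter_upwards [h.isTimeCorrelationMeasure.slice, h.isDual, hb,
    ae_restrict_mem measurableSet_Ico] with t h1 h2 h3 h4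
  exact ⟨hμ t h4, h1.markov, h2, h3⟩

end LaxWendroff

end

/-! ### The Lax–Wendroff theorem for statistical solutions -/

open LaxWendroff in
theorem theorem4p6 {d N : ℕ} {p : ℝ≥0∞} [Fact (1 ≤ p)] (hp : p ≠ ∞)
    {D : Set (Vec d)} (hDo : IsOpen D) (hDb : Bornology.IsBounded D) {T : ℝ} (hT : 0 < T)
    -- the flux function
    (f : Fin d → Vec N → Vec N)
    (hf_growth : ∃ C : ℝ, ∀ m u, ‖f m u‖ ≤ C * (1 + ‖u‖ ^ p.toReal))
    (hf_lip : ∃ C : ℝ, ∀ m u v, ‖f m u - f m v‖ ≤ C * ‖u - v‖ * max ‖u‖ ‖v‖ ^ (p.toReal - 1))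
    -- the meshes and the numerical fluxes
    (Δ : ℕ → ℝ) (hΔ : ∀ n, 0 < Δ n) (hΔ0 : Tendsto Δ atTop (𝓝 0)) (a : ℕ → Vec d)
    (q : ℕ) (hq : 1 ≤ q) (F : ℕ → Fin d → (Fin (2 * q) → Vec N) → Vec N)
    (hF_cont : ∀ n m, LocallyLipschitz (F n m))
    (hF_lip : ∀ R : ℝ, ∃ C : ℝ, ∀ n m, ∀ w : ℤ → Vec N,
      (∀ j ∈ Finset.Icc (1 - (q : ℤ)) q, ‖w j‖ ≤ R) →
        ‖F n m (fun j => w ((j : ℤ) - q + 1)) - f m (w 0)‖ ≤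
          C * ∑ j ∈ Finset.Icc (1 - (q : ℤ)) q, ‖w 0 - w j‖)
    (hF_growth : ∃ C : ℝ, ∀ n m w, ‖F n m w‖ ≤ C * (1 + ∑ j, ‖w j‖ ^ p.toReal))
    -- the initial measure, with support in a ball
    (μbar : Measure (LpSpace d N p D)) [IsProbabilityMeasure μbar]
    (K : ℝ) (hK : ∀ᵐ u ∂μbar, ‖u‖ ≤ K)
    -- the numerical evolution operators
    (S : ℕ → ℝ → LpSpace d N p D → LpSpace d N p D)
    (hS : ∀ n, IsNumericalEvolution T (a n) (Δ n) q (F n) (S n))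
    -- strong convergence of the approximate statistical solutions
    (μ : ℝ → Measure (LpSpace d N p D))
    (hconv : StronglyConverges T (fun n t => μbar.map (S n t)) μ)
    -- the averaged weak BV bound
    (s C : ℝ) (hs : 0 < s)
    (hBV : ∀ n, ENNReal.ofReal (Δ n) ^ d *
      ∫⁻ t in Ico 0 T, ∫⁻ u, jumpSum D (a n) (Δ n) s u ∂(μbar.map (S n t)) ≤
        ENNReal.ofReal (C * Δ n)) :
    IsStatisticalSolution T f μbar μ := by
  have hP0 := toReal_pos_of_fact (p := p) hp
  have hP : 1 ≤ p.toReal := by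
    have := ENNReal.toReal_mono hp (Fact.out : 1 ≤ p)
    simpa using this
  have hDf : volume D ≠ ∞ := hDb.measure_lt_top.ne
  obtain ⟨Cf, hCf⟩ := hf_growth
  obtain ⟨L, hL⟩ := hf_lip
  obtain ⟨CF, hCF⟩ := hF_growth
  obtain ⟨M, hM⟩ := hconv.bounded
  obtain ⟨νn, ν₀, hνn, hν₀, hobs⟩ := hconv.observables
  set c : ℝ≥0 := M.toNNReal ^ p.toReal with hc
  have hbn : ∀ n, TimeDualBdd T p.toReal c (fun t => μbar.map (S n t)) (νn n) := fun n =>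
    (hνn n).timeDualBdd (hconv.memPT_seq n).isProbabilityMeasure (by
      filter_upwards [hM n] with t ht
      filter_upwards [ht] with u hu
      exact lintegral_le_of_norm_le hp hu)
  -- Bounded support of the limit is not part of strong convergence; it is inherited from the
  -- sequence through the moments of all orders.
  have hb₀ : TimeDualBdd T p.toReal c μ ν₀ :=
    timeDualBdd_limit hp hDf hP hbn hν₀.isTimeCorrelationMeasure.markov
      ((ae_restrict_mem measurableSet_Ico).mono fun t ht =>
        hconv.memPT_limit.isProbabilityMeasure t ht) hν₀.isDual hobs
  -- One constant for the growth of f and F and for the weak BV bound. It is at least 1, so that the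
  -- coordinate functions satisfy the same growth bound.
  set C' : ℝ := |Cf| + |CF| + |C| + 1 with hC'
  have hCfC' : Cf ≤ C' := by
    have := le_abs_self Cf; have := abs_nonneg CF; have := abs_nonneg C; linarith
  have hCFC' : CF ≤ C' := by
    have := le_abs_self CF; have := abs_nonneg Cf; have := abs_nonneg C; linarith
  have hCC' : C ≤ C' := by
    have := le_abs_self C; have := abs_nonneg Cf; have := abs_nonneg CF; linarith
  have hfg : ∀ m u, ‖f m u‖ ≤ C' * (1 + ‖u‖ ^ p.toReal) := fun m u =>
    (hCf m u).trans (mul_le_mul_of_nonneg_right hCfC' (by positivity))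
  have hlim : SchemeLimit T p.toReal c q f Δ a F S μbar νn μ ν₀ s C' :=
    { ne_top := hp
      isOpen := hDo
      volume_ne_top := hDf
      time_pos := hT
      one_le := hP
      bounded_seq := hbn
      bounded := hb₀
      observables := hobs
      mesh_pos := hΔ
      mesh_tendsto := hΔ0
      one_le_stencil := hq
      flux_continuous := fun n m => (hF_cont n m).continuous
      flux_growth := fun n m w =>
        (hCF n m w).trans (mul_le_mul_of_nonneg_right hCFC' (by positivity))
      flux_consistent := hF_lip
      growth := hfg
      moment := fun m i => isMomentFn_flux hP (hfg m) (hL m) i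
      one_le_const := by
        have := abs_nonneg Cf; have := abs_nonneg CF; have := abs_nonneg C; linarith
      evolution := hS
      exponent_pos := hs
      weakBV := fun n => (hBV n).trans (ENNReal.ofReal_le_ofReal
        (mul_le_mul_of_nonneg_right hCC' (hΔ n).le)) }
  refine ⟨⟨K, hK⟩, hconv.memPT_limit, ?_, fun νbar ν hνbar hdual hν k => ?_⟩
  · filter_upwards [hb₀.slice] with t ht
    refine ⟨((c : ℝ≥0∞) ^ p.toReal⁻¹).toReal, ?_⟩
    filter_upwards [ht.bound] with u hu
    exact norm_le_of_lintegral_le hp hu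
  · have hbar : DualBdd p.toReal (K.toNNReal ^ p.toReal) μbar νbar :=
      ⟨inferInstance, hνbar.markov, hdual, by
        filter_upwards [hK] with u hu
        exact lintegral_le_of_norm_le hp hu⟩
    exact hlim.momentEquation hbar (hν.timeDualBdd hconv.memPT_limit.isProbabilityMeasure
      (hb₀.slice.mono fun t ht => ht.bound)) k
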